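/- **Setting.** Let $d\ge 1$, let $\tilde{\mathcal M}$ be a $d$-dimensional $C^2$ manifold without boundary (Hausdorff, second countable) with a $C^1$ Riemannian metric $g$, and let $\mathcal M\subset\tilde{\mathcal M}$ be a compact connected domain with $C^2$ boundary: each point of $\partial\mathcal M$ lies in a $C^2$ chart of $\tilde{\mathcal M}$ with coordinates $x=(x',z)$ in which $\mathcal M=\{z\ge 0\}$ (an adapted chart). Write $\varrho=(t,x;\tau,\xi)$ for the points of $T^*(\mathbb R\times\tilde{\mathcal M})$, put $p(\varrho)=-\tau^2+|\xi|_x^2$ with $|\xi|_x^2=g^*_x(\xi,\xi)$, and let $H_p$ be its Hamiltonian vector field, $H_p h=\{p,h\}=\partial_\tau p\,\partial_t h+\nabla_\xi p\cdot\nabla_x h-\nabla_x p\cdot\nabla_\xi h$. For $x\in\partial\mathcal M$ let $\mathsf n_x$ be the inward unit normal vector and $\mathsf n^*_x=g_x(\mathsf n_x,\cdot)$. Define $$\partial_\parallel=\{\varrho:\ x\in\partial\mathcal M,\ g^*_x(\xi,\mathsf n^*_x)=0\},\quad \mathcal H=\partial_\parallel\cap\{p<0\},\quad \mathcal G=\partial_\parallel\cap\{p=0\},$$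 and, in adapted charts, the diffractive set $\mathcal G^{d}=\{\varrho\in\mathcal G: H_p^2z(\varrho)>0\}$ and the glancing set of order three $\mathcal G^{3}=\{\varrho\in\mathcal G: H_p^2z(\varrho)=0\}$. For $\varrho\in\mathcal H\cup\mathcal G$ put $\varrho^\pm=(t,x;\tau,\xi^\pm)$, $\xi^\pm=\xi\pm\sqrt{-p(\varrho)}\,\mathsf n_x^*$; thus $\varrho^\pm=\varrho$ on $\mathcal G$. **Assumptions.** Let $\mathscr U\subset T^*(\mathbb R\times\tilde{\mathcal M})$ be open, $\mu$ a nonnegative Radon measure on $\mathscr U$, $\nu$ a nonnegative Radon measure on $\partial_\parallel$, and $f$ a real continuous function on $T^*(\mathbb R\times\tilde{\mathcal M})$. Assume: 1. the support of $\mu$ (in $\mathscr U$) is contained in $\{p=0\}\cap T^*(\mathbb R\times\mathcal M)\cap\{(\tau,\xi)\ne 0\}$; 2. in the sense of distributions in $\mathscr U$ (tested on compactly supported $C^1$ functions), $${}^tH_p\mu=f\mu-\int_{\mathcal H\cup\mathcal G}\frac{\delta_{\varrho^+}-\delta_{\varrho^-}}{\langle\xi^+-\xi^-,\mathsf n_x\rangle}\,d\nu(\varrho),$$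 where, for $\varrho\in\mathcal G$, the integrand paired with a test function $q$ means $\frac{d}{ds}q(t,x;\tau,\xi+s\,\mathsf n^*_x)|_{s=0}$. **Conclusion.** Let $S=\operatorname{supp}(\nu|_{\mathcal H\cup\mathcal G})$, a subset of $\mathcal H\cup\mathcal G$. * (i) Suppose that $\mathscr U=T^*(\mathbb R\times\tilde{\mathcal M})$, or that $\mu$ vanishes in a uniform neighborhood of the zero section, that is, $\mu(\{\tau^2+|\xi|_x^2<c^2\})=0$ for some $c>0$. Then there is $C>0$ such that $|\tau|\ge C$ at every $\varrho\in S$ with $\varrho^+\in\mathscr U$ or $\varrho^-\in\mathscr U$. * (i') In all cases, for every compact $K\subset\mathscr U$ there is $C>0$ such that $|\tau|\ge C$ at every $\varrho\in S$ with $\varrho^+\in K$ or $\varrho^-\in K$. * (ii) $\nu\big(\mathscr U\cap(\mathcal G^{d}\cup\mathcal G^{3})\big)=0$. * (iii) $\mu(\mathcal G^{d})=0$. -/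

import Mathlib

open Set Filter Topology MeasureTheory Bundle Manifold

noncomputable section

namespace GeometricWave

/-! ### Phase space

`N` is a manifold of class `C²` and dimension `n + 1`, without boundary. Points of the cotangent
bundle of `ℝ × N` are written `(t, τ, (m, ξ))` with `ξ` a covector at `m`. -/

/-- The coordinate space `ℝᵈ`, with `d = n + 1`. -/
abbrev Eucl (n : ℕ) : Type := EuclideanSpace ℝ (Fin (n + 1))

/-- Covectors at `m`. -/
abbrev Covector (n : ℕ) (N : Type*) [TopologicalSpace N] [ChartedSpace (Eucl n) N] (m : N) :
    Type :=
  TangentSpace 𝓘(ℝ, Eucl n) m →L[ℝ] ℝ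

/-- The cotangent bundle `T*N`, with the topology of a vector bundle. -/
abbrev CotBundle (n : ℕ) (N : Type*) [TopologicalSpace N] [ChartedSpace (Eucl n) N] : Type _ :=
  TotalSpace (Eucl n →L[ℝ] ℝ) (fun m : N => Covector n N m)

/-- The cotangent bundle `T*(ℝ × N)`, a point being `(t, τ, (m, ξ))`. -/
abbrev Phase (n : ℕ) (N : Type*) [TopologicalSpace N] [ChartedSpace (Eucl n) N] : Type _ :=
  ℝ × ℝ × CotBundle n N

/-- Riemannian metrics of class `C¹` on `N`. -/
abbrev Metric1 (n : ℕ) (N : Type*) [TopologicalSpace N] [ChartedSpace (Eucl n) N]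
    [IsManifold 𝓘(ℝ, Eucl n) 2 N] : Type _ :=
  ContMDiffRiemannianMetric 𝓘(ℝ, Eucl n) 1 (Eucl n) (fun m : N => TangentSpace 𝓘(ℝ, Eucl n) m)

/-- Canonical coordinates `(t, x, τ, ξ)` of phase space. -/
abbrev Coord (n : ℕ) : Type := ℝ × Eucl n × ℝ × Eucl n

/-- The standard basis of `ℝᵈ`. -/
def stdVec (n : ℕ) (i : Fin (n + 1)) : Eucl n := EuclideanSpace.single i 1

/-- The Poisson bracket `{f, h}` in canonical coordinates `(t, x, τ, ξ)`:
`∂_τ f ∂_t h - ∂_t f ∂_τ h + ∑ᵢ (∂_{ξᵢ} f ∂_{xᵢ} h - ∂_{xᵢ} f ∂_{ξᵢ} h)`. -/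
def poisson {n : ℕ} (f h : Coord n → ℝ) (y : Coord n) : ℝ :=
  fderiv ℝ f y (0, 0, 1, 0) * fderiv ℝ h y (1, 0, 0, 0)
    - fderiv ℝ f y (1, 0, 0, 0) * fderiv ℝ h y (0, 0, 1, 0)
    + ∑ i : Fin (n + 1),
      (fderiv ℝ f y (0, 0, 0, stdVec n i) * fderiv ℝ h y (0, stdVec n i, 0, 0)
        - fderiv ℝ f y (0, stdVec n i, 0, 0) * fderiv ℝ h y (0, 0, 0, stdVec n i))

variable {n : ℕ} {N : Type*} [TopologicalSpace N] [ChartedSpace (Eucl n) N]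

instance instMeasurableSpaceCotBundle [IsManifold 𝓘(ℝ, Eucl n) 2 N] :
    MeasurableSpace (CotBundle n N) := borel _

instance instBorelSpaceCotBundle [IsManifold 𝓘(ℝ, Eucl n) 2 N] :
    BorelSpace (CotBundle n N) := ⟨rfl⟩

/-- The dual variable `τ` of time. -/
def tau (ρ : Phase n N) : ℝ := ρ.2.1

/-- The point of `N` below `ρ`. -/
def base (ρ : Phase n N) : N := ρ.2.2.1

/-- The covector `ξ` of `ρ = (t, m; τ, ξ)`. -/
def cov (ρ : Phase n N) : Covector n N (base ρ) := ρ.2.2.2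

/-- The translate `(t, m; τ, ξ + η)` of `ρ = (t, m; τ, ξ)`. -/
def addCov (ρ : Phase n N) (η : Covector n N (base ρ)) : Phase n N :=
  (ρ.1, ρ.2.1, ⟨base ρ, cov ρ + η⟩)

/-! ### Charts and Hamiltonian vector fields -/

/-- Canonical coordinates of phase space associated with a chart `e` of `N`; the components of `ξ`
are its values on the coordinate vector fields. Meaningful over the domain of `e`. -/
def toCoord (e : OpenPartialHomeomorph N (Eucl n)) (ρ : Phase n N) : Coord n :=
  (ρ.1, e (base ρ), tau ρ,
    WithLp.toLp 2 fun i : Fin (n + 1) =>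
      cov ρ ((mfderiv 𝓘(ℝ, Eucl n) 𝓘(ℝ, Eucl n) e (base ρ)).inverse (stdVec n i)))

/-- The point with canonical coordinates `(t, x, τ, ω)` in the chart `e`, that is, the covector
`∑ᵢ ωᵢ dxᵢ` at the point `e⁻¹(x)`. Meaningful for `x` in the target of `e`. -/
def ofCoord (e : OpenPartialHomeomorph N (Eucl n)) (y : Coord n) : Phase n N :=
  (y.1, y.2.2.1, ⟨e.symm y.2.1,
    (innerSL ℝ y.2.2.2).comp (mfderiv 𝓘(ℝ, Eucl n) 𝓘(ℝ, Eucl n) e (e.symm y.2.1))⟩)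

/-- `H_h q = {h, q}` computed in the chart `e`; over the domain of `e` the value does not depend
on the chart. -/
def ham (e : OpenPartialHomeomorph N (Eucl n)) (h q : Phase n N → ℝ) (ρ : Phase n N) : ℝ :=
  poisson (h ∘ ofCoord e) (q ∘ ofCoord e) (toCoord e ρ)

/-- The last coordinate function `z = x_d` of the chart `e`, as a function on phase space. -/
def zfun (e : OpenPartialHomeomorph N (Eucl n)) (ρ : Phase n N) : ℝ :=
  e (base ρ) (Fin.last n)

/-- The covector `dz = dx_d` of the chart `e` at `m`. -/
def dz (e : OpenPartialHomeomorph N (Eucl n)) (m : N) : Covector n N m :=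
  (innerSL ℝ (stdVec n (Fin.last n))).comp (mfderiv 𝓘(ℝ, Eucl n) 𝓘(ℝ, Eucl n) e m)

variable [IsManifold 𝓘(ℝ, Eucl n) 2 N]

/-- The `C²` charts `e` of `N` adapted to `M`: within the chart, `M` is `{z ≥ 0}`. -/
def IsAdaptedChart (M : Set N) (e : OpenPartialHomeomorph N (Eucl n)) : Prop :=
  e ∈ IsManifold.maximalAtlas 𝓘(ℝ, Eucl n) 2 N ∧
    ∀ m ∈ e.source, (m ∈ M ↔ 0 ≤ e m (Fin.last n))

/-- `M` is a compact connected domain of `N` with boundary of class `C²`, that is, a compact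
connected `C²` manifold with boundary, of the same dimension as `N`. Its boundary as a manifold is
its frontier in `N`. -/
structure IsCompactC2Domain (M : Set N) : Prop where
  isCompact : IsCompact M
  isConnected : IsConnected M
  exists_chart : ∀ m ∈ frontier M,
    ∃ e : OpenPartialHomeomorph N (Eucl n), IsAdaptedChart M e ∧ m ∈ e.source

/-! ### Metric notions -/

/-- The musical isomorphism `♯ : T*_m N → T_m N`, inverse of `v ↦ g(v, ·)`. -/
def sharp (g : Metric1 n N) (m : N) (ξ : Covector n N m) : TangentSpace 𝓘(ℝ, Eucl n) m :=
  (g.inner m).inverse ξ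

/-- The inner product `g*_m(ξ, η)` on covectors. -/
def cometric (g : Metric1 n N) (m : N) (ξ η : Covector n N m) : ℝ := η (sharp g m ξ)

/-- The symbol `p(t, x; τ, ξ) = -τ² + |ξ|²_x` of the wave operator. -/
def symb (g : Metric1 n N) (ρ : Phase n N) : ℝ :=
  -(tau ρ) ^ 2 + cometric g (base ρ) (cov ρ) (cov ρ)

open Classical in
/-- The unit conormal covector `n*_m = dz / |dz|` at a boundary point `m` of `M`, `z` being the last
coordinate of any adapted chart around `m`; it does not depend on that chart. -/
def conormal (g : Metric1 n N) (M : Set N) (m : N) : Covector n N m :=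
  if h : ∃ e : OpenPartialHomeomorph N (Eucl n), IsAdaptedChart M e ∧ m ∈ e.source then
    (Real.sqrt (cometric g m (dz h.choose m) (dz h.choose m)))⁻¹ • dz h.choose m
  else 0

/-- The inward pointing unit normal vector `n_m` at a boundary point `m` of `M`. -/
def normal (g : Metric1 n N) (M : Set N) (m : N) : TangentSpace 𝓘(ℝ, Eucl n) m :=
  sharp g m (conormal g M m)

/-! ### Partition of the cotangent bundle at the boundary -/

/-- The bundle of the points `(t, x; τ, ξ)` with `x ∈ ∂M` and `ξ` orthogonal to the conormal. -/
def tangentialBundle (g : Metric1 n N) (M : Set N) : Set (Phase n N) :=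
  {ρ | base ρ ∈ frontier M ∧ cometric g (base ρ) (cov ρ) (conormal g M (base ρ)) = 0}

/-- The hyperbolic region. -/
def hyperbolic (g : Metric1 n N) (M : Set N) : Set (Phase n N) :=
  {ρ | ρ ∈ tangentialBundle g M ∧ symb g ρ < 0}

/-- The glancing region. -/
def glancing (g : Metric1 n N) (M : Set N) : Set (Phase n N) :=
  {ρ | ρ ∈ tangentialBundle g M ∧ symb g ρ = 0}

/-- The diffractive set: glancing points where `H_p² z > 0`. The sign of `H_p² z` at a glancing
point does not depend on the adapted chart. -/
def diffractive (g : Metric1 n N) (M : Set N) : Set (Phase n N) :=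
  {ρ | ρ ∈ glancing g M ∧ ∃ e : OpenPartialHomeomorph N (Eucl n),
    IsAdaptedChart M e ∧ base ρ ∈ e.source ∧ 0 < ham e (symb g) (ham e (symb g) (zfun e)) ρ}

/-- The glancing set of order three: glancing points where `H_p² z = 0`. -/
def glancing3 (g : Metric1 n N) (M : Set N) : Set (Phase n N) :=
  {ρ | ρ ∈ glancing g M ∧ ∃ e : OpenPartialHomeomorph N (Eucl n),
    IsAdaptedChart M e ∧ base ρ ∈ e.source ∧ ham e (symb g) (ham e (symb g) (zfun e)) ρ = 0}

/-- The point `(t, x; τ, ξ + s n*_x)`. -/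
def shift (g : Metric1 n N) (M : Set N) (s : ℝ) (ρ : Phase n N) : Phase n N :=
  addCov ρ (s • conormal g M (base ρ))

/-- `ρ⁺ = (t, x; τ, ξ + λ n*_x)` with `λ = √(-p(ρ))`; it is `ρ` at a glancing point. -/
def liftPlus (g : Metric1 n N) (M : Set N) (ρ : Phase n N) : Phase n N :=
  shift g M (Real.sqrt (-symb g ρ)) ρ

/-- `ρ⁻ = (t, x; τ, ξ - λ n*_x)` with `λ = √(-p(ρ))`; it is `ρ` at a glancing point. -/
def liftMinus (g : Metric1 n N) (M : Set N) (ρ : Phase n N) : Phase n N :=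
  shift g M (-Real.sqrt (-symb g ρ)) ρ

open Classical in
/-- The pairing of `(δ_{ρ⁺} - δ_{ρ⁻}) / ⟨ξ⁺ - ξ⁻, n_x⟩` with a test function `q`. At a glancing point
it is understood as its limit along hyperbolic points, the derivative of `q` at `ρ` in the
direction of the conormal `n*_x`. -/
def sourcePairing (g : Metric1 n N) (M : Set N) (q : Phase n N → ℝ) (ρ : Phase n N) : ℝ :=
  if symb g ρ < 0 then
    (q (liftPlus g M ρ) - q (liftMinus g M ρ)) /
      (cov (liftPlus g M ρ) (normal g M (base ρ)) - cov (liftMinus g M ρ) (normal g M (base ρ)))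
  else deriv (fun s : ℝ => q (shift g M s ρ)) 0

/-! ### The two assumptions on the measure -/

/-- The part of phase space above the domain of the chart `e`. -/
def above (e : OpenPartialHomeomorph N (Eucl n)) : Set (Phase n N) := {ρ | base ρ ∈ e.source}

/-- `q` is a `C¹` function with compact support in the part of `U` above the domain of `e`. -/
structure IsTestFunction (U : Set (Phase n N)) (e : OpenPartialHomeomorph N (Eucl n))
    (q : Phase n N → ℝ) : Prop where
  hasCompactSupport : HasCompactSupport q
  tsupport_subset : tsupport q ⊆ U ∩ above e
  contDiffOn : ContDiffOn ℝ 1 (q ∘ ofCoord e) {y | y.2.1 ∈ e.target}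

/-- `μ` is a nonnegative (Radon) measure on the open set `U`. -/
structure IsMeasureOn (U : Set (Phase n N)) (μ : Measure (Phase n N)) : Prop where
  measure_compl : μ Uᶜ = 0
  measure_lt_top : ∀ K : Set (Phase n N), IsCompact K → K ⊆ U → μ K < ⊤

/-- The support of `μ` in `U` lies in `Char p ∩ T*(ℝ × M) \ 0`. -/
def SupportAssumption (g : Metric1 n N) (M : Set N) (U : Set (Phase n N))
    (μ : Measure (Phase n N)) : Prop :=
  ∀ ρ ∈ U ∩ μ.support, symb g ρ = 0 ∧ base ρ ∈ M ∧ ¬ (tau ρ = 0 ∧ cov ρ = 0)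

/-- The measure equation `ᵗH_p μ = f μ - ∫ (δ_{ρ⁺} - δ_{ρ⁻}) / ⟨ξ⁺ - ξ⁻, n_x⟩ dν(ρ)` in the sense of
distributions in `U`, the integral being over the hyperbolic and glancing regions. It is tested
on the `C¹` functions with compact support in `U` above the domain of a `C²` chart. -/
def MeasureEquation (g : Metric1 n N) (M : Set N) (U : Set (Phase n N))
    (f : Phase n N → ℝ) (μ ν : Measure (Phase n N)) : Prop :=
  ∀ e ∈ IsManifold.maximalAtlas 𝓘(ℝ, Eucl n) 2 N, ∀ q : Phase n N → ℝ, IsTestFunction U e q →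
    ∫ ρ in above e, ham e (symb g) q ρ ∂μ =
      (∫ ρ in above e, f ρ * q ρ ∂μ)
        - ∫ ρ in (hyperbolic g M ∪ glancing g M) ∩ above e, sourcePairing g M q ρ ∂ν

end GeometricWave

end

set_option linter.unusedSectionVars false
set_option linter.unusedSimpArgs false

noncomputable section

namespace GeometricWave

section

variable {n : ℕ} {N : Type*} [TopologicalSpace N] [ChartedSpace (Eucl n) N]

/-! ### Topology of phase space. -/

section Topology

variable [IsManifold 𝓘(ℝ, Eucl n) 2 N]

/-! Everything comes from inserting well-chosen test functions into the measure equation. Two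
families are used: multiples of `zeta`, that is of ζ = H_p z / 2, which make the source term visible
with a sign, and functions of (t, x, τ, p), which do not see the source at all.

Along the conormal line through a tangential point, ζ is linear: its value at ξ + s n* is s|dz|.
Hence the source pairs with Ψζ to give |dz| times the mean of Ψ at the two lifts, at hyperbolic and
glancing points alike (`sourcePairing_extend`). If μ vanished near a lift lying in U of a point of
S, a bump Ψ ≥ 0 at that lift would kill both μ-integrals and leave a positive ν-integral. So such
lifts belong to supp μ (`lift_mem_support`). There p = 0 and (τ, ξ) ≠ 0, so τ ≠ 0. The lifts keep τ,
and compactness gives (i'). If μ vanishes for τ² + |ξ|² < c², then p = 0 gives 2τ² ≥ c² at the lift,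
which is (i) in that case.

For U the whole phase space, time is not compact and a uniform gap must be produced. A test function
a(t)c(τ)β(x)η(p) takes equal values at the two lifts, since p does (`sourcePairing_prodTest`). Both
τ and p are conserved by H_p, and t moves with speed -2τ. Compactness excludes 0 < |τ| < ε from supp
μ for |t| ≤ 1. A weighted estimate in time, with weight exp(-l t²) cut off at |t| = T, propagates
this to all times with the same ε (`measure_slab_eq_zero`). The constant l depends on T and on a
lower bound δ for |τ|, but ε does not.

For (ii) and (iii), take Ψ = ψ^(k+1) · lor((k+1)ζ) · lor((k+1)² z) with lor(s) = 1/(1+s²), where {ψ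
= 1} is a closed set of glancing points with H_p² z ≥ 0. The scaling is parabolic because H_p z =
2ζ. All terms of H_p(Ψζ) stay bounded and tend to 0, apart from Ψ H_p ζ. In the limit the integral
of H_p ζ over {ψ = 1} against μ equals minus the integral of |dz| against ν (`exists_nhds_null`).
The two sides have opposite signs, so both vanish: ν has no mass where H_p² z ≥ 0 and μ none where
H_p² z > 0. For ν the sign of H_p² z must be compared between adapted charts (`exists_kap_eq`),
which rests on the symplectic invariance of the Poisson bracket. -/

instance instT2SpaceCotBundle [T2Space N] : T2Space (CotBundle n N) := by
  refine ⟨fun a b hab => ?_⟩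
  by_cases h : a.1 = b.1
  · let e := trivializationAt (Eucl n →L[ℝ] ℝ) (fun m : N => Covector n N m) a.1
    have ha : a ∈ e.source := by
      rw [e.mem_source]; exact FiberBundle.mem_baseSet_trivializationAt' a.1
    have hb : b ∈ e.source := by
      rw [e.mem_source]
      show b.1 ∈ _
      rw [← h]; exact FiberBundle.mem_baseSet_trivializationAt' a.1
    have hne : e a ≠ e b := fun hh => hab (e.injOn ha hb hh)
    obtain ⟨u, v, hu, hv, hau, hbv, huv⟩ := t2_separation hne
    refine ⟨e.source ∩ e ⁻¹' u, e.source ∩ e ⁻¹' v,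
      e.continuousOn.isOpen_inter_preimage e.open_source hu,
      e.continuousOn.isOpen_inter_preimage e.open_source hv, ⟨ha, hau⟩, ⟨hb, hbv⟩, ?_⟩
    rw [Set.disjoint_left]
    rintro x ⟨_, hx⟩ ⟨_, hx'⟩
    exact Set.disjoint_left.1 huv hx hx'
  · obtain ⟨u, v, hu, hv, hau, hbv, huv⟩ := t2_separation h
    have hc : Continuous (fun x : CotBundle n N => x.1) := FiberBundle.continuous_proj _ _
    exact ⟨_, _, hu.preimage hc, hv.preimage hc, hau, hbv, huv.preimage _⟩

/-- Needed so that the product σ-algebra of phase space is the Borel one and so that a measure is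
carried by its support. -/
instance instSecondCountableCotBundle [SecondCountableTopology N] :
    SecondCountableTopology (CotBundle n N) := by
  obtain ⟨s, hs, hs'⟩ := TopologicalSpace.countable_cover_nhds (α := N)
    (f := fun m => (trivializationAt (Eucl n →L[ℝ] ℝ) (fun m : N => Covector n N m) m).baseSet)
    (fun m => (trivializationAt (Eucl n →L[ℝ] ℝ) (fun m : N => Covector n N m) m).open_baseSet.mem_nhds
      (FiberBundle.mem_baseSet_trivializationAt' m))
  have := hs.to_subtype
  let e := fun m : N => trivializationAt (Eucl n →L[ℝ] ℝ) (fun m : N => Covector n N m) m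
  have : ∀ i : s, SecondCountableTopology (e i).source := fun i =>
    ((e i).toOpenPartialHomeomorph.toHomeomorphSourceTarget).isInducing.secondCountableTopology
  refine TopologicalSpace.secondCountableTopology_of_countable_cover (U := fun i : s => (e i).source)
    (fun i => (e i).open_source) ?_
  rw [eq_univ_iff_forall]
  intro x
  have : x.1 ∈ ⋃ m ∈ s, (e m).baseSet := by rw [hs']; trivial
  simp only [mem_iUnion] at this
  obtain ⟨m, hm, hx⟩ := this
  exact mem_iUnion.2 ⟨⟨m, hm⟩, (e m).mem_source.2 hx⟩

end Topology

lemma continuous_base [IsManifold 𝓘(ℝ, Eucl n) 2 N] : Continuous (base : Phase n N → N) :=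
  (FiberBundle.continuous_proj _ _).comp (continuous_snd.comp continuous_snd)

lemma continuous_tau [IsManifold 𝓘(ℝ, Eucl n) 2 N] : Continuous (tau : Phase n N → ℝ) :=
  continuous_fst.comp continuous_snd

lemma isOpen_above [IsManifold 𝓘(ℝ, Eucl n) 2 N] (e : OpenPartialHomeomorph N (Eucl n)) :
    IsOpen (above e : Set (Phase n N)) :=
  e.open_source.preimage continuous_base

/-! ### Canonical coordinates over a chart. -/

section Charts

variable [IsManifold 𝓘(ℝ, Eucl n) 2 N] {e : OpenPartialHomeomorph N (Eucl n)}
  (he : e ∈ IsManifold.maximalAtlas 𝓘(ℝ, Eucl n) 2 N)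
include he

lemma mdifferentiable_chart : e.MDifferentiable 𝓘(ℝ, Eucl n) 𝓘(ℝ, Eucl n) :=
  ⟨(contMDiffOn_of_mem_maximalAtlas he).mdifferentiableOn (by norm_num),
    (contMDiffOn_symm_of_mem_maximalAtlas he).mdifferentiableOn (by norm_num)⟩

/-- The differential of a chart at a point of its domain. -/
def chartDiff {m : N} (hm : m ∈ e.source) : TangentSpace 𝓘(ℝ, Eucl n) m ≃L[ℝ] Eucl n :=
  (mdifferentiable_chart he).mfderiv hm

/-- `ContinuousLinearMap.inverse` is 0 on non-invertible maps; over the domain of a chart it is the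
genuine inverse. -/
lemma inverse_mfderiv_chart {m : N} (hm : m ∈ e.source) :
    (mfderiv 𝓘(ℝ, Eucl n) 𝓘(ℝ, Eucl n) e m).inverse =
      ((chartDiff he hm).symm : Eucl n →L[ℝ] TangentSpace 𝓘(ℝ, Eucl n) m) :=
  ContinuousLinearMap.inverse_equiv (chartDiff he hm)

lemma toCoord_apply {ρ : Phase n N} (hρ : ρ ∈ above e) (i : Fin (n + 1)) :
    (toCoord e ρ).2.2.2 i = cov ρ ((chartDiff he hρ).symm (stdVec n i)) := by
  exact congrArg (fun L : Eucl n →L[ℝ] TangentSpace 𝓘(ℝ, Eucl n) (base ρ) => cov ρ (L (stdVec n i)))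
    (inverse_mfderiv_chart he hρ)

/-- Characterises the fibre coordinate by duality, so that later identities are checked against an
arbitrary vector and not by components. -/
lemma inner_toCoord {ρ : Phase n N} (hρ : ρ ∈ above e) (v : Eucl n) :
    inner ℝ (toCoord e ρ).2.2.2 v = cov ρ ((chartDiff he hρ).symm v) := by
  have hv : v = ∑ i, v i • stdVec n i := by
    have := (EuclideanSpace.basisFun (Fin (n + 1)) ℝ).sum_repr v
    simpa [stdVec] using this.symm
  conv_rhs => rw [hv]
  rw [map_sum, map_sum, PiLp.inner_apply]
  refine Finset.sum_congr rfl fun i _ => ?_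
  rw [map_smul, map_smul, toCoord_apply he hρ]
  simp

lemma cov_apply {ρ : Phase n N} (hρ : ρ ∈ above e) (v : TangentSpace 𝓘(ℝ, Eucl n) (base ρ)) :
    cov ρ v = inner ℝ (toCoord e ρ).2.2.2 (chartDiff he hρ v) := by
  rw [inner_toCoord he hρ, ContinuousLinearEquiv.symm_apply_apply]

lemma toCoord_mem_target {ρ : Phase n N} (hρ : ρ ∈ above e) : (toCoord e ρ).2.1 ∈ e.target :=
  e.map_source hρ

omit he in
lemma ofCoord_mem_above {y : Coord n} (hy : y.2.1 ∈ e.target) : ofCoord e y ∈ above e :=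
  e.map_target hy

lemma ofCoord_toCoord {ρ : Phase n N} (hρ : ρ ∈ above e) : ofCoord e (toCoord e ρ) = ρ := by
  obtain ⟨t, τ, m, ξ⟩ := ρ
  have hm : m ∈ e.source := hρ
  have h1 : e.symm (e m) = m := e.left_inv hm
  have key : (⟨e.symm (e m), (innerSL ℝ (toCoord e (t, τ, ⟨m, ξ⟩)).2.2.2).comp
      (mfderiv 𝓘(ℝ, Eucl n) 𝓘(ℝ, Eucl n) e (e.symm (e m)))⟩ : CotBundle n N) = ⟨m, ξ⟩ := by
    rw [h1]
    congr 1
    ext v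
    exact (cov_apply he hρ v).symm
  exact Prod.ext rfl (Prod.ext rfl key)

lemma toCoord_ofCoord {y : Coord n} (hy : y.2.1 ∈ e.target) : toCoord e (ofCoord e y) = y := by
  obtain ⟨t, x, τ, ω⟩ := y
  have hρ := ofCoord_mem_above (N := N) (e := e) hy
  refine Prod.ext rfl (Prod.ext (e.right_inv hy) (Prod.ext rfl ?_))
  refine ext_inner_right ℝ fun v => ?_
  rw [inner_toCoord he hρ]
  show inner ℝ ω (chartDiff he hρ ((chartDiff he hρ).symm v)) = _
  rw [ContinuousLinearEquiv.apply_symm_apply]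

/-- In a hom bundle, continuity is tested in tangent coordinates, where it reduces to the continuity
of the differential of a C² chart. -/
lemma continuousOn_ofCoord : ContinuousOn (ofCoord e : Coord n → Phase n N) {y | y.2.1 ∈ e.target} := by
  have hx : ContinuousOn (fun y : Coord n => e.symm y.2.1) {y | y.2.1 ∈ e.target} :=
    e.continuousOn_symm.comp (by fun_prop) fun y hy => hy
  have key : ContinuousOn (fun y : Coord n => (ofCoord e y : Phase n N).2.2)
      {y | y.2.1 ∈ e.target} := by
    intro y₀ hy₀
    have hopen : IsOpen {y : Coord n | y.2.1 ∈ e.target} := e.open_target.preimage (by fun_prop)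
    have hxy := (hx y₀ hy₀).continuousAt (hopen.mem_nhds hy₀)
    refine ContinuousAt.continuousWithinAt ?_
    rw [continuousAt_hom_bundle]
    refine ⟨hxy, ?_⟩
    have hd := (((contMDiffOn_of_mem_maximalAtlas he).contMDiffAt
      (e.open_source.mem_nhds (e.map_target hy₀))).mfderiv_const
      (m := 1) (by norm_num)).continuousAt
    have hd' := ContinuousAt.comp (f := fun y : Coord n => e.symm y.2.1) (x := y₀) hd hxy
    have hω : ContinuousAt (fun y : Coord n => innerSL ℝ y.2.2.2) y₀ := by fun_prop
    refine (hω.clm_comp hd').congr (Eventually.of_forall fun y => ?_)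
    ext v
    simp [inTangentCoordinates, ContinuousLinearMap.inCoordinates, ofCoord]
    rfl
  exact continuousOn_fst.prodMk ((by fun_prop : ContinuousOn (fun y : Coord n => y.2.2.1) _).prodMk key)

/-- The coordinate vector fields of a chart, as sections of the tangent bundle. -/
lemma contMDiffOn_coordField (v : Eucl n) :
    ContMDiffOn 𝓘(ℝ, Eucl n) (𝓘(ℝ, Eucl n).prod 𝓘(ℝ, Eucl n)) 1
      (fun x : Eucl n => (TotalSpace.mk' (Eucl n) (E := fun m : N => TangentSpace 𝓘(ℝ, Eucl n) m) (e.symm x)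
        (mfderiv 𝓘(ℝ, Eucl n) 𝓘(ℝ, Eucl n) e.symm x v)))
      e.target := by
  have h := (contMDiffOn_symm_of_mem_maximalAtlas he).contMDiffOn_tangentMapWithin
    (m := 1) (by norm_num) e.open_target.uniqueMDiffOn
  have h2 : ContMDiff 𝓘(ℝ, Eucl n) (𝓘(ℝ, Eucl n).prod 𝓘(ℝ, Eucl n)) 1
      (fun x : Eucl n => (⟨x, v⟩ : TangentBundle 𝓘(ℝ, Eucl n) (Eucl n))) := by
    intro x
    rw [contMDiffAt_totalSpace]
    refine ⟨contMDiffAt_id, ?_⟩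
    simpa using contMDiffAt_const
  refine (h.comp h2.contMDiffOn (fun x hx => hx)).congr fun x hx => ?_
  simp only [Function.comp, tangentMapWithin]
  rw [mfderivWithin_of_isOpen e.open_target hx]

lemma continuousOn_toCoord : ContinuousOn (toCoord e : Phase n N → Coord n) (above e) := by
  have hb : ContinuousOn (fun ρ : Phase n N => e (base ρ)) (above e) :=
    e.continuousOn.comp continuous_base.continuousOn fun ρ hρ => hρ
  have hω : ContinuousOn (fun ρ : Phase n N => (toCoord e ρ).2.2.2) (above e) := by
    refine (PiLp.continuous_toLp 2 _).comp_continuousOn (continuousOn_pi.2 fun i => ?_)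
    have hv := (contMDiffOn_coordField he (N := N) (stdVec n i)).continuousOn.comp hb
      (fun ρ hρ => e.map_source hρ)
    have hξ : ContinuousOn (fun ρ : Phase n N => ρ.2.2) (above e) := by fun_prop
    intro ρ₀ hρ₀
    have hbv : ContinuousWithinAt (fun ρ : Phase n N => TotalSpace.mk' (Eucl n)
        (E := fun m : N => TangentSpace 𝓘(ℝ, Eucl n) m) (base ρ)
        ((mfderiv 𝓘(ℝ, Eucl n) 𝓘(ℝ, Eucl n) e (base ρ)).inverse (stdVec n i))) (above e) ρ₀ := by
      refine (hv ρ₀ hρ₀).congr_of_mem (fun ρ hρ => ?_) hρ₀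
      have aux : ∀ (m m' : N) (u : Eucl n), m = m' →
          TotalSpace.mk' (Eucl n) (E := fun m : N => TangentSpace 𝓘(ℝ, Eucl n) m) m u =
          TotalSpace.mk' (Eucl n) (E := fun m : N => TangentSpace 𝓘(ℝ, Eucl n) m) m' u := by
        rintro m _ u rfl; rfl
      rw [inverse_mfderiv_chart he hρ]
      exact aux _ _ _ (e.left_inv hρ).symm
    have := ContinuousWithinAt.clm_bundle_apply (F₂ := ℝ) (E₂ := fun _ : N => ℝ) (hξ ρ₀ hρ₀) hbv
    rw [FiberBundle.continuousWithinAt_totalSpace] at this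
    exact this.2
  exact continuousOn_fst.prodMk (hb.prodMk (continuous_tau.continuousOn.prodMk hω))

end Charts

end

/-! ### The metric and the wave symbol in a chart. -/

section

variable {n : ℕ} {N : Type*} [TopologicalSpace N] [ChartedSpace (Eucl n) N]

/-- The real inner product of `ℝᵈ` as a continuous bilinear map. -/
def innerL (n : ℕ) : Eucl n →L[ℝ] Eucl n →L[ℝ] ℝ :=
  (isBoundedBilinearMap_inner (𝕜 := ℝ) (E := Eucl n)).toContinuousLinearMap

lemma innerL_apply (u v : Eucl n) : innerL n u v = inner ℝ u v := rfl

/-- A positive definite form has trivial kernel, hence is invertible by dimension; this keeps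
`sharp` and `cogram` away from the default value 0 of `inverse`. -/
lemma exists_equiv_of_pos (b : Eucl n →L[ℝ] Eucl n →L[ℝ] ℝ) (hb : ∀ v, v ≠ 0 → 0 < b v v) :
    ∃ A : Eucl n ≃L[ℝ] (Eucl n →L[ℝ] ℝ), (A : Eucl n →L[ℝ] Eucl n →L[ℝ] ℝ) = b := by
  have hinj : Function.Injective b.toLinearMap := by
    rw [← LinearMap.ker_eq_bot, LinearMap.ker_eq_bot']
    intro v hv
    by_contra h
    have := hb v h
    have h0 : b v = 0 := hv
    rw [h0] at this
    simp at this
  have hfr : Module.finrank ℝ (Eucl n) = Module.finrank ℝ (Eucl n →L[ℝ] ℝ) := by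
    rw [← (LinearMap.toContinuousLinearMap (𝕜 := ℝ) (E := Eucl n) (F' := ℝ)).finrank_eq,
      Module.finrank_linearMap, Module.finrank_self, mul_one]
  exact ⟨(b.toLinearMap.linearEquivOfInjective hinj hfr).toContinuousLinearEquiv, by ext; rfl⟩

/-- Coordinates of a covector in a chart. -/
def covCoord (e : OpenPartialHomeomorph N (Eucl n)) (m : N) (ξ : Covector n N m) : Eucl n :=
  WithLp.toLp 2 fun i : Fin (n + 1) =>
      ξ ((mfderiv 𝓘(ℝ, Eucl n) 𝓘(ℝ, Eucl n) e m).inverse (stdVec n i))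

variable [IsManifold 𝓘(ℝ, Eucl n) 2 N]

/-- The Gram bilinear form of the metric in a chart. -/
def gram (g : Metric1 n N) (e : OpenPartialHomeomorph N (Eucl n)) (x : Eucl n) :
    Eucl n →L[ℝ] Eucl n →L[ℝ] ℝ :=
  let D : Eucl n →L[ℝ] Eucl n := mfderiv 𝓘(ℝ, Eucl n) 𝓘(ℝ, Eucl n) e.symm x
  let b : Eucl n →L[ℝ] Eucl n →L[ℝ] ℝ := g.inner (e.symm x)
  b.bilinearComp D D

/-- The matrix of the dual metric in a chart. -/
def cogram (g : Metric1 n N) (e : OpenPartialHomeomorph N (Eucl n)) (x : Eucl n) :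
    Eucl n →L[ℝ] Eucl n :=
  (gram g e x).inverse.comp (innerL n)

/-- The symbol of the wave operator in the coordinates of a chart. -/
def symbC (g : Metric1 n N) (e : OpenPartialHomeomorph N (Eucl n)) (y : Coord n) : ℝ :=
  -(y.2.2.1) ^ 2 + inner ℝ (cogram g e y.2.1 y.2.2.2) y.2.2.2

section

variable {e : OpenPartialHomeomorph N (Eucl n)}
  (he : e ∈ IsManifold.maximalAtlas 𝓘(ℝ, Eucl n) 2 N) (g : Metric1 n N)

lemma inner_sharp (m : N) (ξ : Covector n N m) : g.inner m (sharp g m ξ) = ξ := by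
  obtain ⟨A, hA⟩ := exists_equiv_of_pos (n := n) (g.inner m) (g.pos m)
  have h : sharp g m ξ = A.symm ξ := by
    have : (g.inner m).inverse = (A.symm : (Eucl n →L[ℝ] ℝ) →L[ℝ] Eucl n) := by
      refine Eq.trans ?_ (ContinuousLinearMap.inverse_equiv A)
      rw [hA]; rfl
    show (g.inner m).inverse ξ = _
    rw [this]; rfl
  rw [h]
  have h2 : ∀ v, g.inner m v = A v := fun v => (congrArg (fun L => L v) hA).symm
  exact (h2 _).trans (A.apply_symm_apply ξ)

include he

lemma inner_covCoord {m : N} (hm : m ∈ e.source) (ξ : Covector n N m) (v : Eucl n) :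
    inner ℝ (covCoord e m ξ) v = ξ ((chartDiff he hm).symm v) :=
  inner_toCoord he (ρ := ((0, 0, ⟨m, ξ⟩) : Phase n N)) hm v

lemma covCoord_add {m : N} (hm : m ∈ e.source) (ξ η : Covector n N m) :
    covCoord e m (ξ + η) = covCoord e m ξ + covCoord e m η := by
  refine ext_inner_right ℝ fun v => ?_
  rw [inner_add_left]
  simp only [inner_covCoord he hm]
  rfl

lemma covCoord_smul {m : N} (hm : m ∈ e.source) (c : ℝ) (ξ : Covector n N m) :
    covCoord e m (c • ξ) = c • covCoord e m ξ := by
  refine ext_inner_right ℝ fun v => ?_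
  rw [real_inner_smul_left]
  simp only [inner_covCoord he hm]
  rfl

lemma covCoord_dz {m : N} (hm : m ∈ e.source) :
    covCoord e m (dz e m) = stdVec n (Fin.last n) := by
  refine ext_inner_right ℝ fun v => ?_
  rw [inner_covCoord he hm]
  show inner ℝ (stdVec n (Fin.last n)) (chartDiff he hm ((chartDiff he hm).symm v)) = _
  rw [ContinuousLinearEquiv.apply_symm_apply]

lemma gram_apply {m : N} (hm : m ∈ e.source) (u v : Eucl n) :
    gram g e (e m) u v = g.inner m ((chartDiff he hm).symm u) ((chartDiff he hm).symm v) := by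
  have aux : ∀ m' : N, m' = m → ∀ a b : Eucl n,
      (g.inner m' : Eucl n →L[ℝ] Eucl n →L[ℝ] ℝ) a b =
      (g.inner m : Eucl n →L[ℝ] Eucl n →L[ℝ] ℝ) a b := by
    rintro m' rfl a b; rfl
  exact aux _ (e.left_inv hm) _ _

lemma gram_pos {x : Eucl n} (hx : x ∈ e.target) {v : Eucl n} (hv : v ≠ 0) :
    0 < gram g e x v v := by
  have hm := e.map_target hx
  have := gram_apply he g hm v v
  rw [e.right_inv hx] at this
  rw [this]
  refine g.pos _ _ ?_
  simpa using hv

lemma gram_symm {x : Eucl n} (hx : x ∈ e.target) (u v : Eucl n) :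
    gram g e x u v = gram g e x v u := by
  have hm := e.map_target hx
  have h := gram_apply he g hm
  rw [e.right_inv hx] at h
  rw [h, h]
  exact g.symm _ _ _

lemma gram_cogram {x : Eucl n} (hx : x ∈ e.target) (ω v : Eucl n) :
    gram g e x (cogram g e x ω) v = inner ℝ ω v := by
  obtain ⟨A, hA⟩ := exists_equiv_of_pos (gram g e x) fun v => gram_pos he g hx
  simp only [cogram, ← hA, ContinuousLinearMap.inverse_equiv]
  simp [innerL_apply]

/-- The defining relation of the dual metric; it allows identification of `cogram` without computing
an inverse matrix. -/
lemma cogram_eq_iff {x : Eucl n} (hx : x ∈ e.target) (ω v : Eucl n) :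
    cogram g e x ω = v ↔ ∀ w, gram g e x v w = inner ℝ ω w := by
  refine ⟨fun h w => h ▸ gram_cogram he g hx ω w, fun h => ?_⟩
  by_contra hne
  have h0 := gram_pos he g hx (sub_ne_zero.2 hne)
  rw [ContinuousLinearMap.map_sub₂, gram_cogram he g hx, h, sub_self] at h0
  exact lt_irrefl _ h0

lemma cogram_symm {x : Eucl n} (hx : x ∈ e.target) (u v : Eucl n) :
    inner ℝ (cogram g e x u) v = inner ℝ u (cogram g e x v) := by
  rw [← gram_cogram he g hx u, gram_symm he g hx, gram_cogram he g hx, real_inner_comm]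

lemma cogram_pos {x : Eucl n} (hx : x ∈ e.target) {v : Eucl n} (hv : v ≠ 0) :
    0 < inner ℝ (cogram g e x v) v := by
  rw [real_inner_comm, ← gram_cogram he g hx]
  refine gram_pos he g hx fun h => hv ?_
  refine ext_inner_right ℝ fun w => ?_
  rw [← gram_cogram he g hx, h]; simp

lemma chartDiff_sharp {m : N} (hm : m ∈ e.source) (ξ : Covector n N m) :
    chartDiff he hm (sharp g m ξ) = cogram g e (e m) (covCoord e m ξ) := by
  symm
  rw [cogram_eq_iff he g (e.map_source hm)]
  intro w
  rw [gram_apply he g hm, inner_covCoord he hm, ContinuousLinearEquiv.symm_apply_apply,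
    inner_sharp]

lemma cometric_eq {m : N} (hm : m ∈ e.source) (ξ η : Covector n N m) :
    cometric g m ξ η = inner ℝ (cogram g e (e m) (covCoord e m ξ)) (covCoord e m η) := by
  rw [← chartDiff_sharp he g hm, real_inner_comm, inner_covCoord he hm,
    ContinuousLinearEquiv.symm_apply_apply]
  rfl

lemma symb_eq {ρ : Phase n N} (hρ : ρ ∈ above e) : symb g ρ = symbC g e (toCoord e ρ) := by
  unfold symb symbC
  rw [cometric_eq he g hρ]
  rfl

lemma symb_ofCoord {y : Coord n} (hy : y.2.1 ∈ e.target) :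
    symb g (ofCoord e y) = symbC g e y := by
  rw [symb_eq he g (ofCoord_mem_above hy), toCoord_ofCoord he hy]

lemma contDiffOn_gram : ContDiffOn ℝ 1 (gram g e) e.target := by
  rw [contDiffOn_clm_apply]
  intro u
  rw [contDiffOn_clm_apply]
  intro v
  have h1 : ContMDiffOn 𝓘(ℝ, Eucl n)
      (𝓘(ℝ, Eucl n).prod 𝓘(ℝ, Eucl n →L[ℝ] Eucl n →L[ℝ] ℝ)) 1
      (fun x : Eucl n => TotalSpace.mk' (Eucl n →L[ℝ] Eucl n →L[ℝ] ℝ)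
        (E := fun m : N => TangentSpace 𝓘(ℝ, Eucl n) m →L[ℝ] TangentSpace 𝓘(ℝ, Eucl n) m →L[ℝ] ℝ)
        (e.symm x) (g.inner (e.symm x))) e.target :=
    g.contMDiff.comp_contMDiffOn ((contMDiffOn_symm_of_mem_maximalAtlas he).of_le (by norm_num))
  have h2 := ContMDiffOn.clm_bundle_apply₂ (F₃ := ℝ) (E₃ := fun _ : N => ℝ) h1
    (contMDiffOn_coordField he u) (contMDiffOn_coordField he v)
  intro x hx
  have h3 := h2 x hx
  rw [contMDiffWithinAt_totalSpace] at h3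
  exact h3.2.contDiffWithinAt

/-- Inversion is smooth at an invertible map, so the dual metric inherits the C¹ regularity of the
metric. -/
lemma contDiffOn_cogram : ContDiffOn ℝ 1 (cogram g e) e.target := by
  refine ContDiffOn.clm_comp ?_ contDiffOn_const
  intro x hx
  obtain ⟨A, hA⟩ := exists_equiv_of_pos (gram g e x) fun v => gram_pos he g hx
  have h := contDiffAt_map_inverse (𝕜 := ℝ) (n := 1) A
  rw [hA] at h
  exact h.comp_contDiffWithinAt x (contDiffOn_gram he g x hx)

lemma contDiffOn_cogram_apply : ContDiffOn ℝ 1 (fun y : Coord n => cogram g e y.2.1 y.2.2.2)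
    {y | y.2.1 ∈ e.target} :=
  ((contDiffOn_cogram he g).comp (f := fun y : Coord n => y.2.1) (by fun_prop)
    fun y hy => hy).clm_apply (by fun_prop)

lemma contDiffOn_symbC : ContDiffOn ℝ 1 (symbC g e) {y | y.2.1 ∈ e.target} := by
  refine ContDiffOn.add (by fun_prop) ?_
  exact (contDiffOn_cogram_apply he g).inner ℝ (by fun_prop)

end

end

/-! ### Hamiltonian field and test functions in coordinates. -/

section

variable {n : ℕ} {N : Type*} [TopologicalSpace N] [ChartedSpace (Eucl n) N]

/-- The Hamiltonian vector field of `f` in canonical coordinates. -/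
def hamVec (f : Coord n → ℝ) (y : Coord n) : Coord n :=
  (fderiv ℝ f y (0, 0, 1, 0),
    WithLp.toLp 2 fun i => fderiv ℝ f y (0, 0, 0, stdVec n i),
    -fderiv ℝ f y (1, 0, 0, 0),
    WithLp.toLp 2 fun i => -fderiv ℝ f y (0, stdVec n i, 0, 0))

lemma sum_smul_stdVec (v : Eucl n) : ∑ i, v i • stdVec n i = v := by
  have := (EuclideanSpace.basisFun (Fin (n + 1)) ℝ).sum_repr v
  simpa [stdVec] using this

/-- Turns the bracket into a derivative along a vector, so that the product and chain rules apply.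
-/
lemma poisson_eq (f h : Coord n → ℝ) (y : Coord n) :
    poisson f h y = fderiv ℝ h y (hamVec f y) := by
  set L := fderiv ℝ h y
  have hdec : ∀ (a : ℝ) (u : Eucl n) (b : ℝ) (w : Eucl n), L (a, u, b, w) =
      a * L (1, 0, 0, 0) + ∑ i, u i * L (0, stdVec n i, 0, 0) + b * L (0, 0, 1, 0)
        + ∑ i, w i * L (0, 0, 0, stdVec n i) := by
    intro a u b w
    have h1 : ((a, u, b, w) : Coord n) = a • (1, 0, 0, 0)
        + (ContinuousLinearMap.inr ℝ ℝ (Eucl n × ℝ × Eucl n)) (ContinuousLinearMap.inl ℝ _ _ u)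
        + b • (0, 0, 1, 0)
        + (ContinuousLinearMap.inr ℝ ℝ (Eucl n × ℝ × Eucl n)) (ContinuousLinearMap.inr ℝ _ _
          (ContinuousLinearMap.inr ℝ _ _ w)) := by
      simp
    rw [h1, map_add, map_add, map_add, map_smul, map_smul]
    nth_rewrite 1 [← sum_smul_stdVec u]
    nth_rewrite 1 [← sum_smul_stdVec w]
    simp only [map_sum, map_smul, smul_eq_mul]
    rfl
  rw [show hamVec f y = (_, _, _, _) from rfl, hdec, poisson]
  simp only [Finset.sum_sub_distrib, L]
  simp only [neg_mul, Finset.sum_neg_distrib]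
  ring

lemma continuousOn_hamVec {f : Coord n → ℝ} {s : Set (Coord n)} (hs : IsOpen s)
    (hf : ContDiffOn ℝ 1 f s) : ContinuousOn (hamVec f) s := by
  have h := hf.continuousOn_fderiv_of_isOpen hs le_rfl
  have h' : ∀ v, ContinuousOn (fun y => fderiv ℝ f y v) s := fun v =>
    h.clm_apply continuousOn_const
  exact (h' _).prodMk (((PiLp.continuous_toLp 2 _).comp_continuousOn
    (continuousOn_pi.2 fun i => h' _)).prodMk ((h' _).neg.prodMk
      ((PiLp.continuous_toLp 2 _).comp_continuousOn (continuousOn_pi.2 fun i => (h' _).neg))))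

/-- The region of coordinate space lying above the target of a chart. -/
def region (e : OpenPartialHomeomorph N (Eucl n)) : Set (Coord n) := {y | y.2.1 ∈ e.target}

lemma isOpen_region (e : OpenPartialHomeomorph N (Eucl n)) : IsOpen (region e) :=
  e.open_target.preimage (by fun_prop)

variable [IsManifold 𝓘(ℝ, Eucl n) 2 N]

/-- The derivative of `h` along the Hamiltonian vector field of the wave symbol. -/
def hamD (g : Metric1 n N) (e : OpenPartialHomeomorph N (Eucl n)) (h : Coord n → ℝ)
    (y : Coord n) : ℝ :=
  fderiv ℝ h y (hamVec (symbC g e) y)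

open Classical in
/-- The function on phase space which is `h` in the coordinates of the chart `e`, and `0` outside
the domain of the chart. -/
def extend (e : OpenPartialHomeomorph N (Eucl n)) (h : Coord n → ℝ) (ρ : Phase n N) : ℝ :=
  if ρ ∈ above e then h (toCoord e ρ) else 0

lemma extend_of_mem {e : OpenPartialHomeomorph N (Eucl n)} (h : Coord n → ℝ) {ρ : Phase n N}
    (hρ : ρ ∈ above e) : extend e h ρ = h (toCoord e ρ) := if_pos hρ

/-- Test functions in the coordinates of a chart: functions of class `C¹` vanishing off a compact
set whose image in phase space is contained in `U`. -/
structure IsCoordTest (U : Set (Phase n N)) (e : OpenPartialHomeomorph N (Eucl n))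
    (K : Set (Coord n)) (h : Coord n → ℝ) : Prop where
  contDiffOn : ContDiffOn ℝ 1 h (region e)
  isCompact : IsCompact K
  subset_region : K ⊆ region e
  eq_zero : ∀ y ∈ region e, y ∉ K → h y = 0
  subset_preimage : ∀ y ∈ K, ofCoord e y ∈ U

section

variable {e : OpenPartialHomeomorph N (Eucl n)}
  (he : e ∈ IsManifold.maximalAtlas 𝓘(ℝ, Eucl n) 2 N) (g : Metric1 n N)

include he

lemma isCompact_image_ofCoord {K : Set (Coord n)} (hK : IsCompact K) (hKe : K ⊆ region e) :
    IsCompact (ofCoord e '' K : Set (Phase n N)) :=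
  hK.image_of_continuousOn ((continuousOn_ofCoord he).mono hKe)

lemma mem_image_ofCoord {K : Set (Coord n)} (hKe : K ⊆ region e) {ρ : Phase n N}  :
    ρ ∈ ofCoord e '' K ↔ ρ ∈ above e ∧ toCoord e ρ ∈ K := by
  constructor
  · rintro ⟨y, hy, rfl⟩
    exact ⟨ofCoord_mem_above (hKe hy), by rwa [toCoord_ofCoord he (hKe hy)]⟩
  · rintro ⟨h1, h2⟩
    exact ⟨_, h2, ofCoord_toCoord he h1⟩

/-- The image of `K` in phase space is compact, hence closed since the space is Hausdorff, so
extension by 0 outside the chart creates no new support. -/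
lemma IsCoordTest.isTestFunction [T2Space N] {U : Set (Phase n N)} {K : Set (Coord n)}
    {h : Coord n → ℝ} (H : IsCoordTest U e K h) : IsTestFunction U e (extend e h) := by
  have hKc := isCompact_image_ofCoord he (N := N) H.isCompact H.subset_region
  have hz : ∀ ρ, ρ ∉ ofCoord e '' K → extend e h ρ = 0 := by
    intro ρ hρ
    unfold extend
    split_ifs with h1
    · refine H.eq_zero _ (toCoord_mem_target he h1) fun h2 => hρ ?_
      exact (mem_image_ofCoord he H.subset_region).2 ⟨h1, h2⟩
    · rfl
  refine ⟨HasCompactSupport.intro hKc fun {x} hx => hz x hx, ?_, ?_⟩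
  · have h1 : tsupport (extend e h) ⊆ ofCoord e '' K :=
      closure_minimal (fun ρ hρ => by_contra fun hh => hρ (hz ρ hh)) hKc.isClosed
    refine h1.trans ?_
    rintro _ ⟨y, hy, rfl⟩
    exact ⟨H.subset_preimage y hy, ofCoord_mem_above (H.subset_region hy)⟩
  · refine H.contDiffOn.congr fun y hy => ?_
    simp only [Function.comp]
    rw [extend_of_mem h (ofCoord_mem_above hy), toCoord_ofCoord he hy]

omit he in
lemma poisson_congr {f f' h h' : Coord n → ℝ} {y : Coord n} (hf : f =ᶠ[𝓝 y] f')
    (hh : h =ᶠ[𝓝 y] h') : poisson f h y = poisson f' h' y := by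
  simp only [poisson, hf.fderiv_eq, hh.fderiv_eq]

lemma ham_eq_hamD {q : Phase n N → ℝ} {h : Coord n → ℝ} {ρ : Phase n N} (hρ : ρ ∈ above e)
    (hq : ∀ᶠ y in 𝓝 (toCoord e ρ), q (ofCoord e y) = h y) :
    ham e (symb g) q ρ = hamD g e h (toCoord e ρ) := by
  unfold ham hamD
  rw [← poisson_eq]
  refine poisson_congr ?_ hq
  filter_upwards [(isOpen_region e).mem_nhds (toCoord_mem_target he hρ)] with y hy
  exact symb_ofCoord he g hy

lemma ham_extend (h : Coord n → ℝ) {ρ : Phase n N} (hρ : ρ ∈ above e) :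
    ham e (symb g) (extend e h) ρ = hamD g e h (toCoord e ρ) := by
  refine ham_eq_hamD he g hρ ?_
  filter_upwards [(isOpen_region e).mem_nhds (toCoord_mem_target he hρ)] with y hy
  rw [extend_of_mem h (ofCoord_mem_above hy), toCoord_ofCoord he hy]

lemma measureEquation_extend [T2Space N] {M : Set N} {U : Set (Phase n N)} {f : Phase n N → ℝ}
    {μ ν : Measure (Phase n N)} [BorelSpace (Phase n N)]
    (heq : MeasureEquation g M U f μ ν) {K : Set (Coord n)}
    {h : Coord n → ℝ} (H : IsCoordTest U e K h) :
    ∫ ρ in above e, hamD g e h (toCoord e ρ) ∂μ =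
      (∫ ρ in above e, f ρ * h (toCoord e ρ) ∂μ)
        - ∫ ρ in (hyperbolic g M ∪ glancing g M) ∩ above e, sourcePairing g M (extend e h) ρ ∂ν := by
  have h0 := heq e he _ (H.isTestFunction he)
  have hm : MeasurableSet (above e : Set (Phase n N)) := (isOpen_above e).measurableSet
  rw [setIntegral_congr_fun hm (fun ρ hρ => (ham_extend he g h hρ).symm), h0]
  congr 1
  exact setIntegral_congr_fun hm fun ρ hρ => by simp only [extend_of_mem h hρ]

lemma continuousOn_hamD {h : Coord n → ℝ} (hh : ContDiffOn ℝ 1 h (region e)) :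
    ContinuousOn (hamD g e h) (region e) :=
  (hh.continuousOn_fderiv_of_isOpen (isOpen_region e) le_rfl).clm_apply
    (continuousOn_hamVec (isOpen_region e) (contDiffOn_symbC he g))

omit he in
lemma hamD_eq_zero {h : Coord n → ℝ} {y : Coord n} (hy : h =ᶠ[𝓝 y] 0) : hamD g e h y = 0 := by
  unfold hamD
  rw [hy.fderiv_eq]; simp

lemma differentiableAt_symbC {y : Coord n} (hy : y ∈ region e) :
    DifferentiableAt ℝ (symbC g e) y :=
  ((contDiffOn_symbC he g).contDiffAt ((isOpen_region e).mem_nhds hy)).differentiableAt (by simp)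

/-- With x fixed, the symbol is independent of t and quadratic in (τ, ξ), so its expansion along the
line is exact and the derivative is read off the linear term. -/
lemma fderiv_symbC_vertical {y : Coord n} (hy : y ∈ region e) (a : ℝ) (v : Eucl n) (b : ℝ) :
    fderiv ℝ (symbC g e) y (a, 0, b, v) =
      -2 * y.2.2.1 * b + 2 * inner ℝ (cogram g e y.2.1 y.2.2.2) v := by
  rw [← (differentiableAt_symbC he g hy).lineDeriv_eq_fderiv]
  have h : HasDerivAt (fun s : ℝ => symbC g e (y + s • ((a, 0, b, v) : Coord n)))
      (-2 * y.2.2.1 * b + 2 * inner ℝ (cogram g e y.2.1 y.2.2.2) v) 0 := by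
    have h1 : (fun s : ℝ => symbC g e (y + s • ((a, 0, b, v) : Coord n))) = fun s =>
        symbC g e y + s * (-2 * y.2.2.1 * b + 2 * inner ℝ (cogram g e y.2.1 y.2.2.2) v)
          + s ^ 2 * (- b ^ 2 + inner ℝ (cogram g e y.2.1 v) v) := by
      funext s
      have h2 := cogram_symm he g hy v y.2.2.2
      simp only [symbC, Prod.snd_add, Prod.fst_add, Prod.smul_snd, Prod.smul_fst, smul_zero,
        add_zero, map_add, map_smul, inner_add_left, inner_add_right, real_inner_smul_left,
        real_inner_smul_right, smul_eq_mul, h2, real_inner_comm (cogram g e y.2.1 y.2.2.2) v]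
      ring
    rw [h1]
    have h3 := (((hasDerivAt_id (0 : ℝ)).mul_const
      (-2 * y.2.2.1 * b + 2 * inner ℝ (cogram g e y.2.1 y.2.2.2) v)).const_add (symbC g e y)).add
      (((hasDerivAt_id (0 : ℝ)).pow 2).mul_const (- b ^ 2 + inner ℝ (cogram g e y.2.1 v) v))
    convert! h3 using 1
    simp
  exact h.deriv

/-- The component along ξ involves derivatives of the metric and is left unspecified: the functions
differentiated with this formula do not depend on ξ. -/
lemma hamVec_symbC {y : Coord n} (hy : y ∈ region e) :
    ∃ w, hamVec (symbC g e) y =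
      (-2 * y.2.2.1, (2 : ℝ) • cogram g e y.2.1 y.2.2.2, 0, w) := by
  refine ⟨_, Prod.ext ?_ (Prod.ext ?_ (Prod.ext ?_ rfl))⟩
  · simp only [hamVec]
    rw [fderiv_symbC_vertical he g hy]; simp
  · simp only [hamVec]
    ext i
    rw [PiLp.toLp_apply, fderiv_symbC_vertical he g hy, stdVec, EuclideanSpace.inner_single_right]
    simp
  · simp only [hamVec]
    have := fderiv_symbC_vertical he g hy 1 0 0
    simp only [mul_zero, inner_zero_right, add_zero] at this
    rw [this, neg_zero]

omit he in
-- Antisymmetry of the Poisson bracket.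
lemma hamD_symbC (y : Coord n) : hamD g e (symbC g e) y = 0 := by
  unfold hamD
  rw [← poisson_eq, poisson]
  rw [Finset.sum_eq_zero (fun i _ => by ring)]
  ring

end

end

/-! ### Adapted charts, the conormal and the source term. -/

section

variable {n : ℕ} {N : Type*} [TopologicalSpace N] [ChartedSpace (Eucl n) N]

/-- The differential of the last coordinate of `ℝᵈ`, as a vector. -/
abbrev lastVec (n : ℕ) : Eucl n := stdVec n (Fin.last n)

lemma inner_lastVec_left (v : Eucl n) : inner ℝ (lastVec n) v = v (Fin.last n) := by
  simp [stdVec, EuclideanSpace.inner_single_left]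

lemma lastVec_ne_zero : lastVec n ≠ 0 := by
  intro h
  have := congrArg (fun v : Eucl n => v (Fin.last n)) h
  simp [stdVec] at this

/-- Moving along the kernel of `a` stays in the half-space where `b` is nonnegative, and a linear
function bounded below on a line is constant there; so `b` vanishes on that kernel. -/
lemma exists_smul_of_nonneg {V : Type*} [AddCommGroup V] [Module ℝ V] (a b : V →ₗ[ℝ] ℝ)
    (ha : a ≠ 0) (h : ∀ v, 0 < a v → 0 ≤ b v) : ∃ c : ℝ, 0 ≤ c ∧ b = c • a := by
  obtain ⟨v, hv⟩ : ∃ v, a v ≠ 0 := by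
    by_contra! hh
    exact ha (LinearMap.ext hh)
  set w := (a v)⁻¹ • v with hw
  have haw : a w = 1 := by simp [hw, hv]
  have hker : ∀ u, a u = 0 → b u = 0 := by
    intro u hu
    have h1 : ∀ s : ℝ, 0 ≤ b w + s * b u := by
      intro s
      have := h (w + s • u) (by simp [haw, hu])
      simpa using this
    by_contra hne
    have := h1 (-(b w + 1) / b u)
    rw [div_mul_cancel₀ _ hne] at this
    linarith
  refine ⟨b w, h w (by rw [haw]; norm_num), LinearMap.ext fun u => ?_⟩
  have := hker (u - a u • w) (by simp [haw])
  simp only [map_sub, map_smul, smul_eq_mul] at this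
  simp only [LinearMap.smul_apply, smul_eq_mul]
  linarith

variable [IsManifold 𝓘(ℝ, Eucl n) 2 N]

section Transition

variable {e e' : OpenPartialHomeomorph N (Eucl n)}
  (he : e ∈ IsManifold.maximalAtlas 𝓘(ℝ, Eucl n) 2 N)
  (he' : e' ∈ IsManifold.maximalAtlas 𝓘(ℝ, Eucl n) 2 N)

lemma isOpen_transition : IsOpen (e.target ∩ e.symm ⁻¹' e'.source) :=
  e.symm.isOpen_inter_preimage e'.open_source

include he he'

lemma contDiffOn_transition :
    ContDiffOn ℝ 2 (fun x => e' (e.symm x)) (e.target ∩ e.symm ⁻¹' e'.source) := by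
  rw [← contMDiffOn_iff_contDiffOn]
  exact (contMDiffOn_of_mem_maximalAtlas he').comp
    ((contMDiffOn_symm_of_mem_maximalAtlas he).mono inter_subset_left) fun x hx => hx.2

lemma fderiv_transition {m : N} (hm : m ∈ e.source) (hm' : m ∈ e'.source) (v : Eucl n) :
    fderiv ℝ (fun x => e' (e.symm x)) (e m) v = chartDiff he' hm' ((chartDiff he hm).symm v) := by
  have h1 : HasMFDerivAt 𝓘(ℝ, Eucl n) 𝓘(ℝ, Eucl n) e.symm (e m)
      (mfderiv 𝓘(ℝ, Eucl n) 𝓘(ℝ, Eucl n) e.symm (e m)) :=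
    ((mdifferentiable_chart he).mdifferentiableAt_symm (e.map_source hm)).hasMFDerivAt
  have h2 : HasMFDerivAt 𝓘(ℝ, Eucl n) 𝓘(ℝ, Eucl n) e' (e.symm (e m))
      (mfderiv 𝓘(ℝ, Eucl n) 𝓘(ℝ, Eucl n) e' (e.symm (e m))) := by
    rw [e.left_inv hm]
    exact ((mdifferentiable_chart he').mdifferentiableAt hm').hasMFDerivAt
  obtain ⟨L, hL, hLv⟩ : ∃ L : Eucl n →L[ℝ] Eucl n,
      HasFDerivAt (𝕜 := ℝ) (E := Eucl n) (F := Eucl n) (fun x => e' (e.symm x)) L (e m) ∧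
      ∀ u, L u = (mfderiv 𝓘(ℝ, Eucl n) 𝓘(ℝ, Eucl n) e' (e.symm (e m)) : Eucl n →L[ℝ] Eucl n)
      ((mfderiv 𝓘(ℝ, Eucl n) 𝓘(ℝ, Eucl n) e.symm (e m) : Eucl n →L[ℝ] Eucl n) u) :=
    ⟨_, hasMFDerivAt_iff_hasFDerivAt.1 (HasMFDerivAt.comp (e m) h2 h1), fun u => rfl⟩
  rw [hL.fderiv]
  refine (hLv v).trans ?_
  have aux : ∀ m' : N, m' = m → ∀ u : Eucl n,
      (mfderiv 𝓘(ℝ, Eucl n) 𝓘(ℝ, Eucl n) e' m' : Eucl n →L[ℝ] Eucl n) u =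
      (mfderiv 𝓘(ℝ, Eucl n) 𝓘(ℝ, Eucl n) e' m : Eucl n →L[ℝ] Eucl n) u := by
    rintro m' rfl u; rfl
  exact aux _ (e.left_inv hm) _

lemma inner_covCoord_transition {m : N} (hm : m ∈ e.source) (hm' : m ∈ e'.source)
    (ξ : Covector n N m) (v : Eucl n) :
    inner ℝ (covCoord e m ξ) v =
      inner ℝ (covCoord e' m ξ) (fderiv ℝ (fun x => e' (e.symm x)) (e m) v) := by
  rw [fderiv_transition he he' hm hm', inner_covCoord he hm, inner_covCoord he' hm',
    ContinuousLinearEquiv.symm_apply_apply]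

end Transition

section Adapted

variable {M : Set N} {e e' : OpenPartialHomeomorph N (Eucl n)}

/-- Where z ≠ 0 membership in `M` is locally constant; where z = 0 a small move along -dz, seen as a
vector of the chart, leaves `M`. -/
lemma mem_frontier_iff (he : IsAdaptedChart M e) {m : N} (hm : m ∈ e.source) :
    m ∈ frontier M ↔ e m (Fin.last n) = 0 := by
  have hz : ContinuousAt (fun m => e m (Fin.last n)) m :=
    (EuclideanSpace.proj (Fin.last n)).continuous.continuousAt.comp (e.continuousAt hm)
  constructor
  · intro hfr
    rcases lt_trichotomy (e m (Fin.last n)) 0 with h | h | h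
    · have : ∀ᶠ m' in 𝓝 m, m' ∉ M := by
        filter_upwards [hz.eventually_lt continuousAt_const h, e.open_source.mem_nhds hm]
          with m' h1 h2 h3
        exact absurd (((he.2 m' h2).1 h3)) (not_le.2 h1)
      exact absurd (frontier_subset_closure hfr) (by
        rw [mem_closure_iff_frequently, not_frequently]; exact this)
    · exact h
    · have : ∀ᶠ m' in 𝓝 m, m' ∈ M := by
        filter_upwards [continuousAt_const.eventually_lt hz h, e.open_source.mem_nhds hm]
          with m' h1 h2
        exact (he.2 m' h2).2 h1.le
      exact absurd (mem_interior_iff_mem_nhds.2 this) hfr.2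
  · intro h0
    refine ⟨subset_closure ((he.2 m hm).2 h0.ge), fun hint => ?_⟩
    have hM := mem_interior_iff_mem_nhds.1 hint
    have hc : ContinuousAt (fun s : ℝ => e.symm (e m + s • (-lastVec n))) 0 := by
      refine ContinuousAt.comp (g := e.symm) ?_ (by fun_prop)
      simpa using e.continuousAt_symm (e.map_source hm)
    have ht : ContinuousAt (fun s : ℝ => e m + s • (-lastVec n)) 0 := by fun_prop
    have h1 : ∀ᶠ s : ℝ in 𝓝 0, e.symm (e m + s • (-lastVec n)) ∈ M ∧
        e m + s • (-lastVec n) ∈ e.target := by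
      refine (hc.eventually_mem ?_).and (ht.eventually_mem ?_)
      · simpa [e.left_inv hm] using hM
      · simpa using e.open_target.mem_nhds (e.map_source hm)
    obtain ⟨s, ⟨h2, h3⟩, hs⟩ := ((h1.filter_mono nhdsWithin_le_nhds).and
      (self_mem_nhdsWithin (a := (0 : ℝ)) (s := Ioi 0))).exists
    have h4 := (he.2 _ (e.map_target h3)).1 h2
    rw [e.right_inv h3] at h4
    simp [stdVec, h0] at h4
    exact absurd h4 (not_le.2 hs)

/-- The last coordinate of a second chart, in the coordinates of a first one. -/
def lastTransition (e e' : OpenPartialHomeomorph N (Eucl n)) (x : Eucl n) : ℝ :=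
  e' (e.symm x) (Fin.last n)

lemma contDiffOn_lastTransition (he : e ∈ IsManifold.maximalAtlas 𝓘(ℝ, Eucl n) 2 N)
    (he' : e' ∈ IsManifold.maximalAtlas 𝓘(ℝ, Eucl n) 2 N) :
    ContDiffOn ℝ 2 (lastTransition e e') (e.target ∩ e.symm ⁻¹' e'.source) :=
  (EuclideanSpace.proj (𝕜 := ℝ) (Fin.last n)).contDiff.comp_contDiffOn
    (contDiffOn_transition he he')

lemma lastTransition_nonneg (he : IsAdaptedChart M e) (he' : IsAdaptedChart M e') {x : Eucl n}
    (hx : x ∈ e.target ∩ e.symm ⁻¹' e'.source) (h : 0 ≤ x (Fin.last n)) :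
    0 ≤ lastTransition e e' x := by
  refine (he'.2 _ hx.2).1 ((he.2 _ (e.map_target hx.1)).2 ?_)
  rwa [e.right_inv hx.1]

lemma lastTransition_eq_zero (he : IsAdaptedChart M e) (he' : IsAdaptedChart M e') {x : Eucl n}
    (hx : x ∈ e.target ∩ e.symm ⁻¹' e'.source) (h : x (Fin.last n) = 0) :
    lastTransition e e' x = 0 := by
  refine (mem_frontier_iff he' hx.2).1 ((mem_frontier_iff he (e.map_target hx.1)).2 ?_)
  rwa [e.right_inv hx.1]

/-- On the boundary, the differentials of the last coordinates of two adapted charts are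
proportional. -/
lemma exists_fderiv_lastTransition (he : IsAdaptedChart M e) (he' : IsAdaptedChart M e')
    {x : Eucl n} (hx : x ∈ e.target ∩ e.symm ⁻¹' e'.source) (h : x (Fin.last n) = 0) :
    ∃ c : ℝ, 0 ≤ c ∧ ∀ v, fderiv ℝ (lastTransition e e') x v = c * v (Fin.last n) := by
  have hdiff : DifferentiableAt ℝ (lastTransition e e') x :=
    ((contDiffOn_lastTransition he.1 he'.1).contDiffAt
      (isOpen_transition.mem_nhds hx)).differentiableAt (by simp)
  suffices H : ∃ c : ℝ, 0 ≤ c ∧ (fderiv ℝ (lastTransition e e') x).toLinearMap =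
      c • (EuclideanSpace.proj (𝕜 := ℝ) (Fin.last n) : Eucl n →L[ℝ] ℝ).toLinearMap by
    obtain ⟨c, hc, hc'⟩ := H
    exact ⟨c, hc, fun v => LinearMap.congr_fun hc' v⟩
  refine exists_smul_of_nonneg _ _ ?_ ?_
  · intro hh
    have := LinearMap.congr_fun hh (lastVec n)
    simp [stdVec] at this
  · intro v hv
    have hv : 0 < v (Fin.last n) := hv
    have hd : HasDerivAt (fun s : ℝ => lastTransition e e' (x + s • v))
        (fderiv ℝ (lastTransition e e') x v) 0 := hdiff.hasFDerivAt.hasLineDerivAt v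
    -- The second boundary coordinate vanishes at x and is nonnegative on the inner side, so its
    -- right difference quotients along an inward vector are nonnegative.
    refine ge_of_tendsto (hd.tendsto_slope_zero_right) ?_
    have ht : ContinuousAt (fun s : ℝ => x + s • v) 0 := by fun_prop
    have h1 : ∀ᶠ s : ℝ in 𝓝 0, x + s • v ∈ e.target ∩ e.symm ⁻¹' e'.source :=
      ht.eventually_mem (by simpa using isOpen_transition.mem_nhds hx)
    filter_upwards [h1.filter_mono nhdsWithin_le_nhds, self_mem_nhdsWithin] with s hs hs0
    have hs0 : 0 < s := hs0
    simp only [zero_add, zero_smul, add_zero, lastTransition_eq_zero he he' hx h, sub_zero,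
      smul_eq_mul]
    refine mul_nonneg (by positivity) (lastTransition_nonneg he he' hs ?_)
    simp only [PiLp.add_apply, PiLp.smul_apply, smul_eq_mul, h, zero_add]
    positivity

lemma dz_eq_smul (he : IsAdaptedChart M e) (he' : IsAdaptedChart M e') {m : N}
    (hm : m ∈ e.source) (hm' : m ∈ e'.source) (hfr : m ∈ frontier M) :
    ∃ c : ℝ, 0 < c ∧ dz e' m = c • dz e m := by
  have hx : e m ∈ e.target ∩ e.symm ⁻¹' e'.source :=
    ⟨e.map_source hm, by simpa [e.left_inv hm] using hm'⟩
  obtain ⟨c, hc, hc'⟩ := exists_fderiv_lastTransition he he' hx ((mem_frontier_iff he hm).1 hfr)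
  have h1 : ∀ v, fderiv ℝ (lastTransition e e') (e m) v =
      (chartDiff he'.1 hm' ((chartDiff he.1 hm).symm v)) (Fin.last n) := by
    intro v
    rw [← fderiv_transition he.1 he'.1 hm hm']
    have hd : DifferentiableAt ℝ (fun x => e' (e.symm x)) (e m) :=
      ((contDiffOn_transition he.1 he'.1).contDiffAt
        (isOpen_transition.mem_nhds hx)).differentiableAt (by simp)
    have := ((EuclideanSpace.proj (𝕜 := ℝ) (Fin.last n) :
      Eucl n →L[ℝ] ℝ).hasFDerivAt.comp (e m) hd.hasFDerivAt).fderiv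
    exact congrArg (fun L => L v) this
  have h2 : dz e' m = c • dz e m := by
    ext v
    have h3 := h1 (chartDiff he.1 hm v)
    rw [ContinuousLinearEquiv.symm_apply_apply, hc'] at h3
    show inner ℝ (lastVec n) (chartDiff he'.1 hm' v) = c * inner ℝ (lastVec n) (chartDiff he.1 hm v)
    rw [inner_lastVec_left, inner_lastVec_left, h3]
  -- The factor cannot be 0, because dz' is a nonzero covector.
  refine ⟨c, lt_of_le_of_ne hc fun h0 => ?_, h2⟩
  rw [← h0, zero_smul] at h2
  have h4 := congrArg (covCoord e' m) h2
  rw [covCoord_dz he'.1 hm', show (0 : Covector n N m) = (0 : ℝ) • (0 : Covector n N m) by simp,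
    covCoord_smul he'.1 hm', zero_smul] at h4
  exact lastVec_ne_zero h4

variable (g : Metric1 n N)

/-- Normalisation removes the positive factor between the differentials of two boundary coordinates,
so the chart chosen in the definition is irrelevant. -/
lemma conormal_eq (he : IsAdaptedChart M e) {m : N} (hm : m ∈ e.source) (hfr : m ∈ frontier M) :
    conormal g M m = (Real.sqrt (cometric g m (dz e m) (dz e m)))⁻¹ • dz e m := by
  have hex : ∃ e : OpenPartialHomeomorph N (Eucl n), IsAdaptedChart M e ∧ m ∈ e.source :=
    ⟨e, he, hm⟩
  rw [conormal, dif_pos hex]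
  obtain ⟨c, hc, h⟩ := dz_eq_smul he hex.choose_spec.1 hm hex.choose_spec.2 hfr
  rw [h]
  have h1 : cometric g m (c • dz e m) (c • dz e m) = c ^ 2 * cometric g m (dz e m) (dz e m) := by
    simp only [cometric_eq he.1 g hm, covCoord_smul he.1 hm, map_smul, real_inner_smul_left,
      real_inner_smul_right]
    ring
  rw [h1, Real.sqrt_mul (by positivity), Real.sqrt_sq hc.le, smul_smul, mul_inv_rev, mul_assoc,
    inv_mul_cancel₀ hc.ne', mul_one]

/-- The square of the norm of `dz` in a chart. -/
def normSqDz (g : Metric1 n N) (e : OpenPartialHomeomorph N (Eucl n)) (x : Eucl n) : ℝ :=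
  inner ℝ (cogram g e x (lastVec n)) (lastVec n)

/-- The coordinates of the unit conormal in an adapted chart. -/
def conormalC (g : Metric1 n N) (e : OpenPartialHomeomorph N (Eucl n)) (x : Eucl n) : Eucl n :=
  (Real.sqrt (normSqDz g e x))⁻¹ • lastVec n

lemma normSqDz_pos (he : e ∈ IsManifold.maximalAtlas 𝓘(ℝ, Eucl n) 2 N) {x : Eucl n}
    (hx : x ∈ e.target) : 0 < normSqDz g e x :=
  cogram_pos he g hx lastVec_ne_zero

lemma covCoord_conormal (he : IsAdaptedChart M e) {m : N} (hm : m ∈ e.source)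
    (hfr : m ∈ frontier M) : covCoord e m (conormal g M m) = conormalC g e (e m) := by
  rw [conormal_eq g he hm hfr, covCoord_smul he.1 hm, cometric_eq he.1 g hm, covCoord_dz he.1 hm]
  rfl

lemma cometric_conormal (he : IsAdaptedChart M e) {m : N} (hm : m ∈ e.source)
    (hfr : m ∈ frontier M) : cometric g m (conormal g M m) (conormal g M m) = 1 := by
  have hp := normSqDz_pos g he.1 (e.map_source hm)
  rw [cometric_eq he.1 g hm, covCoord_conormal g he hm hfr, conormalC, map_smul,
    real_inner_smul_left, real_inner_smul_right, ← mul_assoc, ← mul_inv,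
    Real.mul_self_sqrt hp.le]
  exact inv_mul_cancel₀ hp.ne'

lemma toCoord_shift (he : e ∈ IsManifold.maximalAtlas 𝓘(ℝ, Eucl n) 2 N) {ρ : Phase n N}
    (hρ : ρ ∈ above e) (s : ℝ) :
    toCoord e (shift g M s ρ) =
      toCoord e ρ + s • (0, 0, 0, covCoord e (base ρ) (conormal g M (base ρ))) := by
  refine Prod.ext (by simp [toCoord, shift, addCov]) (Prod.ext ?_ (Prod.ext ?_ ?_))
  · simp [toCoord, shift, addCov, base]
  · simp [toCoord, shift, addCov, tau]
  · show covCoord e (base ρ) (cov ρ + s • conormal g M (base ρ)) = _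
    rw [covCoord_add he hρ, covCoord_smul he hρ]
    rfl

lemma cov_shift_normal (he : IsAdaptedChart M e) {ρ : Phase n N} (hρ : ρ ∈ above e)
    (hfr : base ρ ∈ frontier M) (s : ℝ) :
    cov (shift g M s ρ) (normal g M (base ρ)) = cov ρ (normal g M (base ρ)) + s := by
  have := cometric_conormal g he hρ hfr
  show cov ρ (normal g M (base ρ)) + s * cometric g (base ρ) (conormal g M (base ρ))
    (conormal g M (base ρ)) = _
  rw [this, mul_one]

/-- Pythagoras: ξ is orthogonal to the unit conormal. In particular the symbol is even in `s`, and
so takes the same value at both lifts. -/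
lemma symb_shift (he : IsAdaptedChart M e) {ρ : Phase n N} (hρ : ρ ∈ above e)
    (ht : ρ ∈ tangentialBundle g M) (s : ℝ) : symb g (shift g M s ρ) = symb g ρ + s ^ 2 := by
  have h1 := cometric_conormal g he hρ ht.1
  have h2 := ht.2
  have h3 : cometric g (base ρ) (cov ρ + s • conormal g M (base ρ))
      (cov ρ + s • conormal g M (base ρ)) = cometric g (base ρ) (cov ρ) (cov ρ) + s ^ 2 := by
    have hs := cogram_symm he.1 g (e.map_source hρ) (covCoord e (base ρ) (conormal g M (base ρ)))
      (covCoord e (base ρ) (cov ρ))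
    simp only [cometric_eq he.1 g hρ, covCoord_add he.1 hρ, covCoord_smul he.1 hρ, map_add,
      map_smul, inner_add_left, inner_add_right, real_inner_smul_left,
      real_inner_smul_right] at h1 h2 hs ⊢
    rw [real_inner_comm] at hs
    rw [real_inner_comm] at h2
    rw [real_inner_comm] at hs
    rw [h1, hs]
    rw [real_inner_comm (cogram g e (e (base ρ)) (covCoord e (base ρ) (cov ρ)))] at *
    simp only [h2]
    ring
  show -(tau ρ) ^ 2 + cometric g (base ρ) (cov ρ + s • conormal g M (base ρ))
      (cov ρ + s • conormal g M (base ρ)) = _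
  rw [h3, symb]
  ring

/-- Half the derivative of the last coordinate along the Hamiltonian vector field. -/
def zeta (g : Metric1 n N) (e : OpenPartialHomeomorph N (Eucl n)) (y : Coord n) : ℝ :=
  inner ℝ (cogram g e y.2.1 y.2.2.2) (lastVec n)

lemma mem_tangentialBundle_iff (he : IsAdaptedChart M e) {ρ : Phase n N} (hρ : ρ ∈ above e) :
    ρ ∈ tangentialBundle g M ↔
      (toCoord e ρ).2.1 (Fin.last n) = 0 ∧ zeta g e (toCoord e ρ) = 0 := by
  have h1 : base ρ ∈ frontier M ↔ (toCoord e ρ).2.1 (Fin.last n) = 0 := mem_frontier_iff he hρ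
  rw [← h1]
  refine and_congr_right fun hfr => ?_
  have hp := normSqDz_pos g he.1 (e.map_source hρ)
  rw [cometric_eq he.1 g hρ, covCoord_conormal g he hρ hfr, conormalC, real_inner_smul_right]
  have : (Real.sqrt (normSqDz g e (e (base ρ))))⁻¹ ≠ 0 := by positivity
  rw [mul_eq_zero_iff_left this]
  rfl

lemma mem_hyperbolic_union_glancing_iff {ρ : Phase n N} :
    ρ ∈ hyperbolic g M ∪ glancing g M ↔ ρ ∈ tangentialBundle g M ∧ symb g ρ ≤ 0 := by
  simp only [hyperbolic, glancing, mem_union, mem_ofPred_eq, le_iff_lt_or_eq]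
  tauto

/-- The point of coordinates `y` shifted by `s` times the unit conormal. -/
def shiftC (g : Metric1 n N) (e : OpenPartialHomeomorph N (Eucl n)) (s : ℝ) (y : Coord n) :
    Coord n :=
  y + s • (0, 0, 0, conormalC g e y.2.1)

lemma toCoord_shift_adapted (he : IsAdaptedChart M e) {ρ : Phase n N} (hρ : ρ ∈ above e)
    (hfr : base ρ ∈ frontier M) (s : ℝ) :
    toCoord e (shift g M s ρ) = shiftC g e s (toCoord e ρ) := by
  rw [toCoord_shift g he.1 hρ, covCoord_conormal g he hρ hfr]
  rfl

lemma zeta_shiftC (he : e ∈ IsManifold.maximalAtlas 𝓘(ℝ, Eucl n) 2 N) {y : Coord n}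
    (hy : y ∈ region e) (s : ℝ) :
    zeta g e (shiftC g e s y) = zeta g e y + s * Real.sqrt (normSqDz g e y.2.1) := by
  have hp := normSqDz_pos g he hy
  simp only [zeta, shiftC, conormalC, Prod.snd_add, Prod.fst_add, Prod.smul_snd, Prod.smul_fst,
    smul_zero, add_zero, map_add, map_smul, inner_add_left, real_inner_smul_left]
  congr 2
  change _ * normSqDz g e y.2.1 = _
  rw [inv_mul_eq_div, Real.div_sqrt]

lemma continuousOn_shiftC (he : e ∈ IsManifold.maximalAtlas 𝓘(ℝ, Eucl n) 2 N) :
    ContinuousOn (fun q : ℝ × Coord n => shiftC g e q.1 q.2) {q | q.2 ∈ region e} := by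
  have h1 : ContinuousOn (fun q : ℝ × Coord n => normSqDz g e q.2.2.1) {q | q.2 ∈ region e} :=
    ContinuousOn.inner (𝕜 := ℝ) ((((contDiffOn_cogram he g).continuousOn).comp
      (f := fun q : ℝ × Coord n => q.2.2.1)
      (by fun_prop) fun y hy => hy).clm_apply continuousOn_const) continuousOn_const
  have h2 : ContinuousOn (fun q : ℝ × Coord n => conormalC g e q.2.2.1) {q | q.2 ∈ region e} :=
    ((h1.sqrt).inv₀ fun q hq => (Real.sqrt_pos.2 (normSqDz_pos g he hq)).ne').smul
      continuousOn_const
  refine ContinuousOn.add (f := fun q : ℝ × Coord n => q.2) (by fun_prop)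
    (ContinuousOn.smul (f := fun q : ℝ × Coord n => q.1) (by fun_prop) ?_)
  exact continuousOn_const.prodMk (continuousOn_const.prodMk (continuousOn_const.prodMk h2))

/-- The pairing of the source term with a multiple of `zeta`. -/
lemma sourcePairing_extend (he : IsAdaptedChart M e) {Ψ : Coord n → ℝ}
    (hΨ : ContinuousOn Ψ (region e)) {ρ : Phase n N} (hρ : ρ ∈ above e)
    (h : ρ ∈ hyperbolic g M ∪ glancing g M) :
    sourcePairing g M (extend e fun y => Ψ y * zeta g e y) ρ =
      Real.sqrt (normSqDz g e (toCoord e ρ).2.1) *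
        (Ψ (shiftC g e (Real.sqrt (-symbC g e (toCoord e ρ))) (toCoord e ρ)) +
          Ψ (shiftC g e (-Real.sqrt (-symbC g e (toCoord e ρ))) (toCoord e ρ))) / 2 := by
  rw [mem_hyperbolic_union_glancing_iff] at h
  obtain ⟨ht, hp⟩ := h
  have hy : toCoord e ρ ∈ region e := toCoord_mem_target he.1 hρ
  have hz := ((mem_tangentialBundle_iff g he hρ).1 ht).2
  -- At a tangential point ζ is 0, so at the lifts it equals ±λ|dz|. The opposite signs turn the
  -- difference of test values into a sum of values of Ψ, and the factor 2λ cancels.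
  have hval : ∀ s, extend e (fun y => Ψ y * zeta g e y) (shift g M s ρ) =
      Ψ (shiftC g e s (toCoord e ρ)) * (s * Real.sqrt (normSqDz g e (toCoord e ρ).2.1)) := by
    intro s
    rw [extend_of_mem _ (show shift g M s ρ ∈ above e from hρ),
      toCoord_shift_adapted g he hρ ht.1, zeta_shiftC g he.1 hy, hz, zero_add]
  rw [sourcePairing, ← symb_eq he.1 g hρ]
  split_ifs with h0
  · have hl : 0 < Real.sqrt (-symb g ρ) := Real.sqrt_pos.2 (by linarith)
    rw [liftPlus, liftMinus, hval, hval, cov_shift_normal g he hρ ht.1,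
      cov_shift_normal g he hρ ht.1]
    set l := Real.sqrt (-symb g ρ)
    rw [div_eq_iff (by linarith)]
    ring
  · have h00 : symb g ρ = 0 := le_antisymm hp (not_lt.1 h0)
    simp only [hval, h00, neg_zero, Real.sqrt_zero]
    have hc : ContinuousAt (fun s => Ψ (shiftC g e s (toCoord e ρ))) 0 := by
      have h1 : Continuous fun s => shiftC g e s (toCoord e ρ) := by unfold shiftC; fun_prop
      refine ContinuousAt.comp (g := Ψ) ?_ h1.continuousAt
      have : shiftC g e 0 (toCoord e ρ) = toCoord e ρ := by simp [shiftC]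
      rw [this]
      exact hΨ.continuousAt ((isOpen_region e).mem_nhds hy)
    set r := Real.sqrt (normSqDz g e (toCoord e ρ).2.1)
    -- The explicit factor `s` makes the product differentiable at 0 although Ψ is merely
    -- continuous.
    have hd : HasDerivAt (fun s => Ψ (shiftC g e s (toCoord e ρ)) * (s * r))
        (Ψ (shiftC g e 0 (toCoord e ρ)) * r) 0 := by
      rw [hasDerivAt_iff_tendsto_slope_zero]
      have h2 : Tendsto (fun s => Ψ (shiftC g e s (toCoord e ρ)) * r) (𝓝[≠] 0)
          (𝓝 (Ψ (shiftC g e 0 (toCoord e ρ)) * r)) :=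
        (hc.tendsto.mul_const r).mono_left nhdsWithin_le_nhds
      refine h2.congr' ?_
      filter_upwards [self_mem_nhdsWithin] with s hs
      have hs : s ≠ 0 := hs
      simp only [zero_add, zero_mul, mul_zero, sub_zero, smul_eq_mul]
      field_simp
    rw [hd.deriv]
    ring

end Adapted

end

/-! ### The source term in coordinates, and lifts in the support of μ. -/

section

variable {n : ℕ} {N : Type*} [TopologicalSpace N] [ChartedSpace (Eucl n) N]
  [IsManifold 𝓘(ℝ, Eucl n) 2 N] {M : Set N} {e : OpenPartialHomeomorph N (Eucl n)}
  (g : Metric1 n N)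

lemma shiftC_shiftC (s t : ℝ) (y : Coord n) :
    shiftC g e s (shiftC g e t y) = shiftC g e (t + s) y := by
  simp [shiftC, add_smul, add_assoc]

lemma shiftC_zero (y : Coord n) : shiftC g e 0 y = y := by simp [shiftC]

lemma shiftC_mem_region {s : ℝ} {y : Coord n} : shiftC g e s y ∈ region e ↔ y ∈ region e := by
  simp [shiftC, region]

/-- The pairing of the source term with `Ψ * zeta`, in coordinates. -/
def pairC (g : Metric1 n N) (e : OpenPartialHomeomorph N (Eucl n)) (Ψ : Coord n → ℝ)
    (y : Coord n) : ℝ :=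
  Real.sqrt (normSqDz g e y.2.1) * (Ψ (shiftC g e (Real.sqrt (-symbC g e y)) y) +
    Ψ (shiftC g e (-Real.sqrt (-symbC g e y)) y)) / 2

section

variable (he : e ∈ IsManifold.maximalAtlas 𝓘(ℝ, Eucl n) 2 N)
include he

lemma continuousOn_normSqDz : ContinuousOn (fun y : Coord n => normSqDz g e y.2.1) (region e) :=
  ContinuousOn.inner (𝕜 := ℝ) ((((contDiffOn_cogram he g).continuousOn).comp
      (f := fun q : Coord n => q.2.1)
      (by fun_prop) fun y hy => hy).clm_apply continuousOn_const) continuousOn_const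

lemma contDiffOn_zeta : ContDiffOn ℝ 1 (zeta g e) (region e) :=
  (contDiffOn_cogram_apply he g).inner ℝ contDiffOn_const

lemma continuousOn_shift_sqrt (σ : ℝ) :
    ContinuousOn (fun y => shiftC g e (σ * Real.sqrt (-symbC g e y)) y) (region e) := by
  have h := (contDiffOn_symbC he g).continuousOn
  exact (continuousOn_shiftC g he).comp
    (f := fun y : Coord n => (σ * Real.sqrt (-symbC g e y), y))
    ((continuousOn_const.mul h.neg.sqrt).prodMk continuousOn_id) fun y hy => hy

lemma continuousOn_pairC {Ψ : Coord n → ℝ} (hΨ : ContinuousOn Ψ (region e)) :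
    ContinuousOn (pairC g e Ψ) (region e) := by
  have h1 := hΨ.comp (continuousOn_shift_sqrt g he 1) fun y hy => (shiftC_mem_region g).2 hy
  have h2 := hΨ.comp (continuousOn_shift_sqrt g he (-1)) fun y hy => (shiftC_mem_region g).2 hy
  simp only [one_mul, neg_one_mul] at h1 h2
  exact ((continuousOn_normSqDz g he).sqrt.mul (h1.add h2)).div_const 2

/-- Since |ξ|² ≥ 0, -p is at most τ²; as τ is common to a point and its lifts, this bounds the shift
by data of the lift. -/
lemma sqrt_neg_symbC_le {y : Coord n} (hy : y ∈ region e) :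
    Real.sqrt (-symbC g e y) ≤ |y.2.2.1| := by
  rw [← Real.sqrt_sq_eq_abs]
  refine Real.sqrt_le_sqrt ?_
  have : 0 ≤ inner ℝ (cogram g e y.2.1 y.2.2.2) y.2.2.2 := by
    by_cases h : y.2.2.2 = 0
    · simp [h]
    · exact (cogram_pos he g hy h).le
  simp only [symbC]
  linarith

/-- The points one of whose two lifts lies in a given compact set form a relatively compact set. -/
lemma exists_isCompact_of_shift {K : Set (Coord n)} (hK : IsCompact K) (hKe : K ⊆ region e) :
    ∃ K', IsCompact K' ∧ K' ⊆ region e ∧ ∀ y ∈ region e,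
      (shiftC g e (Real.sqrt (-symbC g e y)) y ∈ K ∨
        shiftC g e (-Real.sqrt (-symbC g e y)) y ∈ K) → y ∈ K' := by
  obtain ⟨T, hT⟩ := hK.exists_bound_of_continuousOn (f := fun y : Coord n => y.2.2.1)
    (by fun_prop)
  -- `T` bounds |τ| on `K`; each such point is recovered from its lift by shifting back a distance
  -- at most `T`.
  refine ⟨(fun q : ℝ × Coord n => shiftC g e q.1 q.2) '' (Icc (-T) T ×ˢ K), ?_, ?_, ?_⟩
  · exact (isCompact_Icc.prod hK).image_of_continuousOn
      ((continuousOn_shiftC g he).mono fun q hq => hKe hq.2)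
  · rintro _ ⟨q, hq, rfl⟩
    exact (shiftC_mem_region g).2 (hKe hq.2)
  · intro y hy h
    have hl := sqrt_neg_symbC_le g he hy
    have h0 := Real.sqrt_nonneg (-symbC g e y)
    have key : ∀ s : ℝ, |s| ≤ |y.2.2.1| → shiftC g e s y ∈ K →
        y ∈ (fun q : ℝ × Coord n => shiftC g e q.1 q.2) '' (Icc (-T) T ×ˢ K) := by
      intro s hs hsK
      refine ⟨(-s, shiftC g e s y), ⟨?_, hsK⟩, ?_⟩
      · have h1 := hT _ hsK
        have h2 : (shiftC g e s y).2.2.1 = y.2.2.1 := by simp [shiftC]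
        rw [h2, Real.norm_eq_abs] at h1
        rw [mem_Icc, ← abs_le, abs_neg]
        exact hs.trans h1
      · simp [shiftC_shiftC, shiftC_zero]
    rcases h with h | h
    · exact key _ (by rwa [abs_of_nonneg h0]) h
    · exact key _ (by rwa [abs_neg, abs_of_nonneg h0]) h

omit he in
lemma pairC_eq_zero {K K' : Set (Coord n)} {Ψ : Coord n → ℝ} {y : Coord n} (hy : y ∈ region e)
    (hK' : ∀ y ∈ region e,
      (shiftC g e (Real.sqrt (-symbC g e y)) y ∈ K ∨
        shiftC g e (-Real.sqrt (-symbC g e y)) y ∈ K) → y ∈ K')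
    (hΨ : ∀ y, y ∉ K → Ψ y = 0) (hyK : y ∉ K') : pairC g e Ψ y = 0 := by
  have h1 : shiftC g e (Real.sqrt (-symbC g e y)) y ∉ K := fun h => hyK (hK' y hy (Or.inl h))
  have h2 : shiftC g e (-Real.sqrt (-symbC g e y)) y ∉ K := fun h => hyK (hK' y hy (Or.inr h))
  simp [pairC, hΨ _ h1, hΨ _ h2]

end

section Measure

variable [T2Space N] [SecondCountableTopology N]

lemma measurableSet_boundary (he : IsAdaptedChart M e) :
    MeasurableSet ((hyperbolic g M ∪ glancing g M) ∩ above e : Set (Phase n N)) := by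
  have hm := (isOpen_above (n := n) e).measurableSet
  have hc := continuousOn_toCoord (N := N) he.1
  have hz : ContinuousOn (fun ρ : Phase n N => (toCoord e ρ).2.1 (Fin.last n)) (above e) :=
    (by fun_prop : Continuous fun y : Coord n => y.2.1 (Fin.last n)).comp_continuousOn hc
  have hζ : ContinuousOn (fun ρ : Phase n N => zeta g e (toCoord e ρ)) (above e) :=
    (contDiffOn_zeta g he.1).continuousOn.comp hc fun ρ hρ => toCoord_mem_target he.1 hρ
  have hp : ContinuousOn (fun ρ : Phase n N => symbC g e (toCoord e ρ)) (above e) :=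
    (contDiffOn_symbC he.1 g).continuousOn.comp hc fun ρ hρ => toCoord_mem_target he.1 hρ
  have hset : ((hyperbolic g M ∪ glancing g M) ∩ above e : Set (Phase n N)) =
      ((above e ∩ (fun ρ : Phase n N => (toCoord e ρ).2.1 (Fin.last n)) ⁻¹' {0}) ∩
      (above e ∩ (fun ρ : Phase n N => zeta g e (toCoord e ρ)) ⁻¹' {0})) ∩
      (above e ∩ (fun ρ : Phase n N => symbC g e (toCoord e ρ)) ⁻¹' Iic 0) := by
    ext ρ
    simp only [mem_inter_iff, mem_preimage, mem_singleton_iff, mem_Iic]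
    constructor
    · rintro ⟨h, hρ⟩
      rw [mem_hyperbolic_union_glancing_iff, mem_tangentialBundle_iff g he hρ,
        symb_eq he.1 g hρ] at h
      tauto
    · rintro ⟨⟨⟨hρ, h1⟩, -, h2⟩, -, h3⟩
      refine ⟨?_, hρ⟩
      rw [mem_hyperbolic_union_glancing_iff, mem_tangentialBundle_iff g he hρ,
        symb_eq he.1 g hρ]
      tauto
  have key : ∀ {F : Phase n N → ℝ} {s : Set ℝ}, ContinuousOn F (above e) → IsClosed s →
      MeasurableSet (above e ∩ F ⁻¹' s) := by
    intro F s hF hs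
    obtain ⟨u, hu, hu'⟩ := continuousOn_iff_isClosed.1 hF s hs
    rw [inter_comm, hu']
    exact hu.measurableSet.inter hm
  rw [hset]
  exact ((key hz isClosed_singleton).inter (key hζ isClosed_singleton)).inter (key hp isClosed_Iic)

/-- The union of the two regions is closed: its points lie over the closed set ∂M, and in an adapted
chart it is given by z = 0, ζ = 0, p ≤ 0. -/
lemma mem_of_mem_support (hM : IsCompactC2Domain (n := n) M) {ν : Measure (Phase n N)}
    {ρ : Phase n N}
    (hρ : ρ ∈ (ν.restrict (hyperbolic g M ∪ glancing g M)).support) :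
    ρ ∈ hyperbolic g M ∪ glancing g M := by
  have hcl := (Measure.support_restrict_subset hρ).1
  have hfr : base ρ ∈ frontier M := by
    have : IsClosed {ρ : Phase n N | base ρ ∈ frontier M} :=
      isClosed_frontier.preimage continuous_base
    refine closure_minimal (fun ρ' hρ' => ?_) this hcl
    exact (mem_hyperbolic_union_glancing_iff g |>.1 hρ').1.1
  obtain ⟨e, he, hm⟩ := hM.exists_chart _ hfr
  have hρe : ρ ∈ above e := hm
  have hc := (continuousOn_toCoord (N := N) he.1).continuousAt ((isOpen_above e).mem_nhds hρe)
  have hr := (isOpen_region e).mem_nhds (toCoord_mem_target he.1 hρe)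
  have hz : ContinuousAt (fun ρ : Phase n N => (toCoord e ρ).2.1 (Fin.last n)) ρ :=
    (by fun_prop : Continuous fun y : Coord n => y.2.1 (Fin.last n)).continuousAt.comp hc
  have hζ : ContinuousAt (fun ρ : Phase n N => zeta g e (toCoord e ρ)) ρ :=
    ContinuousAt.comp (g := zeta g e) ((contDiffOn_zeta g he.1).continuousOn.continuousAt hr) hc
  have hp : ContinuousAt (fun ρ : Phase n N => symbC g e (toCoord e ρ)) ρ :=
    ContinuousAt.comp (g := symbC g e) ((contDiffOn_symbC he.1 g).continuousOn.continuousAt hr) hc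
  have hfreq : ∃ᶠ ρ' in 𝓝 ρ, (toCoord e ρ').2.1 (Fin.last n) = 0 ∧ zeta g e (toCoord e ρ') = 0 ∧
      symbC g e (toCoord e ρ') ≤ 0 := by
    refine ((mem_closure_iff_frequently.1 hcl).and_eventually
      ((isOpen_above e).mem_nhds hρe)).mono fun ρ' h => ?_
    have h1 := h.1
    have h2 : ρ' ∈ above e := h.2
    rw [mem_hyperbolic_union_glancing_iff, mem_tangentialBundle_iff g he h2,
        symb_eq he.1 g h2] at h1
    tauto
  rw [mem_hyperbolic_union_glancing_iff, mem_tangentialBundle_iff g he hρe, symb_eq he.1 g hρe]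
  exact ⟨⟨isClosed_singleton.mem_of_frequently_of_tendsto (hfreq.mono fun _ h => h.1) hz,
    isClosed_singleton.mem_of_frequently_of_tendsto (hfreq.mono fun _ h => h.2.1) hζ⟩,
    isClosed_Iic.mem_of_frequently_of_tendsto (hfreq.mono fun _ h => h.2.2) hp⟩

lemma aestronglyMeasurable_comp_toCoord (he : e ∈ IsManifold.maximalAtlas 𝓘(ℝ, Eucl n) 2 N)
    {F : Coord n → ℝ} (hF : ContinuousOn F (region e)) (μ : Measure (Phase n N)) :
    AEStronglyMeasurable (fun ρ => F (toCoord e ρ)) (μ.restrict (above e)) :=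
  (hF.comp (continuousOn_toCoord he) fun _ hρ => toCoord_mem_target he hρ).aestronglyMeasurable
    (isOpen_above e).measurableSet

/-- The measure equation tested on a multiple of `zeta`. -/
lemma measureEquation_zeta (he : IsAdaptedChart M e) {U : Set (Phase n N)} {f : Phase n N → ℝ}
    {μ ν : Measure (Phase n N)} (heq : MeasureEquation g M U f μ ν) {K : Set (Coord n)}
    {Ψ : Coord n → ℝ} (hΨ : ContinuousOn Ψ (region e))
    (H : IsCoordTest U e K fun y => Ψ y * zeta g e y) :
    ∫ ρ in above e, hamD g e (fun y => Ψ y * zeta g e y) (toCoord e ρ) ∂μ =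
      (∫ ρ in above e, f ρ * (Ψ (toCoord e ρ) * zeta g e (toCoord e ρ)) ∂μ)
        - ∫ ρ in (hyperbolic g M ∪ glancing g M) ∩ above e, pairC g e Ψ (toCoord e ρ) ∂ν := by
  rw [measureEquation_extend he.1 g heq H]
  congr 1
  exact setIntegral_congr_fun (measurableSet_boundary g he)
    fun ρ hρ => sourcePairing_extend g he hΨ hρ.2 hρ.1

/-- If a lift of a point of the support of `ν` lies in `U` then it is in the support of `μ`. -/
lemma lift_mem_support (hM : IsCompactC2Domain (n := n) M) {U : Set (Phase n N)} (hU : IsOpen U)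
    {f : Phase n N → ℝ} {μ ν : Measure (Phase n N)} [IsFiniteMeasureOnCompacts ν]
    (heq : MeasureEquation g M U f μ ν) {ρ : Phase n N}
    (hρ : ρ ∈ (ν.restrict (hyperbolic g M ∪ glancing g M)).support) {σ : ℝ}
    (hσ : σ = 1 ∨ σ = -1) (hlift : shift g M (σ * Real.sqrt (-symb g ρ)) ρ ∈ U) :
    shift g M (σ * Real.sqrt (-symb g ρ)) ρ ∈ μ.support := by
  by_contra hns
  have hHG := mem_of_mem_support g hM hρ
  have htan := ((mem_hyperbolic_union_glancing_iff g).1 hHG).1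
  obtain ⟨e, he, hm⟩ := hM.exists_chart _ htan.1
  have hρe : ρ ∈ above e := hm
  have hy := toCoord_mem_target he.1 hρe
  set ρ₁ := shift g M (σ * Real.sqrt (-symb g ρ)) ρ with hρ₁
  have hρ₁e : ρ₁ ∈ above e := hm
  have hy₁ := toCoord_mem_target he.1 hρ₁e
  obtain ⟨W', hW', hμW'⟩ := Measure.notMem_support_iff_exists.1 hns
  set W := interior W' ∩ U with hW
  have hWo : IsOpen W := isOpen_interior.inter hU
  have hμW : μ W = 0 := measure_mono_null (inter_subset_left.trans interior_subset) hμW'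
  have hO : region e ∩ ofCoord e ⁻¹' W ∈ 𝓝 (toCoord e ρ₁) := by
    refine ((continuousOn_ofCoord he.1).isOpen_inter_preimage (isOpen_region e) hWo).mem_nhds
      ⟨hy₁, ?_⟩
    rw [mem_preimage, ofCoord_toCoord he.1 hρ₁e]
    exact ⟨mem_interior_iff_mem_nhds.2 hW', hlift⟩
  -- The bump sits at the lift, inside an open subset of U that is μ-null, so both μ-integrals of
  -- the equation vanish and the nonnegative ν-integral must vanish too.
  obtain ⟨ψ, hψs, hψc, hψd, hψr, hψ1⟩ := exists_contDiff_tsupport_subset (n := 1) hO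
  have hψ0 : ∀ y, 0 ≤ ψ y := fun y => (hψr (mem_range_self y)).1
  have hψz : ∀ y, y ∉ tsupport ψ → ψ y = 0 := fun y hy => image_eq_zero_of_notMem_tsupport hy
  have hψco : ContinuousOn ψ (region e) := hψd.continuous.continuousOn
  have H : IsCoordTest U e (tsupport ψ) fun y => ψ y * zeta g e y :=
    { contDiffOn := hψd.contDiffOn.mul (contDiffOn_zeta g he.1)
      isCompact := hψc
      subset_region := fun y hy => (hψs hy).1
      eq_zero := fun y _ hy => by rw [hψz y hy, zero_mul]
      subset_preimage := fun y hy => (hψs hy).2.2 }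
  have hae : ∀ᵐ ρ' ∂μ.restrict (above e), toCoord e ρ' ∉ tsupport ψ := by
    rw [ae_restrict_iff' (isOpen_above e).measurableSet]
    filter_upwards [measure_eq_zero_iff_ae_notMem.1 hμW] with ρ' h1 h2 h3
    refine h1 ?_
    have := (hψs h3).2
    rwa [mem_preimage, ofCoord_toCoord he.1 h2] at this
  have hE := measureEquation_zeta g he heq hψco H
  rw [integral_eq_zero_of_ae, integral_eq_zero_of_ae, zero_sub, zero_eq_neg] at hE
  rotate_left
  · filter_upwards [hae] with ρ' h
    simp [hψz _ h]
  · filter_upwards [hae] with ρ' h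
    refine hamD_eq_zero g ?_
    filter_upwards [(isClosed_tsupport ψ).isOpen_compl.mem_nhds h] with y hy
    simp [hψz y hy]
  obtain ⟨K', hK', hK'e, hK's⟩ := exists_isCompact_of_shift g he.1 H.isCompact H.subset_region
  have hcont := continuousOn_pairC g he.1 hψco
  have hnn : ∀ y, 0 ≤ pairC g e ψ y := fun y => by
    have := hψ0 (shiftC g e (Real.sqrt (-symbC g e y)) y)
    have := hψ0 (shiftC g e (-Real.sqrt (-symbC g e y)) y)
    unfold pairC
    positivity
  have hint : IntegrableOn (fun ρ' => pairC g e ψ (toCoord e ρ'))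
      ((hyperbolic g M ∪ glancing g M) ∩ above e) ν := by
    refine IntegrableOn.mono_set (t := above e) ?_ inter_subset_right
    have hKc := isCompact_image_ofCoord he.1 (N := N) hK' hK'e
    have h1 : IntegrableOn (fun ρ' => pairC g e ψ (toCoord e ρ')) (ofCoord e '' K') ν := by
      refine ContinuousOn.integrableOn_compact hKc ?_
      refine hcont.comp ((continuousOn_toCoord he.1).mono ?_) ?_
      · exact fun ρ' h => ((mem_image_ofCoord he.1 hK'e).1 h).1
      · exact fun ρ' h => hK'e ((mem_image_ofCoord he.1 hK'e).1 h).2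
    refine h1.of_forall_sdiff_eq_zero (isOpen_above e).measurableSet ?_
    intro ρ' h
    refine pairC_eq_zero g (toCoord_mem_target he.1 h.1) hK's hψz fun h' => h.2 ?_
    exact (mem_image_ofCoord he.1 hK'e).2 ⟨h.1, h'⟩
  have hz := (integral_eq_zero_iff_of_nonneg (fun ρ' => hnn _) hint).1 hE
  have hVo : IsOpen (above e ∩ (fun ρ' => pairC g e ψ (toCoord e ρ')) ⁻¹' Ioi 0) :=
    (hcont.comp (continuousOn_toCoord he.1)
      fun _ hρ => toCoord_mem_target he.1 hρ).isOpen_inter_preimage (isOpen_above e) isOpen_Ioi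
  -- One of the two averaged values of ψ at the base point is 1 and the other is nonnegative.
  -- Positivity persists nearby, giving an open neighborhood that is null for the restriction of ν.
  have hρV : ρ ∈ above e ∩ (fun ρ' => pairC g e ψ (toCoord e ρ')) ⁻¹' Ioi 0 := by
    refine ⟨hρe, ?_⟩
    have h1 : toCoord e ρ₁ = shiftC g e (σ * Real.sqrt (-symbC g e (toCoord e ρ))) (toCoord e ρ) := by
      rw [hρ₁, toCoord_shift_adapted g he hρe htan.1, symb_eq he.1 g hρe]
    rw [h1] at hψ1
    have h2 := hψ0 (shiftC g e (Real.sqrt (-symbC g e (toCoord e ρ))) (toCoord e ρ))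
    have h3 := hψ0 (shiftC g e (-Real.sqrt (-symbC g e (toCoord e ρ))) (toCoord e ρ))
    have h4 := Real.sqrt_pos.2 (normSqDz_pos g he.1 hy)
    rw [mem_preimage, mem_Ioi, pairC]
    have h5 : 0 < ψ (shiftC g e (Real.sqrt (-symbC g e (toCoord e ρ))) (toCoord e ρ)) +
        ψ (shiftC g e (-Real.sqrt (-symbC g e (toCoord e ρ))) (toCoord e ρ)) := by
      rcases hσ with rfl | rfl
      · rw [one_mul] at hψ1; linarith
      · rw [neg_one_mul] at hψ1; linarith
    positivity
  refine Measure.notMem_support_iff_exists.2 ⟨_, hVo.mem_nhds hρV, ?_⟩ hρ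
  rw [Measure.restrict_apply hVo.measurableSet]
  rw [Filter.EventuallyEq, ae_restrict_iff' (measurableSet_boundary g he)] at hz
  refine measure_mono_null ?_ (ae_iff.1 hz)
  rintro ρ' ⟨⟨h1, h2⟩, h3⟩
  simp only [mem_ofPred_eq, Classical.not_imp]
  exact ⟨⟨h3, h1⟩, (show 0 < pairC g e ψ (toCoord e ρ') from h2).ne'⟩

end Measure

end

/-! ### Symplectic invariance and the sign of H_p² z. -/

section

variable {n : ℕ} {N : Type*} [TopologicalSpace N] [ChartedSpace (Eucl n) N]

/-- The canonical symplectic form. -/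
def symplectic (u v : Coord n) : ℝ :=
  u.1 * v.2.2.1 - u.2.2.1 * v.1 + (inner ℝ u.2.1 v.2.2.2 - inner ℝ u.2.2.2 v.2.1)

lemma symplectic_hamVec (f : Coord n → ℝ) (y v : Coord n) :
    symplectic (hamVec f y) v = fderiv ℝ f y v := by
  obtain ⟨a, u, b, w⟩ := v
  set L := fderiv ℝ f y with hL
  have h1 : ((a, u, b, w) : Coord n) = a • (1, 0, 0, 0)
      + (ContinuousLinearMap.inr ℝ ℝ (Eucl n × ℝ × Eucl n)) (ContinuousLinearMap.inl ℝ _ _ u)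
      + b • (0, 0, 1, 0)
      + (ContinuousLinearMap.inr ℝ ℝ (Eucl n × ℝ × Eucl n)) (ContinuousLinearMap.inr ℝ _ _
        (ContinuousLinearMap.inr ℝ _ _ w)) := by
    simp
  have h2 : L (a, u, b, w) = a * L (1, 0, 0, 0) + ∑ i, u i * L (0, stdVec n i, 0, 0)
      + b * L (0, 0, 1, 0) + ∑ i, w i * L (0, 0, 0, stdVec n i) := by
    rw [h1, map_add, map_add, map_add, map_smul, map_smul]
    nth_rewrite 1 [← sum_smul_stdVec u]
    nth_rewrite 1 [← sum_smul_stdVec w]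
    simp only [map_sum, map_smul, smul_eq_mul]
    rfl
  rw [h2]
  simp only [symplectic, hamVec, PiLp.inner_apply, ← hL]
  simp only [RCLike.inner_apply, conj_trivial, mul_neg, Finset.sum_neg_distrib]
  ring

lemma symplectic_ext {u u' : Coord n} (h : ∀ v, symplectic u v = symplectic u' v) : u = u' := by
  refine Prod.ext ?_ (Prod.ext ?_ (Prod.ext ?_ ?_))
  · simpa [symplectic] using h (0, 0, 1, 0)
  · exact ext_inner_right ℝ fun v => by simpa [symplectic] using h (0, 0, 0, v)
  · simpa [symplectic] using h (1, 0, 0, 0)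
  · exact ext_inner_right ℝ fun v => by simpa [symplectic] using h (0, v, 0, 0)

/-- A linear symplectic map is injective, hence bijective in finite dimension, and so it carries the
Hamiltonian vector of f ∘ Φ to that of f. Only derivatives at one point are used, which suits
coordinate changes that are merely C¹. -/
lemma poisson_comp {Φ : Coord n → Coord n} {D : Coord n →L[ℝ] Coord n} {y : Coord n}
    (hΦ : HasFDerivAt Φ D y) (hD : ∀ u v, symplectic (D u) (D v) = symplectic u v)
    {f h : Coord n → ℝ} (hf : DifferentiableAt ℝ f (Φ y)) (hh : DifferentiableAt ℝ h (Φ y)) :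
    poisson (f ∘ Φ) (h ∘ Φ) y = poisson f h (Φ y) := by
  have hinj : Function.Injective D.toLinearMap := by
    rw [← LinearMap.ker_eq_bot, LinearMap.ker_eq_bot']
    intro u hu
    have hu : D u = 0 := hu
    refine symplectic_ext fun v => ?_
    rw [← hD, hu]
    simp [symplectic]
  have hsurj : Function.Surjective D := LinearMap.injective_iff_surjective.1 hinj
  have hcomp : ∀ {q : Coord n → ℝ}, DifferentiableAt ℝ q (Φ y) → ∀ v,
      fderiv ℝ (q ∘ Φ) y v = fderiv ℝ q (Φ y) (D v) := by
    intro q hq v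
    rw [(hq.hasFDerivAt.comp y hΦ).fderiv]; rfl
  have hX : D (hamVec (f ∘ Φ) y) = hamVec f (Φ y) := by
    refine symplectic_ext fun v => ?_
    obtain ⟨w, rfl⟩ := hsurj v
    rw [hD, symplectic_hamVec, symplectic_hamVec, hcomp hf]
  rw [poisson_eq, poisson_eq, hcomp hh, hX]

/-- The projection of coordinate space to the space variable. -/
def projX (n : ℕ) : Coord n →L[ℝ] Eucl n :=
  (ContinuousLinearMap.fst ℝ (Eucl n) (ℝ × Eucl n)).comp
    (ContinuousLinearMap.snd ℝ ℝ (Eucl n × ℝ × Eucl n))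

lemma projX_apply (y : Coord n) : projX n y = y.2.1 := rfl

lemma hasFDerivAt_projX (y : Coord n) : HasFDerivAt (fun y : Coord n => y.2.1) (projX n) y :=
  (projX n).hasFDerivAt

variable [IsManifold 𝓘(ℝ, Eucl n) 2 N]

section Invariance

variable {e e' : OpenPartialHomeomorph N (Eucl n)}
  (he : e ∈ IsManifold.maximalAtlas 𝓘(ℝ, Eucl n) 2 N)
  (he' : e' ∈ IsManifold.maximalAtlas 𝓘(ℝ, Eucl n) 2 N)

include he he'

/-- The change of canonical coordinates between two charts is symplectic. -/
lemma hasFDerivAt_toCoord_ofCoord {y₀ : Coord n}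
    (hy₀ : y₀.2.1 ∈ e.target ∩ e.symm ⁻¹' e'.source) :
    ∃ D : Coord n →L[ℝ] Coord n,
      HasFDerivAt (fun y => toCoord e' (ofCoord e y : Phase n N)) D y₀ ∧
      ∀ u v, symplectic (D u) (D v) = symplectic u v := by
  set φ : Eucl n → Eucl n := fun x => e' (e.symm x) with hφ
  set φ' : Eucl n → Eucl n := fun x => e (e'.symm x) with hφ'
  set Ω : Coord n → Eucl n := fun y => (toCoord e' (ofCoord e y : Phase n N)).2.2.2 with hΩ
  have hopen : IsOpen {y : Coord n | y.2.1 ∈ e.target ∩ e.symm ⁻¹' e'.source} :=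
    isOpen_transition.preimage (by fun_prop)
  have hφ2 : ContDiffAt ℝ 2 φ y₀.2.1 :=
    (contDiffOn_transition he he').contDiffAt (isOpen_transition.mem_nhds hy₀)
  have hmem : φ y₀.2.1 ∈ e'.target ∩ e'.symm ⁻¹' e.source := by
    refine ⟨e'.map_source hy₀.2, ?_⟩
    rw [mem_preimage, e'.left_inv hy₀.2]
    exact e.map_target hy₀.1
  have hφ'2 : ContDiffAt ℝ 2 φ' (φ y₀.2.1) :=
    (contDiffOn_transition he' he).contDiffAt (isOpen_transition.mem_nhds hmem)
  have hx : HasFDerivAt (fun y : Coord n => y.2.1) (projX n) y₀ := hasFDerivAt_projX _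
  have hω : HasFDerivAt (fun y : Coord n => y.2.2.2)
      ((ContinuousLinearMap.snd ℝ ℝ (Eucl n)).comp
      ((ContinuousLinearMap.snd ℝ (Eucl n) (ℝ × Eucl n)).comp
        (ContinuousLinearMap.snd ℝ ℝ (Eucl n × ℝ × Eucl n)))) y₀ :=
    ((ContinuousLinearMap.snd ℝ ℝ (Eucl n)).comp
      ((ContinuousLinearMap.snd ℝ (Eucl n) (ℝ × Eucl n)).comp
        (ContinuousLinearMap.snd ℝ ℝ (Eucl n × ℝ × Eucl n)))).hasFDerivAt
  have hφd := hφ2.differentiableAt (by simp)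
  -- first description of the fibre component, from which it is differentiable
  have hΩ1 : ∀ y : Coord n, y.2.1 ∈ e.target ∩ e.symm ⁻¹' e'.source → ∀ v,
      inner ℝ (Ω y) v = inner ℝ y.2.2.2 (fderiv ℝ φ' (φ y.2.1) v) := by
    intro y hy v
    have h := inner_covCoord_transition he' he (m := e.symm y.2.1) hy.2 (e.map_target hy.1)
      (cov (ofCoord e y : Phase n N)) v
    have h2 : covCoord e (e.symm y.2.1) (cov (ofCoord e y : Phase n N)) = y.2.2.2 :=
      congrArg (fun y : Coord n => y.2.2.2) (toCoord_ofCoord he (N := N) hy.1)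
    rw [h2] at h
    exact h
  have hΩ2 : ∀ y : Coord n, y.2.1 ∈ e.target ∩ e.symm ⁻¹' e'.source → ∀ v,
      inner ℝ y.2.2.2 v = inner ℝ (Ω y) (fderiv ℝ φ y.2.1 v) := by
    intro y hy v
    have h := inner_covCoord_transition he he' (m := e.symm y.2.1) (e.map_target hy.1) hy.2
      (cov (ofCoord e y : Phase n N)) v
    have h2 : covCoord e (e.symm y.2.1) (cov (ofCoord e y : Phase n N)) = y.2.2.2 :=
      congrArg (fun y : Coord n => y.2.2.2) (toCoord_ofCoord he (N := N) hy.1)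
    rw [h2, e.right_inv hy.1] at h
    exact h
  have hΩd : DifferentiableAt ℝ Ω y₀ := by
    rw [differentiableAt_euclidean]
    intro i
    have h1 : (fun y => Ω y i) =ᶠ[𝓝 y₀]
        fun y => inner ℝ y.2.2.2 (fderiv ℝ φ' (φ y.2.1) (stdVec n i)) := by
      filter_upwards [hopen.mem_nhds hy₀] with y hy
      rw [← hΩ1 y hy]
      simp [stdVec, EuclideanSpace.inner_single_right]
    refine DifferentiableAt.congr_of_eventuallyEq ?_ h1
    have h2 : DifferentiableAt ℝ (fderiv ℝ φ') (φ y₀.2.1) :=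
      (hφ'2.fderiv_right (m := 1) (by norm_num)).differentiableAt (by simp)
    have h3 : DifferentiableAt ℝ (fun y : Coord n => fderiv ℝ φ' (φ y.2.1)) y₀ :=
      by
      have h4 : DifferentiableAt ℝ (φ ∘ fun y : Coord n => y.2.1) y₀ :=
        DifferentiableAt.comp y₀ hφd hx.differentiableAt
      exact DifferentiableAt.comp (g := fderiv ℝ φ') y₀ h2 h4
    exact hω.differentiableAt.inner ℝ (h3.clm_apply (differentiableAt_const _))
  -- Obtained by differentiating ω·v = Ω·dφ(x)v, the invariance of the pairing between covectors and
  -- vectors.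
  have hkey : ∀ u : Coord n, ∀ v : Eucl n, inner ℝ (fderiv ℝ Ω y₀ u) (fderiv ℝ φ y₀.2.1 v) =
      inner ℝ u.2.2.2 v - inner ℝ (Ω y₀) (fderiv ℝ (fderiv ℝ φ) y₀.2.1 u.2.1 v) := by
    intro u v
    have h2 : HasFDerivAt (fderiv ℝ φ) (fderiv ℝ (fderiv ℝ φ) y₀.2.1) y₀.2.1 :=
      ((hφ2.fderiv_right (m := 1) (by norm_num)).differentiableAt (by simp)).hasFDerivAt
    have h3 := (h2.comp y₀ hx).clm_apply (hasFDerivAt_const v y₀)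
    have h4 := hΩd.hasFDerivAt.inner ℝ h3
    have h5 := hω.inner ℝ (hasFDerivAt_const v y₀)
    have h6 : (fun y : Coord n => inner ℝ y.2.2.2 v) =ᶠ[𝓝 y₀]
        fun y => inner ℝ (Ω y) (fderiv ℝ φ y.2.1 v) := by
      filter_upwards [hopen.mem_nhds hy₀] with y hy using hΩ2 y hy v
    have h7 := congrArg (fun L => L u) (h5.unique (h4.congr_of_eventuallyEq h6))
    simp [fderivInnerCLM_apply, projX_apply] at h7
    linarith
  -- The two second-order terms in the transformed symplectic form cancel by this symmetry.
  have hsymm : ∀ u v, fderiv ℝ (fderiv ℝ φ) y₀.2.1 u v = fderiv ℝ (fderiv ℝ φ) y₀.2.1 v u :=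
    (hφ2.isSymmSndFDerivAt (by simp))
  have hφx : HasFDerivAt (fun y : Coord n => φ y.2.1) ((fderiv ℝ φ y₀.2.1).comp (projX n)) y₀ :=
    HasFDerivAt.comp (g := φ) (f := fun y : Coord n => y.2.1) y₀ hφd.hasFDerivAt hx
  have hτ : HasFDerivAt (fun y : Coord n => y.2.2.1) ((ContinuousLinearMap.fst ℝ ℝ (Eucl n)).comp
      ((ContinuousLinearMap.snd ℝ (Eucl n) (ℝ × Eucl n)).comp
        (ContinuousLinearMap.snd ℝ ℝ (Eucl n × ℝ × Eucl n)))) y₀ :=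
    ((ContinuousLinearMap.fst ℝ ℝ (Eucl n)).comp
      ((ContinuousLinearMap.snd ℝ (Eucl n) (ℝ × Eucl n)).comp
        (ContinuousLinearMap.snd ℝ ℝ (Eucl n × ℝ × Eucl n)))).hasFDerivAt
  have hΦ := (hasFDerivAt_fst (𝕜 := ℝ) (p := y₀)).prodMk (hφx.prodMk (hτ.prodMk hΩd.hasFDerivAt))
  refine ⟨_, hΦ, ?_⟩
  intro u v
  simp only [symplectic, ContinuousLinearMap.prod_apply, ContinuousLinearMap.comp_apply,
    ContinuousLinearMap.coe_fst', ContinuousLinearMap.coe_snd', projX_apply]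
  rw [real_inner_comm, hkey, hkey, hsymm v.2.1 u.2.1, real_inner_comm u.2.1]
  ring

lemma ham_eq_ham {f q : Phase n N → ℝ} {ρ : Phase n N} (hρ : ρ ∈ above e) (hρ' : ρ ∈ above e')
    (hf : DifferentiableAt ℝ (f ∘ ofCoord e') (toCoord e' ρ))
    (hq : DifferentiableAt ℝ (q ∘ ofCoord e') (toCoord e' ρ)) :
    ham e f q ρ = ham e' f q ρ := by
  have hy : (toCoord e ρ).2.1 ∈ e.target ∩ e.symm ⁻¹' e'.source :=
    ⟨e.map_source hρ, by
      show e.symm (e (base ρ)) ∈ e'.source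
      rw [e.left_inv hρ]; exact hρ'⟩
  obtain ⟨D, hD, hsym⟩ := hasFDerivAt_toCoord_ofCoord he he' hy
  have hΦ : toCoord e' (ofCoord e (toCoord e ρ) : Phase n N) = toCoord e' ρ := by
    rw [ofCoord_toCoord he hρ]
  have hc := poisson_comp hD hsym (f := f ∘ ofCoord e') (h := q ∘ ofCoord e')
    (by rwa [hΦ]) (by rwa [hΦ])
  rw [hΦ] at hc
  refine Eq.trans (poisson_congr ?_ ?_) hc
  all_goals
    filter_upwards [(isOpen_transition (e := e) (e' := e')).preimage
      (by fun_prop : Continuous fun y : Coord n => y.2.1) |>.mem_nhds hy] with y hy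
    have : (ofCoord e y : Phase n N) ∈ above e' := hy.2
    simp only [Function.comp]
    rw [ofCoord_toCoord he' this]

end Invariance

section Glancing

variable {M : Set N} {e e' : OpenPartialHomeomorph N (Eucl n)} (g : Metric1 n N)

lemma ham_zfun (he : e ∈ IsManifold.maximalAtlas 𝓘(ℝ, Eucl n) 2 N) {ρ : Phase n N}
    (hρ : ρ ∈ above e) : ham e (symb g) (zfun e) ρ = 2 * zeta g e (toCoord e ρ) := by
  have hy := toCoord_mem_target he hρ
  rw [ham_eq_hamD he g hρ (h := fun y => y.2.1 (Fin.last n))]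
  · obtain ⟨w, hw⟩ := hamVec_symbC he g hy
    have hL : HasFDerivAt (fun y : Coord n => y.2.1 (Fin.last n))
        ((EuclideanSpace.proj (𝕜 := ℝ) (Fin.last n) : Eucl n →L[ℝ] ℝ).comp (projX n))
        (toCoord e ρ) :=
      ((EuclideanSpace.proj (𝕜 := ℝ) (Fin.last n) : Eucl n →L[ℝ] ℝ).comp (projX n)).hasFDerivAt
    rw [hamD, hL.fderiv, hw]
    simp only [zeta]
    rw [real_inner_comm, inner_lastVec_left]
    simp [projX_apply]
  · filter_upwards [(isOpen_region e).mem_nhds hy] with y hy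
    exact congrArg (fun x : Eucl n => x (Fin.last n)) (e.right_inv hy)

/-- Half the second derivative of the last coordinate along the Hamiltonian vector field. -/
def kap (g : Metric1 n N) (e : OpenPartialHomeomorph N (Eucl n)) (y : Coord n) : ℝ :=
  hamD g e (zeta g e) y

lemma differentiableAt_zeta (he : e ∈ IsManifold.maximalAtlas 𝓘(ℝ, Eucl n) 2 N) {y : Coord n}
    (hy : y ∈ region e) : DifferentiableAt ℝ (zeta g e) y :=
  ((contDiffOn_zeta g he).contDiffAt ((isOpen_region e).mem_nhds hy)).differentiableAt (by simp)

lemma ham_ham_zfun (he : e ∈ IsManifold.maximalAtlas 𝓘(ℝ, Eucl n) 2 N) {ρ : Phase n N}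
    (hρ : ρ ∈ above e) :
    ham e (symb g) (ham e (symb g) (zfun e)) ρ = 2 * kap g e (toCoord e ρ) := by
  have hy := toCoord_mem_target he hρ
  rw [ham_eq_hamD he g hρ (h := fun y => 2 * zeta g e y)]
  · rw [kap, hamD, hamD, fderiv_const_mul (differentiableAt_zeta g he hy)]
    simp
  · filter_upwards [(isOpen_region e).mem_nhds hy] with y hy
    rw [ham_zfun g he (ofCoord_mem_above hy), toCoord_ofCoord he hy]

/-- At a glancing point the sign of `H_p² z` does not depend on the adapted chart. -/
lemma exists_kap_eq (he : IsAdaptedChart M e) (he' : IsAdaptedChart M e') {ρ : Phase n N}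
    (hρ : ρ ∈ above e) (hρ' : ρ ∈ above e') (ht : ρ ∈ tangentialBundle g M) :
    ∃ c : ℝ, 0 ≤ c ∧ kap g e' (toCoord e' ρ) = c * kap g e (toCoord e ρ) := by
  have hy := toCoord_mem_target he.1 hρ
  have hy' := toCoord_mem_target he'.1 hρ'
  set y₀ := toCoord e ρ with hy₀
  have hx₀ : y₀.2.1 ∈ e.target ∩ e.symm ⁻¹' e'.source :=
    ⟨hy, by
      show e.symm (e (base ρ)) ∈ e'.source
      rw [e.left_inv hρ]; exact hρ'⟩
  obtain ⟨hz, hζ⟩ := (mem_tangentialBundle_iff g he hρ).1 ht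
  obtain ⟨c, hc, hcv⟩ := exists_fderiv_lastTransition he he' hx₀ hz
  refine ⟨c, hc, ?_⟩
  set w := lastTransition e e'
  have hopen : IsOpen {y : Coord n | y.2.1 ∈ e.target ∩ e.symm ⁻¹' e'.source} :=
    isOpen_transition.preimage (by fun_prop)
  have hw2 : ∀ x ∈ e.target ∩ e.symm ⁻¹' e'.source, ContDiffAt ℝ 2 w x := fun x hx =>
    (contDiffOn_lastTransition he.1 he'.1).contDiffAt (isOpen_transition.mem_nhds hx)
  have hp : ∀ {ρ : Phase n N}, ρ ∈ above e' →
      DifferentiableAt ℝ (symb g ∘ ofCoord e') (toCoord e' ρ) := by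
    intro ρ hρ'
    have hr := toCoord_mem_target he'.1 hρ'
    refine (differentiableAt_symbC he'.1 g hr).congr_of_eventuallyEq ?_
    filter_upwards [(isOpen_region e').mem_nhds hr] with y hy using symb_ofCoord he'.1 g hy
  -- the first derivative, in the coordinates of the first chart
  have hfirst : ∀ y : Coord n, y.2.1 ∈ e.target ∩ e.symm ⁻¹' e'.source →
      ham e' (symb g) (zfun e') (ofCoord e y) =
        2 * fderiv ℝ w y.2.1 (cogram g e y.2.1 y.2.2.2) := by
    intro y hyt
    have h1 : (ofCoord e y : Phase n N) ∈ above e := ofCoord_mem_above hyt.1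
    have h2 : (ofCoord e y : Phase n N) ∈ above e' := hyt.2
    have hr := toCoord_mem_target he'.1 h2
    rw [← ham_eq_ham he.1 he'.1 h1 h2 (hp h2), ham_eq_hamD he.1 g h1 (h := fun y => w y.2.1)]
    · rw [toCoord_ofCoord he.1 hyt.1]
      obtain ⟨w', hw'⟩ := hamVec_symbC he.1 g hyt.1
      have hx : HasFDerivAt (fun y : Coord n => y.2.1) (projX n) y := hasFDerivAt_projX _
      have hd := ((hw2 _ hyt).differentiableAt (by simp)).hasFDerivAt.comp y hx
      rw [hamD, show (fun y : Coord n => w y.2.1) = w ∘ (fun y : Coord n => y.2.1) from rfl,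
        hd.fderiv, hw']
      simp [projX_apply]
    · filter_upwards with y using rfl
    · refine DifferentiableAt.congr_of_eventuallyEq (f := fun y : Coord n => y.2.1 (Fin.last n))
        (by fun_prop) ?_
      filter_upwards [(isOpen_region e').mem_nhds hr] with y hy
      exact congrArg (fun x : Eucl n => x (Fin.last n)) (e'.right_inv hy)
  have hsecond : 2 * kap g e' (toCoord e' ρ) =
      hamD g e (fun y => 2 * fderiv ℝ w y.2.1 (cogram g e y.2.1 y.2.2.2)) y₀ := by
    rw [← ham_ham_zfun g he'.1 hρ', ← ham_eq_ham he.1 he'.1 hρ hρ' (hp hρ'), ham_eq_hamD he.1 g hρ]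
    · filter_upwards [hopen.mem_nhds hx₀] with y hy using hfirst y hy
    · refine DifferentiableAt.congr_of_eventuallyEq (f := fun y => 2 * zeta g e' y)
        ((differentiableAt_zeta g he'.1 hy').const_mul 2) ?_
      filter_upwards [(isOpen_region e').mem_nhds hy'] with y hy
      simp only [Function.comp]
      rw [ham_zfun g he'.1 (ofCoord_mem_above hy), toCoord_ofCoord he'.1 hy]
  have hV : DifferentiableAt ℝ (fun y : Coord n => cogram g e y.2.1 y.2.2.2) y₀ :=
    ((contDiffOn_cogram_apply he.1 g).contDiffAt
      ((isOpen_region e).mem_nhds hy)).differentiableAt (by simp)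
  set V := fun y : Coord n => cogram g e y.2.1 y.2.2.2 with hVdef
  have hV0 : (V y₀) (Fin.last n) = 0 := by
    rw [← inner_lastVec_left, real_inner_comm]; exact hζ
  have hw' : HasFDerivAt (fderiv ℝ w) (fderiv ℝ (fderiv ℝ w) y₀.2.1) y₀.2.1 :=
    (((hw2 _ hx₀).fderiv_right (m := 1) (by norm_num)).differentiableAt (by simp)).hasFDerivAt
  -- At a tangential point V, the sharp of ξ, is tangent to {z = 0}. The line x + sV stays in the
  -- flat boundary, where dw is proportional to dz and so kills V; hence dw(V) is identically 0 in s
  -- near 0.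
  have hD2 : fderiv ℝ (fderiv ℝ w) y₀.2.1 (V y₀) (V y₀) = 0 := by
    have h1 : HasDerivAt (fun s : ℝ => fderiv ℝ w (y₀.2.1 + s • V y₀) (V y₀))
        (fderiv ℝ (fderiv ℝ w) y₀.2.1 (V y₀) (V y₀)) 0 := by
      have := (hw'.hasLineDerivAt (V y₀)).clm_apply (hasDerivAt_const (0 : ℝ) (V y₀))
      simpa using this
    have h2 : (fun s : ℝ => fderiv ℝ w (y₀.2.1 + s • V y₀) (V y₀)) =ᶠ[𝓝 0] fun _ => 0 := by
      have ht : ContinuousAt (fun s : ℝ => y₀.2.1 + s • V y₀) 0 := by fun_prop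
      filter_upwards [ht.eventually_mem (by
        rw [zero_smul, add_zero]; exact isOpen_transition.mem_nhds hx₀)] with s hs
      obtain ⟨c', -, hc'⟩ := exists_fderiv_lastTransition he he' hs
        (by rw [PiLp.add_apply, PiLp.smul_apply, hV0, hz, smul_zero, add_zero])
      rw [hc', hV0, mul_zero]
    exact h1.unique ((hasDerivAt_const (0 : ℝ) (0 : ℝ)).congr_of_eventuallyEq h2)
  have hx : HasFDerivAt (fun y : Coord n => y.2.1) (projX n) y₀ := hasFDerivAt_projX _
  have hfin := ((hw'.comp y₀ hx).clm_apply hV.hasFDerivAt).const_mul (2 : ℝ)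
  have hzd : HasFDerivAt (zeta g e) _ y₀ :=
    hV.hasFDerivAt.inner ℝ (hasFDerivAt_const (lastVec n) y₀)
  obtain ⟨w', hX⟩ := hamVec_symbC he.1 g hy
  have h3 : kap g e y₀ = (fderiv ℝ V y₀ (hamVec (symbC g e) y₀)) (Fin.last n) := by
    rw [kap, hamD, hzd.fderiv, ← inner_lastVec_left, real_inner_comm]
    simp [fderivInnerCLM_apply]
  -- H_p moves x along 2V, so the product rule yields a multiple of D²w(V, V), which is 0, plus 2
  -- dw(H_p V), in which dw = c dz.
  have h4 : hamD g e (fun y => 2 * fderiv ℝ w y.2.1 (cogram g e y.2.1 y.2.2.2)) y₀ =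
      2 * (c * kap g e y₀) := by
    rw [h3, hamD]
    rw [show (fun y : Coord n => 2 * fderiv ℝ w y.2.1 (cogram g e y.2.1 y.2.2.2)) =
      fun y => 2 * ((fderiv ℝ w ∘ fun y : Coord n => y.2.1) y) (V y) from rfl, hfin.fderiv]
    have h5 : (hamVec (symbC g e) y₀).2.1 = (2 : ℝ) • V y₀ := by rw [hX]
    simp only [_root_.smul_apply, _root_.add_apply,
      ContinuousLinearMap.comp_apply, ContinuousLinearMap.flip_apply,
      projX_apply, Function.comp, h5, map_smul,
      hD2, hcv, smul_eq_mul]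
    ring
  rw [h4] at hsecond
  linarith

end Glancing

end

/-! ### Concentrating test functions at the glancing set. -/

section

variable {n : ℕ} {N : Type*} [TopologicalSpace N] [ChartedSpace (Eucl n) N]
  [IsManifold 𝓘(ℝ, Eucl n) 2 N] {M : Set N} {e : OpenPartialHomeomorph N (Eucl n)}
  (g : Metric1 n N)

section Calculus

lemma hamD_mul {f h : Coord n → ℝ} {y : Coord n} (hf : DifferentiableAt ℝ f y)
    (hh : DifferentiableAt ℝ h y) :
    hamD g e (fun y => f y * h y) y = f y * hamD g e h y + hamD g e f y * h y := by
  unfold hamD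
  rw [fderiv_fun_mul hf hh]
  simp [mul_comm]

lemma hamD_comp {f : Coord n → ℝ} {y : Coord n} (hf : DifferentiableAt ℝ f y) {φ : ℝ → ℝ} {d : ℝ}
    (hφ : HasDerivAt φ d (f y)) : hamD g e (fun y => φ (f y)) y = d * hamD g e f y := by
  unfold hamD
  have := (hφ.comp_hasFDerivAt y hf.hasFDerivAt).fderiv
  rw [show (fun y => φ (f y)) = φ ∘ f from rfl, this]
  simp

lemma differentiableAt_last (y : Coord n) :
    DifferentiableAt ℝ (fun y : Coord n => y.2.1 (Fin.last n)) y := by fun_prop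

lemma hamD_last (he : e ∈ IsManifold.maximalAtlas 𝓘(ℝ, Eucl n) 2 N) {y : Coord n}
    (hy : y ∈ region e) : hamD g e (fun y => y.2.1 (Fin.last n)) y = 2 * zeta g e y := by
  have h := ham_zfun g he (ofCoord_mem_above (N := N) hy)
  rw [ham_eq_hamD he g (ofCoord_mem_above hy) (h := fun y => y.2.1 (Fin.last n)),
    toCoord_ofCoord he hy] at h
  · exact h
  · rw [toCoord_ofCoord he hy]
    filter_upwards [(isOpen_region e).mem_nhds hy] with y hy
    exact congrArg (fun x : Eucl n => x (Fin.last n)) (e.right_inv hy)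

end Calculus

section Lorentzian

/-- The Lorentzian profile. -/
def lor (s : ℝ) : ℝ := (1 + s ^ 2)⁻¹

lemma lor_zero : lor 0 = 1 := by simp [lor]

lemma lor_pos (s : ℝ) : 0 < lor s := by unfold lor; positivity

lemma lor_le_one (s : ℝ) : lor s ≤ 1 := inv_le_one_of_one_le₀ (by nlinarith [sq_nonneg s])

lemma lor_neg (s : ℝ) : lor (-s) = lor s := by simp [lor]

lemma sq_mul_lor_le_one (s : ℝ) : s ^ 2 * lor s ≤ 1 := by
  unfold lor
  rw [mul_inv_le_iff₀ (by positivity)]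
  linarith

lemma abs_mul_lor_le_one (s : ℝ) : |s * lor s| ≤ 1 := by
  rw [abs_mul, abs_of_pos (lor_pos s), lor, mul_inv_le_iff₀ (by positivity)]
  nlinarith [sq_abs s, sq_nonneg (|s| - 1)]

lemma hasDerivAt_lor (s : ℝ) : HasDerivAt lor (-2 * s * lor s ^ 2) s := by
  have h : HasDerivAt (fun s : ℝ => 1 + s ^ 2) (2 * s) s := by
    simpa using (hasDerivAt_pow 2 s).const_add 1
  have := h.inv (by positivity)
  unfold lor
  convert! this using 1
  field_simp

lemma contDiff_lor : ContDiff ℝ 1 lor := by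
  refine ContDiff.inv (by fun_prop) fun s => by positivity

lemma tendsto_lor {a : ℕ → ℝ} (ha : Tendsto (fun k => |a k|) atTop atTop) :
    Tendsto (fun k => lor (a k)) atTop (𝓝 0) := by
  unfold lor
  refine tendsto_inv_atTop_zero.comp (tendsto_atTop_add_const_left _ 1 ?_)
  refine ((tendsto_pow_atTop two_ne_zero).comp ha).congr fun k => by simp

lemma tendsto_mul_lor {a : ℕ → ℝ} (ha : Tendsto (fun k => |a k|) atTop atTop) :
    Tendsto (fun k => a k * lor (a k)) atTop (𝓝 0) := by
  have h := tendsto_inv_atTop_zero.comp ha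
  refine squeeze_zero_norm (fun k => ?_) h
  simp only [Real.norm_eq_abs, Function.comp]
  rcases eq_or_ne (a k) 0 with h0 | h0
  · simp [h0]
  · rw [abs_mul, abs_of_pos (lor_pos _), le_inv_comm₀ (by have := lor_pos (a k); positivity)
      (by positivity), mul_inv, lor, inv_inv, ← sq_abs (a k)]
    have : 0 < |a k| := by positivity
    rw [inv_mul_eq_div, le_div_iff₀ this]
    nlinarith

lemma tendsto_abs_mul {s : ℝ} (hs : s ≠ 0) {c : ℕ → ℝ} (hc : Tendsto c atTop atTop) :
    Tendsto (fun k => |c k * s|) atTop atTop := by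
  simp only [abs_mul]
  exact (tendsto_abs_atTop_atTop.comp hc).atTop_mul_const (abs_pos.2 hs)

/-- The limit is 0 for every `s`, including s = 0 where each term is 0; this is why the error terms
leave nothing behind on {ζ = 0} or {z = 0}. -/
lemma tendsto_mul_lor_mul (s : ℝ) {c : ℕ → ℝ} (hc : Tendsto c atTop atTop) :
    Tendsto (fun k => c k * s * lor (c k * s)) atTop (𝓝 0) := by
  rcases eq_or_ne s 0 with rfl | hs
  · simp
  · exact tendsto_mul_lor (tendsto_abs_mul hs hc)

lemma tendsto_succ : Tendsto (fun k : ℕ => (k : ℝ) + 1) atTop atTop :=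
  tendsto_atTop_add_const_right _ 1 tendsto_natCast_atTop_atTop

lemma tendsto_pow_succ {r : ℝ} (h0 : 0 ≤ r) (h1 : r < 1) :
    Tendsto (fun k : ℕ => r ^ (k + 1)) atTop (𝓝 0) :=
  (tendsto_pow_atTop_nhds_zero_of_lt_one h0 h1).comp (tendsto_add_atTop_nat 1)

end Lorentzian

/-- The concentrating factor of the test functions. -/
def conc (g : Metric1 n N) (e : OpenPartialHomeomorph N (Eucl n)) (ψ : Coord n → ℝ) (k : ℕ)
    (y : Coord n) : ℝ :=
  ψ y ^ (k + 1) * (lor ((k + 1) * zeta g e y) * lor ((k + 1) ^ 2 * y.2.1 (Fin.last n)))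

section Concentration

variable (he : e ∈ IsManifold.maximalAtlas 𝓘(ℝ, Eucl n) 2 N) {ψ : Coord n → ℝ}
  (hψ : ContDiff ℝ 1 ψ)

include he hψ

lemma contDiffOn_conc (k : ℕ) : ContDiffOn ℝ 1 (conc g e ψ k) (region e) := by
  refine (hψ.pow _).contDiffOn.mul (ContDiffOn.mul ?_ ?_)
  · exact contDiff_lor.comp_contDiffOn (contDiffOn_const.mul (contDiffOn_zeta g he))
  · exact contDiff_lor.comp_contDiffOn (by fun_prop)

/-- Writing σ = (k+1)ζ and θ = (k+1)²z, each large factor produced by differentiation is absorbed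
into σ or θ. Differentiating lor(θ) gives (k+1)²·H_p z·ζ = 2σ², which is the reason for the square
in the scale of z: σ² lor(σ) is bounded and θ lor(θ) tends to 0 pointwise. -/
lemma hamD_conc (k : ℕ) {y : Coord n} (hy : y ∈ region e) :
    hamD g e (fun y => conc g e ψ k y * zeta g e y) y =
      ψ y ^ k * hamD g e ψ y * (((k + 1) * zeta g e y) * lor ((k + 1) * zeta g e y)) *
          lor ((k + 1) ^ 2 * y.2.1 (Fin.last n))
        + ψ y ^ (k + 1) * (-2 * kap g e y *
            (((k + 1) * zeta g e y) * lor ((k + 1) * zeta g e y)) ^ 2 *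
            lor ((k + 1) ^ 2 * y.2.1 (Fin.last n))
          - 4 * (((k + 1) * zeta g e y) ^ 2 * lor ((k + 1) * zeta g e y)) *
            (((k + 1) ^ 2 * y.2.1 (Fin.last n)) * lor ((k + 1) ^ 2 * y.2.1 (Fin.last n))) *
            lor ((k + 1) ^ 2 * y.2.1 (Fin.last n)))
        + ψ y ^ (k + 1) * (kap g e y *
            (lor ((k + 1) * zeta g e y) * lor ((k + 1) ^ 2 * y.2.1 (Fin.last n)))) := by
  have hψd : DifferentiableAt ℝ ψ y := hψ.differentiable (by simp) y
  have hz := differentiableAt_zeta g he hy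
  have hl := differentiableAt_last y
  have hA : HasDerivAt (fun s => lor (((k : ℝ) + 1) * s))
      (-2 * ((k + 1) * zeta g e y) * lor ((k + 1) * zeta g e y) ^ 2 * (k + 1)) (zeta g e y) := by
    have := (hasDerivAt_lor (((k : ℝ) + 1) * zeta g e y)).comp (zeta g e y)
      ((hasDerivAt_id (zeta g e y)).const_mul ((k : ℝ) + 1))
    exact this.congr_deriv (by simp)
  have hB : HasDerivAt (fun s => lor (((k : ℝ) + 1) ^ 2 * s))
      (-2 * ((k + 1) ^ 2 * y.2.1 (Fin.last n)) * lor ((k + 1) ^ 2 * y.2.1 (Fin.last n)) ^ 2 *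
        (k + 1) ^ 2) (y.2.1 (Fin.last n)) := by
    have := (hasDerivAt_lor (((k : ℝ) + 1) ^ 2 * y.2.1 (Fin.last n))).comp (y.2.1 (Fin.last n))
      ((hasDerivAt_id (y.2.1 (Fin.last n))).const_mul (((k : ℝ) + 1) ^ 2))
    exact this.congr_deriv (by simp)
  have hAd : DifferentiableAt ℝ (fun y => lor (((k : ℝ) + 1) * zeta g e y)) y :=
    (hA.comp_hasFDerivAt y hz.hasFDerivAt).differentiableAt
  have hBd : DifferentiableAt ℝ (fun y : Coord n => lor (((k : ℝ) + 1) ^ 2 * y.2.1 (Fin.last n))) y :=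
    
    DifferentiableAt.comp (g := fun s => lor (((k : ℝ) + 1) ^ 2 * s))
      (f := fun y : Coord n => y.2.1 (Fin.last n)) y hB.differentiableAt hl
  have hP : HasDerivAt (fun s : ℝ => s ^ (k + 1)) ((k + 1) * ψ y ^ k) (ψ y) := by
    simpa using hasDerivAt_pow (k + 1) (ψ y)
  have hPd : DifferentiableAt ℝ (fun y => ψ y ^ (k + 1)) y := hψd.pow _
  have hABd : DifferentiableAt ℝ (fun y => lor (((k : ℝ) + 1) * zeta g e y) *
      lor (((k : ℝ) + 1) ^ 2 * y.2.1 (Fin.last n))) y := hAd.mul hBd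
  have hCd : DifferentiableAt ℝ (fun y => ψ y ^ (k + 1) * (lor (((k : ℝ) + 1) * zeta g e y) *
      lor (((k : ℝ) + 1) ^ 2 * y.2.1 (Fin.last n)))) y := hPd.mul hABd
  unfold conc
  rw [hamD_mul g hCd hz, hamD_mul g hPd hABd, hamD_mul g hAd hBd,
    hamD_comp g hz hA, hamD_comp g hl hB, hamD_comp g hψd hP, hamD_last g he hy, ← kap]
  ring

/-- The pointwise limit of the derivatives of the concentrating test functions. -/
lemma tendsto_hamD_conc {y : Coord n} (hy : y ∈ region e) (h0 : 0 ≤ ψ y) (h1 : ψ y ≤ 1)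
    (hψ1 : ψ y = 1 → zeta g e y = 0 ∧ y.2.1 (Fin.last n) = 0) :
    Tendsto (fun k : ℕ => hamD g e (fun y => conc g e ψ k y * zeta g e y) y) atTop
      (𝓝 (if ψ y = 1 then kap g e y else 0)) := by
  have hA := tendsto_mul_lor_mul (zeta g e y) tendsto_succ
  have hB := tendsto_mul_lor_mul (y.2.1 (Fin.last n))
    ((tendsto_pow_atTop two_ne_zero).comp tendsto_succ)
  simp only [Function.comp] at hB
  simp only [hamD_conc g he hψ _ hy]
  have hp : ∀ k : ℕ, |ψ y ^ k| ≤ 1 := fun k => by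
    rw [abs_of_nonneg (by positivity)]; exact pow_le_one₀ h0 h1
  have hlor : ∀ s, |lor s| ≤ 1 := fun s => by rw [abs_of_pos (lor_pos s)]; exact lor_le_one s
  have hs2 : ∀ s, |s ^ 2 * lor s| ≤ 1 := fun s => by
    rw [abs_of_nonneg (by have := lor_pos s; positivity)]; exact sq_mul_lor_le_one s
  rw [show (if ψ y = 1 then kap g e y else 0) = 0 + 0 + (if ψ y = 1 then kap g e y else 0) by ring]
  refine Tendsto.add (Tendsto.add ?_ ?_) ?_
  · have h := (hA.abs.const_mul |hamD g e ψ y|)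
    simp only [abs_zero, mul_zero] at h
    refine squeeze_zero_norm (fun k => ?_) h
    rw [Real.norm_eq_abs, abs_mul, abs_mul, abs_mul]
    calc _ ≤ 1 * |hamD g e ψ y| * |(k + 1) * zeta g e y * lor ((k + 1) * zeta g e y)| * 1 := by
          gcongr
          · exact hp k
          · exact hlor _
      _ = _ := by ring
  · have h := ((hA.abs.pow 2).const_mul (2 * |kap g e y|)).add (hB.abs.const_mul 4)
    simp only [abs_zero, mul_zero, ne_eq, OfNat.ofNat_ne_zero, not_false_eq_true, zero_pow,
      add_zero] at h
    refine squeeze_zero_norm (fun k => ?_) h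
    rw [Real.norm_eq_abs, abs_mul]
    refine (mul_le_of_le_one_left (abs_nonneg _) (hp _)).trans ?_
    refine (abs_sub _ _).trans ?_
    rw [abs_mul, abs_mul, abs_mul, abs_mul, abs_mul, abs_mul, abs_pow, abs_neg, abs_two,
      abs_of_pos (by norm_num : (0 : ℝ) < 4)]
    refine add_le_add ?_ ?_
    · exact mul_le_of_le_one_right (by positivity) (hlor _)
    · refine (mul_le_of_le_one_right (by positivity) (hlor _)).trans ?_
      gcongr
      exact mul_le_of_le_one_right (by norm_num) (hs2 _)
  · split_ifs with h
    · obtain ⟨hz, hl⟩ := hψ1 h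
      simp [h, hz, hl, lor_zero]
    · have h2 := (tendsto_pow_succ h0 (lt_of_le_of_ne h1 h)).mul_const |kap g e y|
      rw [zero_mul] at h2
      refine squeeze_zero_norm (fun k => ?_) h2
      rw [Real.norm_eq_abs, abs_mul, abs_mul, abs_mul, abs_of_nonneg (by positivity : 0 ≤ ψ y ^ (k + 1))]
      gcongr
      exact mul_le_of_le_one_right (abs_nonneg _)
        (mul_le_one₀ (hlor _) (abs_nonneg _) (hlor _))

/-- The bound is independent of `k`: this is the domination for the passage to the limit. -/
lemma abs_hamD_conc_le (k : ℕ) {y : Coord n} (hy : y ∈ region e) (h0 : 0 ≤ ψ y) (h1 : ψ y ≤ 1) :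
    |hamD g e (fun y => conc g e ψ k y * zeta g e y) y| ≤
      |hamD g e ψ y| + (2 * |kap g e y| + 4) + |kap g e y| := by
  have hp : ∀ k : ℕ, |ψ y ^ k| ≤ 1 := fun k => by
    rw [abs_of_nonneg (by positivity)]; exact pow_le_one₀ h0 h1
  have hlor : ∀ s, |lor s| ≤ 1 := fun s => by rw [abs_of_pos (lor_pos s)]; exact lor_le_one s
  have hs2 : ∀ s, |s ^ 2 * lor s| ≤ 1 := fun s => by
    rw [abs_of_nonneg (by have := lor_pos s; positivity)]; exact sq_mul_lor_le_one s
  have hs1 := abs_mul_lor_le_one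
  rw [hamD_conc g he hψ _ hy]
  refine (abs_add_le _ _).trans (add_le_add ((abs_add_le _ _).trans (add_le_add ?_ ?_)) ?_)
  · rw [abs_mul, abs_mul, abs_mul]
    calc _ ≤ 1 * |hamD g e ψ y| * 1 * 1 := by
          gcongr
          · exact hp k
          · exact hs1 _
          · exact hlor _
      _ = _ := by ring
  · rw [abs_mul]
    refine (mul_le_of_le_one_left (abs_nonneg _) (hp _)).trans ?_
    refine (abs_sub _ _).trans ?_
    rw [abs_mul, abs_mul, abs_mul, abs_mul, abs_mul, abs_mul, abs_pow, abs_neg, abs_two,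
      abs_of_pos (by norm_num : (0 : ℝ) < 4)]
    refine add_le_add ?_ ?_
    · refine (mul_le_of_le_one_right (by positivity) (hlor _)).trans ?_
      exact mul_le_of_le_one_right (by positivity) (pow_le_one₀ (abs_nonneg _) (hs1 _))
    · refine (mul_le_of_le_one_right (by positivity) (hlor _)).trans ?_
      refine (mul_le_of_le_one_right (by positivity) (hs1 _)).trans ?_
      exact mul_le_of_le_one_right (by norm_num) (hs2 _)
  · rw [abs_mul, abs_mul, abs_mul]
    refine (mul_le_of_le_one_left (by positivity) (hp _)).trans ?_
    exact mul_le_of_le_one_right (abs_nonneg _)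
        (mul_le_one₀ (hlor _) (abs_nonneg _) (hlor _))

omit he hψ in
lemma abs_conc_le (k : ℕ) {y : Coord n} (h0 : 0 ≤ ψ y) (h1 : ψ y ≤ 1) :
    |conc g e ψ k y| ≤ 1 := by
  have hlor : ∀ s, |lor s| ≤ 1 := fun s => by rw [abs_of_pos (lor_pos s)]; exact lor_le_one s
  rw [conc, abs_mul, abs_mul]
  refine mul_le_one₀ ?_ (by positivity) (mul_le_one₀ (hlor _) (abs_nonneg _) (hlor _))
  rw [abs_of_nonneg (by positivity)]; exact pow_le_one₀ h0 h1

omit he hψ in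
-- |ζ lor((k+1)ζ)| is at most 1/(k+1), so the zeroth-order term with f disappears.
lemma tendsto_conc_mul_zeta {y : Coord n} (h0 : 0 ≤ ψ y) (h1 : ψ y ≤ 1) :
    Tendsto (fun k : ℕ => conc g e ψ k y * zeta g e y) atTop (𝓝 0) := by
  have h := (tendsto_inv_atTop_zero.comp tendsto_succ)
  refine squeeze_zero_norm (fun k => ?_) h
  have hk : (0 : ℝ) < k + 1 := by positivity
  have hx : conc g e ψ k y * zeta g e y * (k + 1) = ψ y ^ (k + 1) *
      ((k + 1) * zeta g e y * lor ((k + 1) * zeta g e y)) *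
      lor ((k + 1) ^ 2 * y.2.1 (Fin.last n)) := by
    rw [conc]; ring
  rw [Real.norm_eq_abs, Function.comp, inv_eq_one_div, le_div_iff₀ hk]
  have hab : |conc g e ψ k y * zeta g e y| * (k + 1) = |conc g e ψ k y * zeta g e y * (k + 1)| := by
    rw [abs_mul _ ((k : ℝ) + 1), abs_of_pos hk]
  rw [hab, hx, abs_mul, abs_mul]
  refine mul_le_one₀ (mul_le_one₀ ?_ (abs_nonneg _) (abs_mul_lor_le_one _)) (abs_nonneg _) ?_
  · rw [abs_of_nonneg (by positivity)]; exact pow_le_one₀ h0 h1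
  · rw [abs_of_pos (lor_pos _)]; exact lor_le_one _

/-- At a hyperbolic point the lifts have ζ = ±λ|dz| ≠ 0, so the factor lor((k+1)ζ) kills both
values; at a glancing point the lifts coincide with the point and only the power of ψ remains. -/
lemma tendsto_pairC_conc {y : Coord n} (hψ01 : ∀ y, 0 ≤ ψ y ∧ ψ y ≤ 1) (hy : y ∈ region e)
    (hz : zeta g e y = 0) (hl : y.2.1 (Fin.last n) = 0) (hp : symbC g e y ≤ 0)
    (hψ1 : ψ y = 1 → symbC g e y = 0) :
    Tendsto (fun k : ℕ => pairC g e (conc g e ψ k) y) atTop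
      (𝓝 (if ψ y = 1 then Real.sqrt (normSqDz g e y.2.1) else 0)) := by
  have hG := Real.sqrt_pos.2 (normSqDz_pos g he hy)
  set G := Real.sqrt (normSqDz g e y.2.1)
  have hval : ∀ (s : ℝ) (k : ℕ), conc g e ψ k (shiftC g e s y) =
      ψ (shiftC g e s y) ^ (k + 1) * lor ((k + 1) * (s * G)) := by
    intro s k
    have : (shiftC g e s y).2.1 = y.2.1 := by simp [shiftC]
    rw [conc, zeta_shiftC g he hy, hz, this, hl, zero_add, mul_zero, lor_zero, mul_one]
  rcases eq_or_lt_of_le hp with h | h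
  · have hv : ∀ k, conc g e ψ k y = ψ y ^ (k + 1) := fun k => by
      simpa [shiftC_zero, lor_zero] using hval 0 k
    simp only [pairC, h, neg_zero, Real.sqrt_zero, shiftC_zero, hv]
    have h3 : ∀ k : ℕ, G * (ψ y ^ (k + 1) + ψ y ^ (k + 1)) / 2 = G * ψ y ^ (k + 1) := by
      intro k; ring
    change Tendsto (fun k : ℕ => G * (ψ y ^ (k + 1) + ψ y ^ (k + 1)) / 2) _ _
    simp only [h3]
    split_ifs with h1
    · simp [h1]
    · have := (tendsto_pow_succ (hψ01 y).1 (lt_of_le_of_ne (hψ01 y).2 h1)).const_mul G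
      simpa using this
  · rw [if_neg fun h1 => h.ne (hψ1 h1)]
    have hl' : 0 < Real.sqrt (-symbC g e y) := Real.sqrt_pos.2 (by linarith)
    have h4 := tendsto_lor (tendsto_abs_mul (mul_pos hl' hG).ne' tendsto_succ)
    have h5 := h4.const_mul G
    rw [mul_zero] at h5
    refine squeeze_zero_norm (fun k => ?_) h5
    simp only [pairC, hval, neg_mul, mul_neg, lor_neg]
    change |G * _ / 2| ≤ _
    have hp1 : ∀ y, ψ y ^ (k + 1) ≤ 1 := fun y => pow_le_one₀ (hψ01 y).1 (hψ01 y).2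
    have hp0 : ∀ y, 0 ≤ ψ y ^ (k + 1) := fun y => pow_nonneg (hψ01 y).1 _
    have hL := (lor_pos ((k + 1) * (Real.sqrt (-symbC g e y) * G))).le
    have h6 := hp0 (shiftC g e (Real.sqrt (-symbC g e y)) y)
    have h7 := hp0 (shiftC g e (-Real.sqrt (-symbC g e y)) y)
    rw [abs_of_nonneg (by positivity), mul_div_assoc]
    refine mul_le_mul_of_nonneg_left ?_ hG.le
    have h8 := mul_le_of_le_one_left hL (hp1 (shiftC g e (Real.sqrt (-symbC g e y)) y))
    have h9 := mul_le_of_le_one_left hL (hp1 (shiftC g e (-Real.sqrt (-symbC g e y)) y))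
    linarith

omit he hψ in
lemma abs_pairC_conc_le (hψ01 : ∀ y, 0 ≤ ψ y ∧ ψ y ≤ 1) (k : ℕ) (y : Coord n) :
    |pairC g e (conc g e ψ k) y| ≤ Real.sqrt (normSqDz g e y.2.1) := by
  have h1 : ∀ y, |conc g e ψ k y| ≤ 1 := fun y => abs_conc_le g k (hψ01 y).1 (hψ01 y).2
  have hs := Real.sqrt_nonneg (normSqDz g e y.2.1)
  rw [pairC, mul_div_assoc, abs_mul, abs_of_nonneg hs]
  refine mul_le_of_le_one_right hs ?_
  rw [abs_div, abs_two, div_le_one (by norm_num)]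
  refine (abs_add_le _ _).trans ?_
  linarith [h1 (shiftC g e (Real.sqrt (-symbC g e y)) y),
    h1 (shiftC g e (-Real.sqrt (-symbC g e y)) y)]

end Concentration

end

/-! ### Vanishing of ν and μ on glancing sets. -/

section

/-- Dominated convergence for uniformly bounded functions vanishing off a set of finite measure. -/
lemma tendsto_setIntegral_of_bounded {α : Type*} [MeasurableSpace α] {μ : Measure α}
    {S K : Set α} (hS : MeasurableSet S) (hK : MeasurableSet K) (hμ : μ K < ⊤)
    {F : ℕ → α → ℝ} {f : α → ℝ} {C : ℝ}
    (hF : ∀ k, AEStronglyMeasurable (F k) (μ.restrict S))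
    (hb : ∀ k, ∀ x ∈ S, x ∈ K → |F k x| ≤ C) (hz : ∀ k, ∀ x ∈ S, x ∉ K → F k x = 0)
    (hlim : ∀ x ∈ S, Tendsto (fun k => F k x) atTop (𝓝 (f x))) :
    IntegrableOn f S μ ∧
      Tendsto (fun k => ∫ x in S, F k x ∂μ) atTop (𝓝 (∫ x in S, f x ∂μ)) := by
  have hbi : Integrable (K.indicator fun _ => C) (μ.restrict S) := by
    rw [integrable_indicator_iff hK]
    refine integrableOn_const ?_
    exact ((Measure.restrict_apply_le _ _).trans_lt hμ).ne
  have hbd : ∀ k, ∀ x ∈ S, ‖F k x‖ ≤ K.indicator (fun _ => C) x := by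
    intro k x hx
    by_cases h : x ∈ K
    · rw [indicator_of_mem h]; exact hb k x hx h
    · rw [indicator_of_notMem h, hz k x hx h, norm_zero]
  have hl : ∀ᵐ x ∂μ.restrict S, Tendsto (fun k => F k x) atTop (𝓝 (f x)) :=
    (ae_restrict_iff' hS).2 (Eventually.of_forall hlim)
  have hbd' : ∀ k, ∀ᵐ x ∂μ.restrict S, ‖F k x‖ ≤ K.indicator (fun _ => C) x := fun k =>
    (ae_restrict_iff' hS).2 (Eventually.of_forall (hbd k))
  refine ⟨hbi.mono' (aestronglyMeasurable_of_tendsto_ae atTop hF hl) ?_,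
    tendsto_integral_of_dominated_convergence _ hF hbi hbd' hl⟩
  rw [ae_restrict_iff' hS]
  refine Eventually.of_forall fun x hx => ?_
  exact le_of_tendsto (hlim x hx).norm (Eventually.of_forall fun k => hbd k x hx)

variable {n : ℕ} {N : Type*} [TopologicalSpace N] [ChartedSpace (Eucl n) N]
  [IsManifold 𝓘(ℝ, Eucl n) 2 N] {M : Set N} {e : OpenPartialHomeomorph N (Eucl n)}
  (g : Metric1 n N)

variable [T2Space N] [SecondCountableTopology N]

/-- Near a glancing point, `ν` vanishes on the glancing points with `H_p² z ≥ 0` and `μ` vanishes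
on those with `H_p² z > 0`. -/
lemma exists_nhds_null (he : IsAdaptedChart M e) {U : Set (Phase n N)} (hU : IsOpen U)
    {f : Phase n N → ℝ} (hf : Continuous f)
    {μ ν : Measure (Phase n N)} (hμ : IsMeasureOn U μ) [IsFiniteMeasureOnCompacts ν]
    (heq : MeasureEquation g M U f μ ν) {ρ₀ : Phase n N} (hρ₀ : ρ₀ ∈ above e) (hρ₀U : ρ₀ ∈ U) :
    ∃ O ∈ 𝓝 ρ₀, O ⊆ above e ∧
      ν (O ∩ {ρ | ρ ∈ glancing g M ∧ 0 ≤ kap g e (toCoord e ρ)}) = 0 ∧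
      μ (O ∩ {ρ | ρ ∈ glancing g M ∧ 0 < kap g e (toCoord e ρ)}) = 0 := by
  have hy₀ := toCoord_mem_target he.1 hρ₀
  set y₀ := toCoord e ρ₀ with hy₀def
  have hO : region e ∩ ofCoord e ⁻¹' U ∈ 𝓝 y₀ := by
    refine ((continuousOn_ofCoord he.1).isOpen_inter_preimage (isOpen_region e) hU).mem_nhds
      ⟨hy₀, ?_⟩
    rwa [mem_preimage, ofCoord_toCoord he.1 hρ₀]
  -- The ball of radius r carries the test functions; they concentrate in the half-size ball, which
  -- leaves room for the cutoff.
  obtain ⟨r, hr, hrO⟩ := Metric.nhds_basis_closedBall.mem_iff.1 hO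
  set B := Metric.closedBall y₀ r with hB
  have hBc : IsCompact B := isCompact_closedBall _ _
  have hBe : B ⊆ region e := fun y hy => (hrO hy).1
  have hκc : ContinuousOn (kap g e) (region e) := continuousOn_hamD he.1 g (contDiffOn_zeta g he.1)
  -- the compact set on which the test functions concentrate
  set K₀ := Metric.closedBall y₀ (r / 2) ∩ {y | (y.2.1 (Fin.last n) = 0 ∧ zeta g e y = 0) ∧
    (symbC g e y = 0 ∧ 0 ≤ kap g e y)} with hK₀
  have hK₀c : IsClosed K₀ := by
    have hsub : Metric.closedBall y₀ (r / 2) ⊆ region e :=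
      (Metric.closedBall_subset_closedBall (by linarith)).trans hBe
    have key : ∀ {F : Coord n → ℝ} {s : Set ℝ}, ContinuousOn F (region e) → IsClosed s →
        IsClosed (Metric.closedBall y₀ (r / 2) ∩ F ⁻¹' s) := fun hF hs =>
      (hF.mono hsub).preimage_isClosed_of_isClosed Metric.isClosed_closedBall hs
    have h1 := key (F := fun y : Coord n => y.2.1 (Fin.last n)) (by fun_prop)
      (isClosed_singleton (x := (0 : ℝ)))
    have h2 := key (contDiffOn_zeta g he.1).continuousOn (isClosed_singleton (x := (0 : ℝ)))
    have h3 := key (contDiffOn_symbC he.1 g).continuousOn (isClosed_singleton (x := (0 : ℝ)))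
    have h4 := key hκc (isClosed_Ici (a := (0 : ℝ)))
    have : K₀ = ((Metric.closedBall y₀ (r / 2) ∩ (fun y : Coord n => y.2.1 (Fin.last n)) ⁻¹' {0}) ∩
        (Metric.closedBall y₀ (r / 2) ∩ (zeta g e) ⁻¹' {0})) ∩
        ((Metric.closedBall y₀ (r / 2) ∩ (symbC g e) ⁻¹' {0}) ∩
        (Metric.closedBall y₀ (r / 2) ∩ (kap g e) ⁻¹' (Ici 0))) := by
      ext y
      simp only [hK₀, mem_inter_iff, mem_ofPred_eq, mem_preimage, mem_singleton_iff, mem_Ici]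
      tauto
    rw [this]
    exact (h1.inter h2).inter (h3.inter h4)
  -- ψ equals 1 exactly on `K₀`, so its powers tend to the indicator of `K₀`. The condition in `K₀`
  -- is H_p ζ ≥ 0 and not > 0, to keep it closed and to include order-three points.
  obtain ⟨ψ, hψm, hψr, hψ0, hψ1⟩ := exists_contMDiff_zero_iff_one_iff_of_isClosed
    (n := 1) 𝓘(ℝ, Coord n) (s := (Metric.ball y₀ r)ᶜ) (t := K₀)
    Metric.isOpen_ball.isClosed_compl hK₀c (by
      rw [Set.disjoint_left]
      intro y hy hy'
      refine hy (Metric.closedBall_subset_ball (by linarith) hy'.1))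
  have hψd : ContDiff ℝ 1 ψ := hψm.contDiff
  have hψ01 : ∀ y, 0 ≤ ψ y ∧ ψ y ≤ 1 := fun y => hψr (mem_range_self y)
  have hψz : ∀ y, y ∉ B → ψ y = 0 := fun y hy =>
    (hψ0 y).1 fun h => hy (Metric.ball_subset_closedBall h)
  have hψone : ∀ y, ψ y = 1 → (y.2.1 (Fin.last n) = 0 ∧ zeta g e y = 0) ∧
    (symbC g e y = 0 ∧ 0 ≤ kap g e y) := fun y hy => ((hψ1 y).2 hy).2
  have hconcz : ∀ k, ∀ y, y ∉ B → conc g e ψ k y = 0 := fun k y hy => by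
    rw [conc, hψz y hy]; simp
  have hconcd := fun k => contDiffOn_conc g he.1 hψd k
  have H : ∀ k, IsCoordTest U e B fun y => conc g e ψ k y * zeta g e y := fun k =>
    { contDiffOn := (hconcd k).mul (contDiffOn_zeta g he.1)
      isCompact := hBc
      subset_region := hBe
      eq_zero := fun y _ hy => by rw [hconcz k y hy, zero_mul]
      subset_preimage := fun y hy => (hrO hy).2 }
  have hE := fun k => measureEquation_zeta g he heq (hconcd k).continuousOn (H k)
  -- compact sets of phase space
  have hBPc := isCompact_image_ofCoord he.1 (N := N) hBc hBe
  have hBPμ : μ (ofCoord e '' B) < ⊤ := hμ.measure_lt_top _ hBPc (by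
    rintro _ ⟨y, hy, rfl⟩; exact (hrO hy).2)
  have hnotB : ∀ ρ ∈ above e, ρ ∉ (ofCoord e '' B : Set (Phase n N)) → toCoord e ρ ∉ B :=
    fun ρ hρ h h' => h ((mem_image_ofCoord he.1 hBe).2 ⟨hρ, h'⟩)
  obtain ⟨B', hB'c, hB'e, hB'⟩ := exists_isCompact_of_shift g he.1 hBc hBe
  have hBPc' := isCompact_image_ofCoord he.1 (N := N) hB'c hB'e
  have hBPν : ν (ofCoord e '' B') < ⊤ := hBPc'.measure_lt_top
  have hSm : MeasurableSet (above e : Set (Phase n N)) := (isOpen_above e).measurableSet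
  have hHm := measurableSet_boundary g he
  have hψC : ContinuousOn (hamD g e ψ) (region e) := continuousOn_hamD he.1 g hψd.contDiffOn
  -- the three limits
  obtain ⟨C₁, hC₁⟩ := hBc.exists_bound_of_continuousOn
    (f := fun y => |hamD g e ψ y| + (2 * |kap g e y| + 4) + |kap g e y|)
    (((hψC.mono hBe).abs.add (((hκc.mono hBe).abs.const_mul 2).add continuousOn_const)).add
      (hκc.mono hBe).abs)
  obtain ⟨hI₁, hT₁⟩ := tendsto_setIntegral_of_bounded (μ := μ) (C := C₁) hSm hBPc.measurableSet hBPμ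
    (F := fun k ρ => hamD g e (fun y => conc g e ψ k y * zeta g e y) (toCoord e ρ))
    (f := fun ρ => if ψ (toCoord e ρ) = 1 then kap g e (toCoord e ρ) else 0)
    (fun k => aestronglyMeasurable_comp_toCoord he.1 (continuousOn_hamD he.1 g (H k).contDiffOn) μ)
    (fun k ρ hρ hρB => by
      have h1 := ((mem_image_ofCoord he.1 hBe).1 hρB).2
      have h2 := hψ01 (toCoord e ρ)
      refine (abs_hamD_conc_le g he.1 hψd k (hBe h1) h2.1 h2.2).trans ?_
      exact (le_abs_self _).trans (hC₁ _ h1))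
    (fun k ρ hρ hρB => by
      refine hamD_eq_zero g ?_
      filter_upwards [hBc.isClosed.isOpen_compl.mem_nhds (hnotB ρ hρ hρB)] with y hy
      rw [hconcz k y hy, zero_mul]; rfl)
    (fun ρ hρ => by
      have h2 := hψ01 (toCoord e ρ)
      exact tendsto_hamD_conc g he.1 hψd (toCoord_mem_target he.1 hρ) h2.1 h2.2
        fun h => (hψone _ h).1.symm)
  obtain ⟨C₂, hC₂⟩ := hBPc.exists_bound_of_continuousOn
    (f := fun ρ => f ρ * zeta g e (toCoord e ρ)) (by
      refine hf.continuousOn.mul ((contDiffOn_zeta g he.1).continuousOn.comp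
        ((continuousOn_toCoord he.1).mono ?_) ?_)
      · exact fun ρ' h => ((mem_image_ofCoord he.1 hBe).1 h).1
      · exact fun ρ' h => hBe ((mem_image_ofCoord he.1 hBe).1 h).2)
  obtain ⟨-, hT₂⟩ := tendsto_setIntegral_of_bounded (μ := μ) (C := C₂) hSm hBPc.measurableSet hBPμ
    (F := fun k ρ => f ρ * (conc g e ψ k (toCoord e ρ) * zeta g e (toCoord e ρ)))
    (f := fun ρ => 0)
    (fun k => hf.aestronglyMeasurable.mul
      (aestronglyMeasurable_comp_toCoord he.1 (H k).contDiffOn.continuousOn μ))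
    (fun k ρ hρ hρB => by
      have h2 := hψ01 (toCoord e ρ)
      have h3 := abs_conc_le g (e := e) k h2.1 h2.2
      rw [mul_left_comm, abs_mul]
      exact (mul_le_of_le_one_left (abs_nonneg _) h3).trans (hC₂ _ hρB))
    (fun k ρ hρ hρB => by rw [hconcz k _ (hnotB ρ hρ hρB)]; ring)
    (fun ρ hρ => by
      have h2 := hψ01 (toCoord e ρ)
      simpa using (tendsto_conc_mul_zeta g (e := e) h2.1 h2.2).const_mul (f ρ))
  obtain ⟨C₃, hC₃⟩ := hB'c.exists_bound_of_continuousOn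
    (f := fun y : Coord n => Real.sqrt (normSqDz g e y.2.1))
    ((continuousOn_normSqDz g he.1).mono hB'e).sqrt
  obtain ⟨hI₃, hT₃⟩ := tendsto_setIntegral_of_bounded (μ := ν) (C := C₃) hHm hBPc'.measurableSet hBPν
    (F := fun k ρ => pairC g e (conc g e ψ k) (toCoord e ρ))
    (f := fun ρ => if ψ (toCoord e ρ) = 1 then Real.sqrt (normSqDz g e (toCoord e ρ).2.1) else 0)
    (fun k => (aestronglyMeasurable_comp_toCoord he.1
      (continuousOn_pairC g he.1 (hconcd k).continuousOn) ν).mono_measure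
        (Measure.restrict_mono_set ν inter_subset_right))
    (fun k ρ hρ hρB => by
      have h1 := ((mem_image_ofCoord he.1 hB'e).1 hρB).2
      exact (abs_pairC_conc_le g hψ01 k _).trans ((le_abs_self _).trans (hC₃ _ h1)))
    (fun k ρ hρ hρB => by
      refine pairC_eq_zero g (toCoord_mem_target he.1 hρ.2) hB' (hconcz k) fun h' => hρB ?_
      exact (mem_image_ofCoord he.1 hB'e).2 ⟨hρ.2, h'⟩)
    (fun ρ hρ => by
      obtain ⟨ht, hp⟩ := (mem_hyperbolic_union_glancing_iff g).1 hρ.1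
      obtain ⟨hl, hz⟩ := (mem_tangentialBundle_iff g he hρ.2).1 ht
      rw [symb_eq he.1 g hρ.2] at hp
      exact tendsto_pairC_conc g he.1 hψd hψ01 (toCoord_mem_target he.1 hρ.2) hz hl hp
        fun h => (hψone _ h).2.1)
  -- The limit identity: the integral of H_p ζ over `K₀` against μ is minus the integral of |dz|
  -- over `K₀` against ν. The integrands are nonnegative, so both integrals are 0.
  have hlim := tendsto_nhds_unique (hT₁.congr hE) (hT₂.sub hT₃)
  rw [integral_zero, zero_sub] at hlim
  have hpos₁ : 0 ≤ fun ρ : Phase n N => if ψ (toCoord e ρ) = 1 then kap g e (toCoord e ρ) else 0 := by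
    intro ρ
    simp only [Pi.zero_apply]
    split_ifs with h
    exacts [(hψone _ h).2.2, le_rfl]
  have hpos₃ : 0 ≤ fun ρ : Phase n N =>
      if ψ (toCoord e ρ) = 1 then Real.sqrt (normSqDz g e (toCoord e ρ).2.1) else 0 := by
    intro ρ
    simp only [Pi.zero_apply]
    split_ifs with h
    exacts [Real.sqrt_nonneg _, le_rfl]
  have hi₁ := integral_nonneg (μ := μ.restrict (above e)) hpos₁
  have hi₃ := integral_nonneg (μ := ν.restrict ((hyperbolic g M ∪ glancing g M) ∩ above e)) hpos₃
  have hz₁ := (integral_eq_zero_iff_of_nonneg hpos₁ hI₁).1 (by linarith)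
  have hz₃ := (integral_eq_zero_iff_of_nonneg hpos₃ hI₃).1 (by linarith)
  rw [Filter.EventuallyEq, ae_restrict_iff' hSm] at hz₁
  rw [Filter.EventuallyEq, ae_restrict_iff' hHm] at hz₃
  have hmem : ∀ ρ ∈ above e, toCoord e ρ ∈ Metric.closedBall y₀ (r / 2) → ρ ∈ glancing g M →
      0 ≤ kap g e (toCoord e ρ) → ψ (toCoord e ρ) = 1 := by
    intro ρ hρ hb hg hk
    refine (hψ1 _).1 ⟨hb, (mem_tangentialBundle_iff g he hρ).1 hg.1, ?_, hk⟩
    rw [← symb_eq he.1 g hρ]; exact hg.2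
  refine ⟨above e ∩ toCoord e ⁻¹' (Metric.ball y₀ (r / 2)), ?_, inter_subset_left, ?_, ?_⟩
  · exact ((continuousOn_toCoord he.1).isOpen_inter_preimage (isOpen_above e)
      Metric.isOpen_ball).mem_nhds ⟨hρ₀, Metric.mem_ball_self (by linarith)⟩
  · refine measure_mono_null ?_ (ae_iff.1 hz₃)
    rintro ρ ⟨⟨hρ, hb⟩, hg, hk⟩
    have h1 := hmem ρ hρ (Metric.ball_subset_closedBall hb) hg hk
    simp only [mem_ofPred_eq, Classical.not_imp, h1, if_true, Pi.zero_apply]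
    exact ⟨⟨Or.inr hg, hρ⟩, (Real.sqrt_pos.2
      (normSqDz_pos g he.1 (toCoord_mem_target he.1 hρ))).ne'⟩
  · refine measure_mono_null ?_ (ae_iff.1 hz₁)
    rintro ρ ⟨⟨hρ, hb⟩, hg, hk⟩
    have h1 := hmem ρ hρ (Metric.ball_subset_closedBall hb) hg hk.le
    simp only [mem_ofPred_eq, Classical.not_imp, h1, if_true, Pi.zero_apply]
    exact ⟨hρ, hk.ne'⟩

lemma diffractive_union_glancing3_subset (he : IsAdaptedChart M e) {ρ : Phase n N}
    (hρ : ρ ∈ above e) (h : ρ ∈ diffractive g M ∪ glancing3 g M) :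
    ρ ∈ glancing g M ∧ 0 ≤ kap g e (toCoord e ρ) := by
  have key : ∃ e' : OpenPartialHomeomorph N (Eucl n), IsAdaptedChart M e' ∧ base ρ ∈ e'.source ∧
      0 ≤ ham e' (symb g) (ham e' (symb g) (zfun e')) ρ := by
    rcases h with ⟨_, e', h1, h2, h3⟩ | ⟨_, e', h1, h2, h3⟩
    exacts [⟨e', h1, h2, h3.le⟩, ⟨e', h1, h2, h3.ge⟩]
  have hg : ρ ∈ glancing g M := by
    rcases h with h | h
    exacts [h.1, h.1]
  obtain ⟨e', he', hm, hk⟩ := key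
  -- Each glancing point comes with its own adapted chart, while the null set is described in the
  -- fixed chart `e`; a nonnegative factor is enough to transfer the weak inequality.
  obtain ⟨c, hc, hc'⟩ := exists_kap_eq g he' he (show ρ ∈ above e' from hm) hρ hg.1
  rw [ham_ham_zfun g he'.1 hm] at hk
  refine ⟨hg, ?_⟩
  rw [hc']
  have : 0 ≤ kap g e' (toCoord e' ρ) := by linarith
  positivity

lemma measure_diffractive_union_glancing3 (hM : IsCompactC2Domain (n := n) M) {U : Set (Phase n N)}
    (hU : IsOpen U) {f : Phase n N → ℝ} (hf : Continuous f)
    {μ ν : Measure (Phase n N)} (hμ : IsMeasureOn U μ) [IsFiniteMeasureOnCompacts ν]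
    (heq : MeasureEquation g M U f μ ν) :
    ν (U ∩ (diffractive g M ∪ glancing3 g M)) = 0 := by
  refine measure_null_of_locally_null _ fun ρ hρ => ?_
  have hfr : base ρ ∈ frontier M := by
    rcases hρ.2 with h | h
    exacts [h.1.1.1, h.1.1.1]
  obtain ⟨e, he, hm⟩ := hM.exists_chart _ hfr
  obtain ⟨O, hO, hOe, hν, -⟩ := exists_nhds_null g he hU hf hμ heq (show ρ ∈ above e from hm) hρ.1
  refine ⟨O ∩ (U ∩ (diffractive g M ∪ glancing3 g M)),
    inter_mem (nhdsWithin_le_nhds hO) self_mem_nhdsWithin, measure_mono_null ?_ hν⟩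
  rintro ρ' ⟨h1, -, h2⟩
  exact ⟨h1, diffractive_union_glancing3_subset g he (hOe h1) h2⟩

/-- The chart witnessing H_p² z > 0 at a point also serves nearby, by continuity, so here no
comparison of charts is required. -/
lemma measure_diffractive {U : Set (Phase n N)}
    (hU : IsOpen U) {f : Phase n N → ℝ} (hf : Continuous f)
    {μ ν : Measure (Phase n N)} (hμ : IsMeasureOn U μ) [IsFiniteMeasureOnCompacts ν]
    (heq : MeasureEquation g M U f μ ν) : μ (diffractive g M) = 0 := by
  have hUn : μ (U ∩ diffractive g M) = 0 := by
    refine measure_null_of_locally_null _ fun ρ hρ => ?_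
    obtain ⟨-, e, he, hm, hk⟩ := hρ.2
    have hρe : ρ ∈ above e := hm
    obtain ⟨O, hO, hOe, -, hμ'⟩ := exists_nhds_null g he hU hf hμ heq hρe hρ.1
    rw [ham_ham_zfun g he.1 hm] at hk
    have hc : ContinuousOn (fun ρ : Phase n N => kap g e (toCoord e ρ)) (above e) :=
      (continuousOn_hamD he.1 g (contDiffOn_zeta g he.1)).comp (continuousOn_toCoord he.1)
        fun _ h => toCoord_mem_target he.1 h
    have hpos : ∀ᶠ ρ' in 𝓝 ρ, 0 < kap g e (toCoord e ρ') :=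
      continuousAt_const.eventually_lt (hc.continuousAt ((isOpen_above e).mem_nhds hρe))
        (by linarith)
    refine ⟨(O ∩ {ρ' | 0 < kap g e (toCoord e ρ')}) ∩ (U ∩ diffractive g M),
      inter_mem (nhdsWithin_le_nhds (inter_mem hO hpos)) self_mem_nhdsWithin,
      measure_mono_null ?_ hμ'⟩
    rintro ρ' ⟨⟨h1, h2⟩, -, h3⟩
    exact ⟨h1, h3.1, h2⟩
  refine measure_mono_null (t := Uᶜ ∪ (U ∩ diffractive g M)) (fun ρ h => ?_)
    (measure_union_null hμ.measure_compl hUn)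
  by_cases hρU : ρ ∈ U
  exacts [Or.inr ⟨hρU, h⟩, Or.inl hρU]

end

/-! ### Test functions that do not see the source. -/

section

/-- A weight `w` supported in `[-T, T]`, for which `t w(t)` decays at rate `λ`. -/
lemma exists_weight {T : ℝ} (hT : 0 ≤ T) (l : ℝ) : ∃ w : ℝ → ℝ, ContDiff ℝ 1 w ∧ (∀ t, 0 ≤ w t) ∧
    (∀ t, |t| < T → 0 < w t) ∧ (∀ t, T ≤ |t| → w t = 0) ∧
    ∀ t, deriv (fun t => t * w t) t ≤ (1 - 2 * l * t ^ 2) * w t := by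
  set E := expNegInvGlue
  have hE : ContDiff ℝ 1 E := expNegInvGlue.contDiff (n := 1)
  -- The Gaussian contributes -2lt² to the logarithmic derivative; the cutoff contributes -2t²E',
  -- which is nonpositive as E is monotone and is dropped.
  refine ⟨fun t => Real.exp (-(l * t ^ 2)) * E (T ^ 2 - t ^ 2), by fun_prop, fun t =>
    mul_nonneg (Real.exp_pos _).le (expNegInvGlue.nonneg _), fun t ht => ?_, fun t ht => ?_,
    fun t => ?_⟩
  · refine mul_pos (Real.exp_pos _) (expNegInvGlue.pos_of_pos ?_)
    have := sq_lt_sq' (by linarith [abs_nonneg t]) ht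
    rw [sq_abs] at this; linarith
  · have h1 : T ^ 2 ≤ |t| ^ 2 := pow_le_pow_left₀ hT ht 2
    rw [sq_abs] at h1
    have : E (T ^ 2 - t ^ 2) = 0 := expNegInvGlue.zero_of_nonpos (by linarith)
    simp only [this, mul_zero]
  · have hd := (hE.differentiable (by simp) (T ^ 2 - t ^ 2)).hasDerivAt
    have h2 : HasDerivAt (fun t : ℝ => T ^ 2 - t ^ 2) (-(2 * t)) t := by
      simpa using (hasDerivAt_pow 2 t).const_sub (T ^ 2)
    have h3 : HasDerivAt (fun t : ℝ => Real.exp (-(l * t ^ 2)))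
        (Real.exp (-(l * t ^ 2)) * (-(l * (2 * t)))) t := by
      have : HasDerivAt (fun t : ℝ => -(l * t ^ 2)) (-(l * (2 * t))) t := by
        have h := ((hasDerivAt_pow 2 t).const_mul (-l))
        simpa using h
      exact this.exp
    have h4 := (hasDerivAt_id t).mul (h3.mul (hd.comp t h2))
    have h5 : deriv (fun t => t * (Real.exp (-(l * t ^ 2)) * E (T ^ 2 - t ^ 2))) t = _ := h4.deriv
    rw [h5]
    have h6 : 0 ≤ deriv E (T ^ 2 - t ^ 2) := expNegInvGlue.monotone.deriv_nonneg
    have h7 := mul_nonneg (mul_nonneg (Real.exp_pos (-(l * t ^ 2))).le h6) (sq_nonneg t)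
    simp only [id, Function.comp, Pi.mul_apply]
    nlinarith [h7]

variable {n : ℕ} {N : Type*} [TopologicalSpace N] [ChartedSpace (Eucl n) N]
  [IsManifold 𝓘(ℝ, Eucl n) 2 N] {e : OpenPartialHomeomorph N (Eucl n)}
  (g : Metric1 n N)

/-- The points with `|t| ≤ T`, `x ∈ S`, `|τ| ≤ 1` and `|p| ≤ 1`. -/
def energyBox (g : Metric1 n N) (e : OpenPartialHomeomorph N (Eucl n)) (S : Set (Eucl n)) (T : ℝ) :
    Set (Coord n) :=
  {y | |y.1| ≤ T ∧ y.2.1 ∈ S ∧ |y.2.2.1| ≤ 1 ∧ |symbC g e y| ≤ 1}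

/-- The product test function `a(t) c(τ) β(x) η(p)`. -/
def prodTest (g : Metric1 n N) (e : OpenPartialHomeomorph N (Eucl n)) (a c η : ℝ → ℝ)
    (β : Eucl n → ℝ) (y : Coord n) : ℝ :=
  a y.1 * (c y.2.2.1 * (β y.2.1 * η (symbC g e y)))

section

variable (he : e ∈ IsManifold.maximalAtlas 𝓘(ℝ, Eucl n) 2 N) {S : Set (Eucl n)}
include he

/-- Minimum on S times the unit sphere, extended by homogeneity. -/
lemma exists_coercive (hS : IsCompact S) (hSe : S ⊆ e.target) :
    ∃ c > 0, ∀ x ∈ S, ∀ v : Eucl n, c * ‖v‖ ^ 2 ≤ inner ℝ (cogram g e x v) v := by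
  have hc : ContinuousOn (fun q : Eucl n × Eucl n => inner ℝ (cogram g e q.1 q.2) q.2)
      (S ×ˢ Metric.sphere 0 1) :=
    ContinuousOn.inner (𝕜 := ℝ) ((((contDiffOn_cogram he g).continuousOn).comp
      (f := fun q : Eucl n × Eucl n => q.1) (by fun_prop) fun y hy => hSe hy.1).clm_apply
        (by fun_prop)) (by fun_prop)
  obtain ⟨c, hc0, hcle⟩ := (hS.prod (isCompact_sphere 0 1)).exists_forall_le' hc (a := 0)
    fun q hq => cogram_pos he g (hSe hq.1) (by
      rintro h; have := hq.2; simp [h] at this)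
  refine ⟨c, hc0, fun x hx v => ?_⟩
  by_cases hv : v = 0
  · simp [hv]
  have hn : 0 < ‖v‖ := norm_pos_iff.2 hv
  have h := hcle (x, ‖v‖⁻¹ • v) ⟨hx, by simp [norm_smul, hn.ne']⟩
  simp only [map_smul, real_inner_smul_left, real_inner_smul_right] at h
  rw [← mul_assoc, ← mul_inv, ← pow_two, inv_mul_eq_div, le_div_iff₀ (by positivity)] at h
  exact h

lemma isCompact_energyBox (hS : IsCompact S) (hSe : S ⊆ e.target) (T : ℝ) :
    IsCompact (energyBox g e S T) := by
  obtain ⟨c, hc, hcle⟩ := exists_coercive g he hS hSe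
  -- From |p| ≤ 1 and |τ| ≤ 1, the dual norm satisfies |ξ|² ≤ 2, so ‖ξ‖² ≤ 2/c; the radius 2/c + 1
  -- avoids a square root.
  set A : Set (Coord n) := Icc (-T) T ×ˢ S ×ˢ Icc (-1) 1 ×ˢ Metric.closedBall 0 (2 / c + 1) with hA
  have hAc : IsCompact A :=
    isCompact_Icc.prod (hS.prod (isCompact_Icc.prod (isCompact_closedBall _ _)))
  have hp : ContinuousOn (fun y => |symbC g e y|) A :=
    ((contDiffOn_symbC he g).continuousOn.mono fun y hy => hSe hy.2.1).abs
  have hEq : energyBox g e S T = A ∩ (fun y => |symbC g e y|) ⁻¹' Iic 1 := by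
    ext y
    simp only [energyBox, hA, mem_ofPred_eq, mem_inter_iff, mem_prod, mem_preimage, mem_Iic,
      mem_closedBall_zero_iff, mem_Icc]
    constructor
    · rintro ⟨h1, h2, h3, h4⟩
      refine ⟨⟨abs_le.1 h1, h2, abs_le.1 h3, ?_⟩, h4⟩
      have h5 := hcle _ h2 y.2.2.2
      have h6 := (abs_le.1 h4).2
      have h7 : y.2.2.1 ^ 2 ≤ 1 := (sq_le_one_iff_abs_le_one _).2 h3
      have h8 : c * ‖y.2.2.2‖ ^ 2 ≤ 2 := by
        simp only [symbC] at h6; linarith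
      have h9 : ‖y.2.2.2‖ ^ 2 ≤ 2 / c := by rwa [le_div_iff₀ hc, mul_comm]
      nlinarith [sq_nonneg (‖y.2.2.2‖ - 1)]
    · rintro ⟨⟨h1, h2, h3, -⟩, h4⟩
      exact ⟨abs_le.2 h1, h2, abs_le.2 h3, h4⟩
  rw [hEq]
  exact hAc.of_isClosed_subset (hp.preimage_isClosed_of_isClosed hAc.isClosed isClosed_Iic)
    inter_subset_left

omit he in
lemma energyBox_subset_region (hSe : S ⊆ e.target) (T : ℝ) :
    energyBox g e S T ⊆ region e := fun _ hy => hSe hy.2.1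

variable {a c η : ℝ → ℝ} {β : Eucl n → ℝ} {T : ℝ}

lemma isCoordTest_prodTest (ha : ContDiff ℝ 1 a) (hc : ContDiff ℝ 1 c) (hη : ContDiff ℝ 1 η)
    (hβ : ContDiff ℝ 1 β) (hβc : HasCompactSupport β) (hβe : tsupport β ⊆ e.target)
    (ha0 : ∀ t, T < |t| → a t = 0) (hc0 : ∀ s, 1 < |s| → c s = 0) (hη0 : ∀ s, 1 < |s| → η s = 0) :
    IsCoordTest univ e (energyBox g e (tsupport β) T) (prodTest g e a c η β) := by
  refine ⟨?_, isCompact_energyBox g he hβc hβe T, energyBox_subset_region g hβe T, ?_, fun _ _ =>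
    mem_univ _⟩
  · have h1 : ContDiffOn ℝ 1 (fun y => η (symbC g e y)) (region e) :=
      hη.comp_contDiffOn (contDiffOn_symbC he g)
    have h2 : ContDiff ℝ 1 fun y : Coord n => a y.1 := ha.comp contDiff_fst
    have h3 : ContDiff ℝ 1 fun y : Coord n => c y.2.2.1 :=
      hc.comp (contDiff_fst.comp (contDiff_snd.comp contDiff_snd))
    have h4 : ContDiff ℝ 1 fun y : Coord n => β y.2.1 := hβ.comp (contDiff_fst.comp contDiff_snd)
    exact h2.contDiffOn.mul (h3.contDiffOn.mul (h4.contDiffOn.mul h1))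
  · intro y _ hy
    simp only [energyBox, mem_ofPred_eq, not_and_or, not_le] at hy
    unfold prodTest
    rcases hy with h | h | h | h
    · rw [ha0 _ h]; ring
    · rw [image_eq_zero_of_notMem_tsupport h]; ring
    · rw [hc0 _ h]; ring
    · rw [hη0 _ h]; ring

/-- τ and p are constant along the flow, so only the factors in t and x are differentiated. -/
lemma hamD_prodTest (ha : ContDiff ℝ 1 a) (hc : ContDiff ℝ 1 c) (hη : ContDiff ℝ 1 η)
    (hβ : ContDiff ℝ 1 β) {y : Coord n} (hy : y ∈ region e) :
    hamD g e (prodTest g e a c η β) y =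
      -2 * y.2.2.1 * deriv a y.1 * c y.2.2.1 * β y.2.1 * η (symbC g e y) +
        a y.1 * c y.2.2.1 * η (symbC g e y) *
          (2 * fderiv ℝ β y.2.1 (cogram g e y.2.1 y.2.2.2)) := by
  obtain ⟨w, hw⟩ := hamVec_symbC he g hy
  have da : DifferentiableAt ℝ (fun y : Coord n => a y.1) y :=
    (ha.differentiable (by simp) _).comp y differentiableAt_fst
  have dc : DifferentiableAt ℝ (fun y : Coord n => c y.2.2.1) y :=
    (hc.differentiable (by simp) _).comp y (f := fun y : Coord n => y.2.2.1) (by fun_prop)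
  have dβ : DifferentiableAt ℝ (fun y : Coord n => β y.2.1) y :=
    (hβ.differentiable (by simp) _).comp y (f := fun y : Coord n => y.2.1) (by fun_prop)
  have dη : DifferentiableAt ℝ (fun y : Coord n => η (symbC g e y)) y :=
    (hη.differentiable (by simp) _).comp y (differentiableAt_symbC he g hy)
  have ea : hamD g e (fun y : Coord n => a y.1) y = deriv a y.1 * (-2 * y.2.2.1) := by
    rw [hamD_comp g (f := fun y : Coord n => y.1) differentiableAt_fst
      (ha.differentiable (by simp) y.1).hasDerivAt, hamD, fderiv_fst, hw]
    rfl
  have ec : hamD g e (fun y : Coord n => c y.2.2.1) y = 0 := by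
    have h : HasFDerivAt (fun y : Coord n => y.2.2.1) ((ContinuousLinearMap.fst ℝ ℝ (Eucl n)).comp
        ((ContinuousLinearMap.snd ℝ (Eucl n) (ℝ × Eucl n)).comp
          (ContinuousLinearMap.snd ℝ ℝ (Eucl n × ℝ × Eucl n)))) y :=
      (hasFDerivAt_snd.comp y hasFDerivAt_snd).fst
    rw [hamD_comp g (f := fun y : Coord n => y.2.2.1) h.differentiableAt
      (hc.differentiable (by simp) y.2.2.1).hasDerivAt, hamD, h.fderiv, hw]
    simp
  have eβ : hamD g e (fun y : Coord n => β y.2.1) y =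
      2 * fderiv ℝ β y.2.1 (cogram g e y.2.1 y.2.2.2) := by
    have h : HasFDerivAt (fun y : Coord n => y.2.1) ((ContinuousLinearMap.fst ℝ (Eucl n) _).comp
          (ContinuousLinearMap.snd ℝ ℝ (Eucl n × ℝ × Eucl n))) y :=
      hasFDerivAt_snd.fst
    have h2 : HasFDerivAt (fun y : Coord n => β y.2.1) _ y :=
      (hβ.differentiable (by simp) y.2.1).hasFDerivAt.comp y h
    rw [hamD, h2.fderiv, hw]
    simp
  have eη : hamD g e (fun y : Coord n => η (symbC g e y)) y = 0 := by
    rw [hamD_comp g (differentiableAt_symbC he g hy) (hη.differentiable (by simp) _).hasDerivAt,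
      hamD_symbC, mul_zero]
  have dβη : DifferentiableAt ℝ (fun y : Coord n => β y.2.1 * η (symbC g e y)) y := dβ.mul dη
  have dcβη : DifferentiableAt ℝ
      (fun y : Coord n => c y.2.2.1 * (β y.2.1 * η (symbC g e y))) y := dc.mul dβη
  unfold prodTest
  rw [hamD_mul g da dcβη, hamD_mul g dc dβη, hamD_mul g dβ dη, ea, ec, eβ, eη]
  ring

/-- The function depends on ξ through p alone, and p is even along the conormal: the difference at
the two lifts vanishes, and so does the conormal derivative at a glancing point. The chart `e` need
not be adapted. -/
lemma sourcePairing_prodTest {M : Set N} (hM : IsCompactC2Domain (n := n) M)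
    (hη : ContDiff ℝ 1 η) {ρ : Phase n N} (hρ : ρ ∈ above e)
    (h : ρ ∈ hyperbolic g M ∪ glancing g M) :
    sourcePairing g M (extend e (prodTest g e a c η β)) ρ = 0 := by
  rw [mem_hyperbolic_union_glancing_iff] at h
  obtain ⟨ht, hp⟩ := h
  obtain ⟨e', he', hm'⟩ := hM.exists_chart _ ht.1
  set k := a ρ.1 * (c (tau ρ) * β (e (base ρ))) with hk
  have hq : ∀ s, extend e (prodTest g e a c η β) (shift g M s ρ) = k * η (symb g ρ + s ^ 2) := by
    intro s
    have hs : shift g M s ρ ∈ above e := hρ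
    rw [extend_of_mem _ hs, ← symb_shift g he' hm' ht s, symb_eq he g hs, hk]
    unfold prodTest
    simp only [toCoord]
    show a ρ.1 * (c (tau ρ) * (β (e (base ρ)) * _)) = _
    ring
  unfold sourcePairing
  split_ifs with hlt
  · rw [liftPlus, liftMinus, hq, hq, neg_sq, sub_self, zero_div]
  · simp only [hq]
    have h1 : HasDerivAt (fun s : ℝ => symb g ρ + s ^ 2) 0 0 := by
      simpa using (hasDerivAt_pow 2 (0 : ℝ)).const_add (symb g ρ)
    have h2 := (((hη.differentiable (by simp) _).hasDerivAt.comp (0 : ℝ) h1).const_mul k).deriv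
    simpa using h2

end

end

/-! ### Lower bounds for τ on compact sets, and equations without source. -/

section

variable {n : ℕ} {N : Type*} [TopologicalSpace N] [ChartedSpace (Eucl n) N]
  [IsManifold 𝓘(ℝ, Eucl n) 2 N] {M : Set N}
  (g : Metric1 n N)

lemma cometric_self_pos {m : N} {ξ : Covector n N m} (hξ : ξ ≠ 0) : 0 < cometric g m ξ ξ := by
  have h1 : g.inner m (sharp g m ξ) (sharp g m ξ) = cometric g m ξ ξ := by
    rw [inner_sharp]; rfl
  rw [← h1]
  refine g.pos m _ fun h => hξ ?_
  rw [← inner_sharp g m ξ, h, map_zero]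

lemma cometric_self_nonneg {m : N} (ξ : Covector n N m) : 0 ≤ cometric g m ξ ξ := by
  by_cases h : ξ = 0
  · rw [h]; simp [cometric]
  · exact (cometric_self_pos g h).le

lemma continuousOn_symb {e : OpenPartialHomeomorph N (Eucl n)}
    (he : e ∈ IsManifold.maximalAtlas 𝓘(ℝ, Eucl n) 2 N) :
    ContinuousOn (symb g : Phase n N → ℝ) (above e) :=
  ((contDiffOn_symbC he g).continuousOn.comp (continuousOn_toCoord he)
    fun _ hρ => toCoord_mem_target he hρ).congr fun _ hρ => symb_eq he g hρ

lemma continuous_symb : Continuous (symb g : Phase n N → ℝ) :=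
  continuous_iff_continuousAt.2 fun ρ =>
    (continuousOn_symb g (IsManifold.chart_mem_maximalAtlas (base ρ))).continuousAt
      ((isOpen_above _).mem_nhds (mem_chart_source (Eucl n) (base ρ)))

/-- On compact subsets of `U`, the variable `τ` is bounded below on the support of `μ`. -/
lemma exists_le_abs_tau {U : Set (Phase n N)} {μ : Measure (Phase n N)}
    (hsupp : SupportAssumption g M U μ) {K : Set (Phase n N)} (hK : IsCompact K) (hKU : K ⊆ U) :
    ∃ C > 0, ∀ ρ ∈ K ∩ μ.support, C ≤ |tau ρ| := by
  refine (hK.inter_right Measure.isClosed_support).exists_forall_le'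
    (continuous_tau.abs.continuousOn) fun ρ hρ => abs_pos.2 fun h0 => ?_
  obtain ⟨h1, -, h3⟩ := hsupp ρ ⟨hKU hρ.1, hρ.2⟩
  -- On p = 0, τ = 0 forces |ξ|² = 0, hence a point of the zero section, which the support avoids.
  refine h3 ⟨h0, by_contra fun h => ?_⟩
  have := cometric_self_pos g h
  simp only [symb, h0] at h1
  linarith

section

variable [T2Space N] [SecondCountableTopology N] {e : OpenPartialHomeomorph N (Eucl n)}
  (he : e ∈ IsManifold.maximalAtlas 𝓘(ℝ, Eucl n) 2 N)
include he

lemma integrableOn_comp_toCoord {μ : Measure (Phase n N)} {F : Coord n → ℝ}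
    (hF : ContinuousOn F (region e)) {K : Set (Coord n)} (hK : IsCompact K) (hKe : K ⊆ region e)
    (hμ : μ (ofCoord e '' K) < ⊤) (hz : ∀ y ∈ region e, y ∉ K → F y = 0) :
    IntegrableOn (fun ρ => F (toCoord e ρ)) (above e) μ := by
  obtain ⟨C, hC⟩ := hK.exists_bound_of_continuousOn (hF.mono hKe)
  refine (tendsto_setIntegral_of_bounded (isOpen_above e).measurableSet
    (isCompact_image_ofCoord he hK hKe).isClosed.measurableSet hμ
    (F := fun _ ρ => F (toCoord e ρ)) (C := C)
    (fun _ => aestronglyMeasurable_comp_toCoord he hF μ)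
    (fun _ ρ _ hρ => hC _ ((mem_image_ofCoord he hKe).1 hρ).2)
    (fun _ ρ h1 h2 => hz _ (toCoord_mem_target he h1) fun h3 =>
      h2 ((mem_image_ofCoord he hKe).2 ⟨h1, h3⟩)) fun ρ _ => tendsto_const_nhds).1

/-- Test functions of product type see no source. -/
lemma integral_prodTest (hM : IsCompactC2Domain (n := n) M) {f : Phase n N → ℝ}
    (hf : Continuous f) {μ ν : Measure (Phase n N)} (hμ : IsMeasureOn univ μ)
    (heq : MeasureEquation g M univ f μ ν) {a c η : ℝ → ℝ} {β : Eucl n → ℝ} {K : Set (Coord n)}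
    (hη : ContDiff ℝ 1 η) (H : IsCoordTest univ e K (prodTest g e a c η β)) :
    Integrable ((above e).indicator fun ρ => hamD g e (prodTest g e a c η β) (toCoord e ρ) -
      f ρ * prodTest g e a c η β (toCoord e ρ)) μ ∧
    ∫ ρ, (above e).indicator (fun ρ => hamD g e (prodTest g e a c η β) (toCoord e ρ) -
      f ρ * prodTest g e a c η β (toCoord e ρ)) ρ ∂μ = 0 := by
  have hm : MeasurableSet (above e : Set (Phase n N)) := (isOpen_above e).measurableSet
  have hK := hμ.measure_lt_top _ (isCompact_image_ofCoord he H.isCompact H.subset_region)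
    (subset_univ _)
  have h1 : IntegrableOn (fun ρ => hamD g e (prodTest g e a c η β) (toCoord e ρ)) (above e) μ :=
    integrableOn_comp_toCoord he (continuousOn_hamD he g H.contDiffOn) H.isCompact H.subset_region
      hK fun y hy hyK => hamD_eq_zero g (by
        filter_upwards [(isOpen_region e).mem_nhds hy,
          H.isCompact.isClosed.isOpen_compl.mem_nhds hyK] with z hz hzK
        exact H.eq_zero z hz hzK)
  have h2 : IntegrableOn (fun ρ => f ρ * prodTest g e a c η β (toCoord e ρ)) (above e) μ := by
    refine (integrableOn_comp_toCoord he (F := fun y => f (ofCoord e y) * prodTest g e a c η β y)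
      ((hf.comp_continuousOn (continuousOn_ofCoord he)).mul H.contDiffOn.continuousOn)
      H.isCompact H.subset_region hK fun y hy hyK => by
        rw [H.eq_zero y hy hyK, mul_zero]).congr_fun (fun ρ hρ => ?_) hm
    simp only [ofCoord_toCoord he hρ]
  refine ⟨(integrable_indicator_iff hm).2 (h1.sub h2), ?_⟩
  rw [integral_indicator hm, integral_sub h1 h2, measureEquation_extend he g heq H]
  have h0 : ∫ ρ in (hyperbolic g M ∪ glancing g M) ∩ above e,
      sourcePairing g M (extend e (prodTest g e a c η β)) ρ ∂ν = 0 := by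
    refine setIntegral_eq_zero_of_forall_eq_zero fun ρ hρ => ?_
    exact sourcePairing_prodTest g he hM hη hρ.2 hρ.1
  rw [h0]; ring

end

/-- No partition of unity is required: a lower bound for the sum suffices, since the derivatives of
the bumps will be absorbed by the time weight. -/
lemma exists_bumps (hM : IsCompact M) : ∃ (s : Finset N) (β : N → Eucl n → ℝ),
    (∀ m, ContDiff ℝ 1 (β m) ∧ HasCompactSupport (β m) ∧
      tsupport (β m) ⊆ (chartAt (Eucl n) m).target ∧ ∀ x, 0 ≤ β m x) ∧
    ∀ x ∈ M, ∃ m ∈ s, x ∈ (chartAt (Eucl n) m).source ∧ 1 / 2 < β m (chartAt (Eucl n) m x) := by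
  have h : ∀ m : N, ∃ β : Eucl n → ℝ, tsupport β ⊆ (chartAt (Eucl n) m).target ∧
      HasCompactSupport β ∧ ContDiff ℝ 1 β ∧ range β ⊆ Icc 0 1 ∧ β (chartAt (Eucl n) m m) = 1 :=
    fun m => exists_contDiff_tsupport_subset (n := 1) (chart_target_mem_nhds (Eucl n) m)
  choose β h1 h2 h3 h4 h5 using h
  obtain ⟨s, -, hs⟩ := hM.elim_nhds_subcover
    (fun m => {x | x ∈ (chartAt (Eucl n) m).source ∧ 1 / 2 < β m (chartAt (Eucl n) m x)})
    fun m _ => by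
      have hc : ContinuousAt (fun x => β m (chartAt (Eucl n) m x)) m :=
        (h3 m).continuous.continuousAt.comp
          ((chartAt (Eucl n) m).continuousAt (mem_chart_source (Eucl n) m))
      exact Filter.inter_mem (chart_source_mem_nhds (Eucl n) m)
        (hc.eventually_const_lt (by show (1 / 2 : ℝ) < β m (chartAt (Eucl n) m m); rw [h5]; norm_num))
  refine ⟨s, β, fun m => ⟨h3 m, h2 m, h1 m, fun x => (h4 m ⟨x, rfl⟩).1⟩, fun x hx => ?_⟩
  obtain ⟨m, hm, h⟩ := mem_iUnion₂.1 (hs hx)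
  exact ⟨m, hm, h⟩

end

/-! ### Propagation in time and the uniform gap in τ. -/

section

variable {n : ℕ} {N : Type*} [TopologicalSpace N] [ChartedSpace (Eucl n) N]
  [IsManifold 𝓘(ℝ, Eucl n) 2 N] {M : Set N}
  (g : Metric1 n N)

/-- With a = t w(t) and c = τκ(τ), the speed -2τ of t produces the signed factor τ². The rest equals
t w κ η(0) times the quantity bounded by `C` on the energy box; off the box that quantity or the
weight is 0. -/
lemma le_hamD_prodTest_sub {e : OpenPartialHomeomorph N (Eucl n)}
    (he : e ∈ IsManifold.maximalAtlas 𝓘(ℝ, Eucl n) 2 N) {w κ η : ℝ → ℝ} {β : Eucl n → ℝ}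
    {T C f₀ : ℝ} (hw : ContDiff ℝ 1 w) (hκ : ContDiff ℝ 1 κ) (hη : ContDiff ℝ 1 η)
    (hβ : ContDiff ℝ 1 β) (hw0 : ∀ t, 0 ≤ w t) (hκ0 : ∀ t, 0 ≤ κ t) (hη0 : 0 ≤ η 0)
    (hwT : ∀ t, T ≤ |t| → w t = 0) (hκ1 : ∀ t, 1 ≤ |t| → κ t = 0) (hC : 0 ≤ C)
    {y : Coord n} (hy : y ∈ region e) (hp : symbC g e y = 0)
    (hk : y ∈ energyBox g e (tsupport β) T →
      |y.2.2.1 * (2 * fderiv ℝ β y.2.1 (cogram g e y.2.1 y.2.2.2) - f₀ * β y.2.1)| ≤ C) :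
    κ y.2.2.1 * η 0 * (-2 * y.2.2.1 ^ 2 * deriv (fun t => t * w t) y.1 * β y.2.1
        - |y.1| * w y.1 * C) ≤
      hamD g e (prodTest g e (fun t => t * w t) (fun s => s * κ s) η β) y -
        f₀ * prodTest g e (fun t => t * w t) (fun s => s * κ s) η β y := by
  rw [hamD_prodTest g he (a := fun t => t * w t) (c := fun s => s * κ s) (contDiff_id.mul hw)
    (contDiff_id.mul hκ) hη hβ hy, prodTest, hp]
  set k := y.2.2.1 * (2 * fderiv ℝ β y.2.1 (cogram g e y.2.1 y.2.2.2) - f₀ * β y.2.1) with hkdef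
  have key : -(|y.1| * C * (w y.1 * κ y.2.2.1)) ≤ y.1 * k * (w y.1 * κ y.2.2.1) := by
    by_cases hb : y ∈ energyBox g e (tsupport β) T
    · have h1 : |y.1 * k| ≤ |y.1| * C := by
        rw [abs_mul]; exact mul_le_mul_of_nonneg_left (hk hb) (abs_nonneg _)
      have h2 := (abs_le.1 h1).1
      have h3 := mul_le_mul_of_nonneg_right h2 (mul_nonneg (hw0 y.1) (hκ0 y.2.2.1))
      linarith
    · have h0 : k = 0 ∨ w y.1 * κ y.2.2.1 = 0 := by
        simp only [energyBox, mem_ofPred_eq, not_and_or, not_le, hp, abs_zero] at hb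
        rcases hb with h | h | h | h
        · right; rw [hwT _ h.le, zero_mul]
        · left
          rw [hkdef, image_eq_zero_of_notMem_tsupport h,
            (notMem_tsupport_iff_eventuallyEq.1 h).fderiv_eq]
          simp
        · right; rw [hκ1 _ h.le, mul_zero]
        · linarith
      rcases h0 with h | h
      · rw [h, mul_zero, zero_mul, neg_nonpos]
        exact mul_nonneg (mul_nonneg (abs_nonneg _) hC) (mul_nonneg (hw0 _) (hκ0 _))
      · rw [h]; simp
  have := mul_le_mul_of_nonneg_left key hη0
  simp only [hkdef] at this
  linarith

lemma le_indicator_hamD_prodTest_sub {e : OpenPartialHomeomorph N (Eucl n)}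
    (he : e ∈ IsManifold.maximalAtlas 𝓘(ℝ, Eucl n) 2 N) {w κ η : ℝ → ℝ} {β : Eucl n → ℝ}
    {T C : ℝ} {f : Phase n N → ℝ} (hw : ContDiff ℝ 1 w) (hκ : ContDiff ℝ 1 κ)
    (hη : ContDiff ℝ 1 η) (hβ : ContDiff ℝ 1 β) (hw0 : ∀ t, 0 ≤ w t) (hκ0 : ∀ t, 0 ≤ κ t)
    (hη0 : 0 ≤ η 0) (hwT : ∀ t, T ≤ |t| → w t = 0) (hκ1 : ∀ t, 1 ≤ |t| → κ t = 0) (hC : 0 ≤ C)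
    {ρ : Phase n N} (hp : symb g ρ = 0)
    (hk : ∀ y ∈ energyBox g e (tsupport β) T,
      |y.2.2.1 * (2 * fderiv ℝ β y.2.1 (cogram g e y.2.1 y.2.2.2)
        - f (ofCoord e y) * β y.2.1)| ≤ C) :
    κ (tau ρ) * η 0 * (-2 * tau ρ ^ 2 * deriv (fun t => t * w t) ρ.1 *
        (above e).indicator (fun ρ : Phase n N => β (e (base ρ))) ρ - |ρ.1| * w ρ.1 * C) ≤
      (above e).indicator (fun ρ : Phase n N =>
        hamD g e (prodTest g e (fun t => t * w t) (fun s => s * κ s) η β) (toCoord e ρ) -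
          f ρ * prodTest g e (fun t => t * w t) (fun s => s * κ s) η β (toCoord e ρ)) ρ := by
  by_cases hm : ρ ∈ above e
  · rw [indicator_of_mem hm, indicator_of_mem hm]
    refine le_hamD_prodTest_sub g he hw hκ hη hβ hw0 hκ0 hη0 hwT hκ1 hC
      (toCoord_mem_target he hm) ((symb_eq he g hm).symm.trans hp) fun hb => ?_
    have := hk _ hb
    rwa [ofCoord_toCoord he hm] at this
  · rw [indicator_of_notMem hm, indicator_of_notMem hm, mul_zero, zero_sub, mul_neg, neg_nonpos]
    exact mul_nonneg (mul_nonneg (hκ0 _) hη0)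
      (mul_nonneg (mul_nonneg (abs_nonneg _) (hw0 _)) hC)

/-- The constant depends on T, β and f but not on the weights w and κ, so the decay rate of w can be
chosen after it. -/
lemma exists_bound_prodTest {e : OpenPartialHomeomorph N (Eucl n)}
    (he : e ∈ IsManifold.maximalAtlas 𝓘(ℝ, Eucl n) 2 N) {f : Phase n N → ℝ} (hf : Continuous f)
    {β : Eucl n → ℝ} (hβ : ContDiff ℝ 1 β) (hβc : HasCompactSupport β)
    (hβe : tsupport β ⊆ e.target) (T : ℝ) :
    ∃ C, 0 ≤ C ∧ ∀ y ∈ energyBox g e (tsupport β) T,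
      |y.2.2.1 * (2 * fderiv ℝ β y.2.1 (cogram g e y.2.1 y.2.2.2)
        - f (ofCoord e y) * β y.2.1)| ≤ C := by
  have hfd : Continuous fun y : Coord n => fderiv ℝ β y.2.1 :=
    (hβ.continuous_fderiv (by simp)).comp (by fun_prop)
  have hβ' : Continuous fun y : Coord n => β y.2.1 := hβ.continuous.comp (by fun_prop)
  have hcont : ContinuousOn (fun y : Coord n => y.2.2.1 *
      (2 * fderiv ℝ β y.2.1 (cogram g e y.2.1 y.2.2.2) - f (ofCoord e y) * β y.2.1)) (region e) :=
    (by fun_prop : Continuous fun y : Coord n => y.2.2.1).continuousOn.mul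
      ((continuousOn_const.mul (hfd.continuousOn.clm_apply
        (contDiffOn_cogram_apply he g).continuousOn)).sub
        ((hf.comp_continuousOn (continuousOn_ofCoord he)).mul hβ'.continuousOn))
  obtain ⟨C, hC⟩ := (isCompact_energyBox g he hβc hβe T).exists_bound_of_continuousOn
    (hcont.mono (energyBox_subset_region g hβe T))
  exact ⟨max C 0, le_max_right _ _, fun y hy => (hC y hy).trans (le_max_left _ _)⟩

/-- A smooth cutoff, positive exactly for `δ < |r| < ε`. -/
lemma exists_cutoff {δ ε : ℝ} (hδ : 0 ≤ δ) (hε : 0 < ε) : ∃ κ : ℝ → ℝ, ContDiff ℝ 1 κ ∧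
    (∀ r, 0 ≤ κ r) ∧ ∀ r, 0 < κ r ↔ δ < |r| ∧ |r| < ε := by
  have hE : ContDiff ℝ 1 expNegInvGlue := expNegInvGlue.contDiff (n := 1)
  have h0 : ∀ r : ℝ, 0 ≤ expNegInvGlue (r ^ 2 - δ ^ 2) * expNegInvGlue (ε ^ 2 - r ^ 2) := fun r =>
    mul_nonneg (expNegInvGlue.nonneg _) (expNegInvGlue.nonneg _)
  refine ⟨fun s => expNegInvGlue (s ^ 2 - δ ^ 2) * expNegInvGlue (ε ^ 2 - s ^ 2), by fun_prop, h0,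
    fun r => ?_⟩
  have h1 : 0 < expNegInvGlue (r ^ 2 - δ ^ 2) * expNegInvGlue (ε ^ 2 - r ^ 2) ↔
      0 < r ^ 2 - δ ^ 2 ∧ 0 < ε ^ 2 - r ^ 2 := by
    rw [(h0 r).lt_iff_ne', mul_ne_zero_iff, ne_eq, ne_eq, expNegInvGlue.zero_iff_nonpos,
      expNegInvGlue.zero_iff_nonpos, not_le, not_le]
  rw [h1, sub_pos, sub_pos, sq_lt_sq, sq_lt_sq, abs_of_nonneg hδ, abs_of_pos hε]

section

variable [T2Space N] [SecondCountableTopology N]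

/-- If the measure equation holds on the whole phase space, `μ` vanishes where `|τ|` is small and
bounded below, uniformly in time. -/
lemma measure_slab_eq_zero (hM : IsCompactC2Domain (n := n) M) {f : Phase n N → ℝ}
    (hf : Continuous f) {μ ν : Measure (Phase n N)} (hμ : IsMeasureOn univ μ)
    (hsupp : SupportAssumption g M univ μ) (heq : MeasureEquation g M univ f μ ν) {ε : ℝ}
    (hε1 : ε ≤ 1) (hε : ∀ ρ ∈ μ.support, |ρ.1| ≤ 1 → ε ≤ |tau ρ|) {T δ : ℝ} (hT : 0 < T)
    (hδ : 0 < δ) : μ {ρ | |ρ.1| < T ∧ δ < |tau ρ| ∧ |tau ρ| < ε} = 0 := by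
  by_cases hε0 : ε ≤ 0
  · rw [show {ρ : Phase n N | |ρ.1| < T ∧ δ < |tau ρ| ∧ |tau ρ| < ε} = ∅ from
      eq_empty_of_forall_notMem fun ρ h => absurd h.2.2 (not_lt.2 (hε0.trans (abs_nonneg _))),
      measure_empty]
  push Not at hε0
  obtain ⟨s, β, hβ, hcov⟩ := exists_bumps (n := n) hM.isCompact
  have he : ∀ m : N, chartAt (Eucl n) m ∈ IsManifold.maximalAtlas 𝓘(ℝ, Eucl n) 2 N :=
    fun m => IsManifold.chart_mem_maximalAtlas m
  obtain ⟨κ, hκc, hκ0, hκpos⟩ := exists_cutoff hδ.le hε0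
  set η : ℝ → ℝ := fun p => expNegInvGlue (1 - p ^ 2) with hηdef
  have hηc : ContDiff ℝ 1 η :=
    (expNegInvGlue.contDiff (n := 1)).comp (contDiff_const.sub (contDiff_id.pow 2))
  have hκ1 : ∀ r, 1 ≤ |r| → κ r = 0 := fun r hr => le_antisymm (not_lt.1 fun h =>
    absurd (((hκpos r).1 h).2.trans_le hε1) (not_lt.2 hr)) (hκ0 r)
  have hη0 : 0 < η 0 := expNegInvGlue.pos_of_pos (by norm_num)
  have hη1 : ∀ p, 1 < |p| → η p = 0 := fun p hp => expNegInvGlue.zero_of_nonpos (by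
    have := (one_lt_sq_iff_one_lt_abs p).2 hp; linarith)
  have hbd := fun m => exists_bound_prodTest g (he m) hf (hβ m).1 (hβ m).2.1 (hβ m).2.2.1 T
  choose C hC0 hC using hbd
  -- The first term makes δ²l exceed the total error constant by at least 1, which leaves a positive
  -- remainder; the second ensures l ≥ 1.
  set l := (∑ m ∈ s, C m + 1) / δ ^ 2 + 1 with hl
  have hCs : 0 ≤ ∑ m ∈ s, C m := Finset.sum_nonneg fun m _ => hC0 m
  obtain ⟨w, hwc, hw0, hwpos, hwT, hwd⟩ := exists_weight hT.le l
  set G : N → Phase n N → ℝ := fun m => (above (chartAt (Eucl n) m)).indicator fun ρ =>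
    hamD g (chartAt (Eucl n) m) (prodTest g (chartAt (Eucl n) m) (fun t => t * w t)
      (fun r => r * κ r) η (β m)) (toCoord (chartAt (Eucl n) m) ρ) -
    f ρ * prodTest g (chartAt (Eucl n) m) (fun t => t * w t) (fun r => r * κ r) η (β m)
      (toCoord (chartAt (Eucl n) m) ρ) with hG
  have hGint : ∀ m, Integrable (G m) μ ∧ ∫ ρ, G m ρ ∂μ = 0 := fun m =>
    integral_prodTest g (he m) hM hf hμ heq hηc
      (isCoordTest_prodTest g (he m) (T := T) (contDiff_id.mul hwc) (contDiff_id.mul hκc) hηc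
        (hβ m).1 (hβ m).2.1 (hβ m).2.2.1 (fun t ht => by rw [hwT t ht.le, mul_zero])
        (fun r hr => by rw [hκ1 r hr.le, mul_zero]) hη1)
  set B : N → Phase n N → ℝ := fun m => (above (chartAt (Eucl n) m)).indicator fun ρ =>
    β m (chartAt (Eucl n) m (base ρ)) with hB
  have hB0 : ∀ m ρ, 0 ≤ B m ρ := fun m ρ => indicator_nonneg (fun ρ _ => (hβ m).2.2.2 _) ρ
  have hGge : ∀ m, ∀ ρ ∈ μ.support, κ (tau ρ) * η 0 *
      (-2 * tau ρ ^ 2 * deriv (fun t => t * w t) ρ.1 * B m ρ - |ρ.1| * w ρ.1 * C m) ≤ G m ρ := by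
    intro m ρ hρ
    exact le_indicator_hamD_prodTest_sub g (he m) hwc hκc hηc (hβ m).1 hw0 hκ0 hη0.le hwT hκ1
      (hC0 m) (hsupp ρ ⟨mem_univ _, hρ⟩).1 (hC m)
  -- This pointwise bound is the core of the argument: the sum has integral 0, so a nonnegative
  -- lower bound forces it to vanish almost everywhere.
  have hlow : ∀ ρ ∈ μ.support, κ (tau ρ) * η 0 * (|ρ.1| * w ρ.1) ≤ ∑ m ∈ s, G m ρ := by
    intro ρ hρ
    refine le_trans ?_ (Finset.sum_le_sum fun m _ => hGge m ρ hρ)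
    rw [← Finset.mul_sum, Finset.sum_sub_distrib, ← Finset.mul_sum, ← Finset.mul_sum]
    rcases (hκ0 (tau ρ)).eq_or_lt with h0 | hpos
    · rw [← h0]; simp
    refine mul_le_mul_of_nonneg_left ?_ (mul_nonneg (hκ0 _) hη0.le)
    obtain ⟨h1, h2⟩ := (hκpos _).1 hpos
    -- The weight has the wrong sign near t = 0, but there the support has no point with |τ| < ε.
    have ht : 1 < |ρ.1| := not_le.1 fun h => absurd (hε ρ hρ h) (not_le.2 h2)
    have hBs : 1 / 2 ≤ ∑ m ∈ s, B m ρ := by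
      obtain ⟨m, hms, hm, hm2⟩ := hcov _ (hsupp ρ ⟨mem_univ _, hρ⟩).2.1
      refine le_trans ?_ (Finset.single_le_sum (fun i _ => hB0 i ρ) hms)
      have hm' : ρ ∈ above (chartAt (Eucl n) m) := hm
      simp only [hB, indicator_of_mem hm']
      exact hm2.le
    have hτ : δ ^ 2 ≤ tau ρ ^ 2 := by rw [← sq_abs (tau ρ)]; exact pow_le_pow_left₀ hδ.le h1.le 2
    have ht2 : |ρ.1| ≤ ρ.1 ^ 2 := by rw [← sq_abs]; nlinarith
    have hl1 : 1 ≤ l := by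
      have h3 : 0 ≤ (∑ m ∈ s, C m + 1) / δ ^ 2 := by positivity
      linarith
    have hd : l * |ρ.1| * w ρ.1 ≤ -deriv (fun t => t * w t) ρ.1 := by
      have h3 := hwd ρ.1
      have h4 : l * |ρ.1| ≤ 2 * l * ρ.1 ^ 2 - 1 := by nlinarith
      have h5 := mul_le_mul_of_nonneg_right h4 (hw0 ρ.1)
      linarith
    have hlw : 0 ≤ l * |ρ.1| * w ρ.1 :=
      mul_nonneg (mul_nonneg (by linarith) (abs_nonneg _)) (hw0 _)
    -- The factor 2 compensates the lower bound 1/2 for the sum of the bumps.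
    have h6 : δ ^ 2 * (l * |ρ.1| * w ρ.1) ≤
        tau ρ ^ 2 * (-deriv (fun t => t * w t) ρ.1) * (2 * ∑ m ∈ s, B m ρ) := by
      have h7 := mul_le_mul hτ hd hlw (sq_nonneg _)
      have h8 : 0 ≤ δ ^ 2 * (l * |ρ.1| * w ρ.1) := mul_nonneg (sq_nonneg _) hlw
      nlinarith
    have h9 : δ ^ 2 * l = ∑ m ∈ s, C m + 1 + δ ^ 2 := by rw [hl]; field_simp
    have h10 : δ ^ 2 * (l * |ρ.1| * w ρ.1) = (∑ m ∈ s, C m + 1 + δ ^ 2) * (|ρ.1| * w ρ.1) := by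
      rw [← h9]; ring
    have h11 : 0 ≤ δ ^ 2 * (|ρ.1| * w ρ.1) :=
      mul_nonneg (sq_nonneg _) (mul_nonneg (abs_nonneg _) (hw0 _))
    linarith
  have hint : ∫ ρ, ∑ m ∈ s, G m ρ ∂μ = 0 := by
    rw [integral_finsetSum _ fun m _ => (hGint m).1]
    exact Finset.sum_eq_zero fun m _ => (hGint m).2
  have hae : ∀ᵐ ρ ∂μ, ρ ∈ μ.support := Measure.support_mem_ae
  have hnn : 0 ≤ᵐ[μ] fun ρ => ∑ m ∈ s, G m ρ := by
    filter_upwards [hae] with ρ hρ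
    exact (mul_nonneg (mul_nonneg (hκ0 _) hη0.le)
      (mul_nonneg (abs_nonneg _) (hw0 _))).trans (hlow ρ hρ)
  have hz := (integral_eq_zero_iff_of_nonneg_ae hnn
    (integrable_finsetSum _ fun m _ => (hGint m).1)).1 hint
  refine measure_mono_null ?_ (ae_iff.1 (hz.and hae))
  rintro ρ ⟨h1, h2⟩ ⟨h3, h4⟩
  have hpos := (hκpos _).2 h2
  have ht : 1 < |ρ.1| := not_le.1 fun h => absurd (hε ρ h4 h) (not_le.2 h2.2)
  have h5 := hlow ρ h4
  rw [show ∑ m ∈ s, G m ρ = 0 from h3] at h5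
  exact absurd h5 (not_le.2 (mul_pos (mul_pos hpos hη0) (mul_pos (by linarith) (hwpos _ h1))))

/-- If the measure equation holds on the whole phase space, `μ` vanishes in a uniform neighborhood
of the zero section. -/
lemma exists_measure_nhds_zero_section (hM : IsCompactC2Domain (n := n) M) {f : Phase n N → ℝ}
    (hf : Continuous f) {μ ν : Measure (Phase n N)} (hμ : IsMeasureOn univ μ)
    (hsupp : SupportAssumption g M univ μ) (heq : MeasureEquation g M univ f μ ν) :
    ∃ c > 0, μ {ρ | tau ρ ^ 2 + cometric g (base ρ) (cov ρ) (cov ρ) < c ^ 2} = 0 := by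
  obtain ⟨s, β, hβ, hcov⟩ := exists_bumps (n := n) hM.isCompact
  have he : ∀ m : N, chartAt (Eucl n) m ∈ IsManifold.maximalAtlas 𝓘(ℝ, Eucl n) 2 N :=
    fun m => IsManifold.chart_mem_maximalAtlas m
  have hK : IsCompact (⋃ m ∈ s, (ofCoord (chartAt (Eucl n) m) ''
      energyBox g (chartAt (Eucl n) m) (tsupport (β m)) 1 : Set (Phase n N))) :=
    s.isCompact_biUnion fun m _ => isCompact_image_ofCoord (he m)
      (isCompact_energyBox g (he m) (hβ m).2.1 (hβ m).2.2.1 1)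
      (energyBox_subset_region g (hβ m).2.2.1 1)
  -- This compact set contains every point of the support with |t| ≤ 1 and |τ| ≤ 1, since x ∈ M and
  -- p = 0 there. The resulting ε is fixed before the slabs are chosen.
  obtain ⟨ε, hε, hεK⟩ := exists_le_abs_tau g hsupp hK (subset_univ _)
  have hε' : ∀ ρ ∈ μ.support, |ρ.1| ≤ 1 → min ε 1 ≤ |tau ρ| := by
    intro ρ hρ ht
    by_cases hτ : |tau ρ| ≤ 1
    · refine (min_le_left _ _).trans (hεK ρ ⟨?_, hρ⟩)
      obtain ⟨hp, hb, -⟩ := hsupp ρ ⟨mem_univ _, hρ⟩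
      obtain ⟨m, hms, hm, hm2⟩ := hcov _ hb
      refine mem_biUnion hms ((mem_image_ofCoord (he m)
        (energyBox_subset_region g (hβ m).2.2.1 1)).2 ⟨hm, ht, ?_, hτ, ?_⟩)
      · exact subset_tsupport _ (ne_of_gt (by linarith : 0 < β m (chartAt (Eucl n) m (base ρ))))
      · rw [← symb_eq (he m) g hm, hp]; simp
    · exact (min_le_right _ _).trans (not_le.1 hτ).le
  have hpos : 0 < min ε 1 := lt_min hε one_pos
  -- The slabs exhaust 0 < |τ| < min(ε, 1), and τ never vanishes on the support.
  have hnull : μ (⋃ k : ℕ, {ρ : Phase n N | |ρ.1| < (k : ℝ) + 1 ∧ 1 / ((k : ℝ) + 1) < |tau ρ| ∧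
      |tau ρ| < min ε 1}) = 0 :=
    measure_iUnion_null fun k => measure_slab_eq_zero g hM hf hμ hsupp heq (min_le_right _ _) hε'
      (by positivity) (by positivity)
  refine ⟨min ε 1, hpos, measure_mono_null ?_
    (measure_union_null hnull (mem_ae_iff.1 (Measure.support_mem_ae (μ := μ))))⟩
  intro ρ hρ
  by_cases hs : ρ ∈ μ.support
  · left
    obtain ⟨hp, -, h0⟩ := hsupp ρ ⟨mem_univ _, hs⟩
    have hτ0 : 0 < |tau ρ| := abs_pos.2 fun h => h0 ⟨h, by_contra fun h' => by
      have := cometric_self_pos g h'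
      simp only [symb, h] at hp
      linarith⟩
    have hτ : |tau ρ| < min ε 1 := by
      have h1 : tau ρ ^ 2 + cometric g (base ρ) (cov ρ) (cov ρ) < min ε 1 ^ 2 := hρ
      have h2 := cometric_self_nonneg g (cov ρ)
      exact abs_lt_of_sq_lt_sq (by linarith) hpos.le
    obtain ⟨k₁, hk₁⟩ := exists_nat_gt |ρ.1|
    obtain ⟨k₂, hk₂⟩ := exists_nat_one_div_lt hτ0
    refine mem_iUnion.2 ⟨max k₁ k₂, ?_, ?_, hτ⟩
    · have : (k₁ : ℝ) ≤ (max k₁ k₂ : ℕ) := Nat.cast_le.2 (le_max_left _ _)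
      linarith
    · refine lt_of_le_of_lt ?_ hk₂
      have : (k₂ : ℝ) ≤ (max k₁ k₂ : ℕ) := Nat.cast_le.2 (le_max_right _ _)
      exact one_div_le_one_div_of_le (by positivity) (by linarith)
  · exact Or.inr hs

/-- A lift lies in the support of μ, where p = 0 and so τ² + |ξ|² = 2τ². This is at least c² because
the forbidden set is open and null; c/2 is a convenient value below c/√2. -/
lemma half_le_abs_tau_of_measure_eq_zero (hM : IsCompactC2Domain (n := n) M)
    {U : Set (Phase n N)} (hU : IsOpen U) {f : Phase n N → ℝ} {μ ν : Measure (Phase n N)}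
    [IsFiniteMeasureOnCompacts ν] (hsupp : SupportAssumption g M U μ)
    (heq : MeasureEquation g M U f μ ν) {c : ℝ} (hc : 0 < c)
    (h0 : μ {ρ | tau ρ ^ 2 + cometric g (base ρ) (cov ρ) (cov ρ) < c ^ 2} = 0) :
    ∀ ρ ∈ (ν.restrict (hyperbolic g M ∪ glancing g M)).support,
      (liftPlus g M ρ ∈ U ∨ liftMinus g M ρ ∈ U) → c / 2 ≤ |tau ρ| := by
  have hopen : IsOpen {ρ : Phase n N | 2 * tau ρ ^ 2 + symb g ρ < c ^ 2} :=
    isOpen_lt ((continuous_const.mul (continuous_tau.pow 2)).add (continuous_symb g))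
      continuous_const
  have hset : {ρ : Phase n N | tau ρ ^ 2 + cometric g (base ρ) (cov ρ) (cov ρ) < c ^ 2} =
      {ρ | 2 * tau ρ ^ 2 + symb g ρ < c ^ 2} := by
    ext ρ
    simp only [mem_ofPred_eq, symb]
    rw [show 2 * tau ρ ^ 2 + (-tau ρ ^ 2 + cometric g (base ρ) (cov ρ) (cov ρ)) =
      tau ρ ^ 2 + cometric g (base ρ) (cov ρ) (cov ρ) by ring]
  rw [hset] at h0
  have key : ∀ ρ ∈ (ν.restrict (hyperbolic g M ∪ glancing g M)).support, ∀ σ : ℝ,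
      (σ = 1 ∨ σ = -1) → shift g M (σ * Real.sqrt (-symb g ρ)) ρ ∈ U → c / 2 ≤ |tau ρ| := by
    intro ρ hρ σ hσ hl
    have hs := lift_mem_support g hM hU heq hρ hσ hl
    have hp := (hsupp _ ⟨hl, hs⟩).1
    by_contra hlt
    have hmem : shift g M (σ * Real.sqrt (-symb g ρ)) ρ ∈
        {ρ : Phase n N | 2 * tau ρ ^ 2 + symb g ρ < c ^ 2} := by
      show 2 * tau ρ ^ 2 + symb g (shift g M (σ * Real.sqrt (-symb g ρ)) ρ) < c ^ 2
      rw [hp, ← sq_abs]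
      nlinarith [abs_nonneg (tau ρ)]
    exact absurd h0 (ne_of_gt ((Measure.mem_support_iff_forall _).1 hs _ (hopen.mem_nhds hmem)))
  rintro ρ hρ (h | h)
  · exact key ρ hρ 1 (Or.inl rfl) (by rwa [one_mul])
  · exact key ρ hρ (-1) (Or.inr rfl) (by rwa [neg_one_mul])

/-- The bound for τ on the part of supp μ in K passes to the base point because shifting by the
conormal leaves τ unchanged. -/
lemma exists_abs_tau_ge_of_isCompact (hM : IsCompactC2Domain (n := n) M)
    {U : Set (Phase n N)} (hU : IsOpen U) {f : Phase n N → ℝ} {μ ν : Measure (Phase n N)}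
    [IsFiniteMeasureOnCompacts ν] (hsupp : SupportAssumption g M U μ)
    (heq : MeasureEquation g M U f μ ν) {K : Set (Phase n N)} (hKU : K ⊆ U) (hK : IsCompact K) :
    ∃ C > 0, ∀ ρ ∈ (ν.restrict (hyperbolic g M ∪ glancing g M)).support,
      (liftPlus g M ρ ∈ K ∨ liftMinus g M ρ ∈ K) → C ≤ |tau ρ| := by
  obtain ⟨C, hC, hCK⟩ := exists_le_abs_tau g hsupp hK hKU
  have key : ∀ ρ ∈ (ν.restrict (hyperbolic g M ∪ glancing g M)).support, ∀ σ : ℝ,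
      (σ = 1 ∨ σ = -1) → shift g M (σ * Real.sqrt (-symb g ρ)) ρ ∈ K → C ≤ |tau ρ| :=
    fun ρ hρ σ hσ hl => hCK (shift g M (σ * Real.sqrt (-symb g ρ)) ρ) ⟨hl, lift_mem_support g hM hU heq hρ hσ (hKU hl)⟩
  refine ⟨C, hC, ?_⟩
  rintro ρ hρ (h | h)
  · exact key ρ hρ 1 (Or.inl rfl) (by rwa [one_mul])
  · exact key ρ hρ (-1) (Or.inr rfl) (by rwa [neg_one_mul])

end

end

end GeometricWave

end

/-! ### The theorem. -/

open GeometricWave in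
theorem mainTheorem4 (n : ℕ) (N : Type*) [TopologicalSpace N] [T2Space N]
    [SecondCountableTopology N] [ChartedSpace (Eucl n) N] [IsManifold 𝓘(ℝ, Eucl n) 2 N]
    (g : Metric1 n N) (M : Set N) (hM : IsCompactC2Domain (n := n) M)
    (U : Set (Phase n N)) (hU : IsOpen U)
    (μ : Measure (Phase n N)) (hμ : IsMeasureOn U μ)
    (ν : Measure (Phase n N)) [IsFiniteMeasureOnCompacts ν]
    (hν : ν (tangentialBundle g M)ᶜ = 0)
    (f : Phase n N → ℝ) (hf : Continuous f)
    (hsupp : SupportAssumption g M U μ)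
    (heq : MeasureEquation g M U f μ ν) :
    ((U = univ ∨ ∃ c > 0, μ {ρ | tau ρ ^ 2 + cometric g (base ρ) (cov ρ) (cov ρ) < c ^ 2} = 0) →
      ∃ C > 0, ∀ ρ ∈ (ν.restrict (hyperbolic g M ∪ glancing g M)).support,
        (liftPlus g M ρ ∈ U ∨ liftMinus g M ρ ∈ U) → C ≤ |tau ρ|) ∧
    (∀ K ⊆ U, IsCompact K →
      ∃ C > 0, ∀ ρ ∈ (ν.restrict (hyperbolic g M ∪ glancing g M)).support,
        (liftPlus g M ρ ∈ K ∨ liftMinus g M ρ ∈ K) → C ≤ |tau ρ|) ∧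
    ν (U ∩ (diffractive g M ∪ glancing3 g M)) = 0 ∧
    μ (diffractive g M) = 0 := by
  refine ⟨?_, fun K hKU hK => exists_abs_tau_ge_of_isCompact g hM hU hsupp heq hKU hK,
    measure_diffractive_union_glancing3 g hM hU hf hμ heq, measure_diffractive g hU hf hμ heq⟩
  rintro (rfl | ⟨c, hc, h0⟩)
  · obtain ⟨c, hc, h0⟩ := exists_measure_nhds_zero_section g hM hf hμ hsupp heq
    exact ⟨c / 2, half_pos hc, half_le_abs_tau_of_measure_eq_zero g hM hU hsupp heq hc h0⟩
  · exact ⟨c / 2, half_pos hc, half_le_abs_tau_of_measure_eq_zero g hM hU hsupp heq hc h0⟩
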